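/- **Corollary (Inversions in finite Coxeter groups).** Let $(W,S)$ be a finite irreducible Coxeter system of rank $n=|S|\ge 1$, with length function $\ell$, and let $X$ be a random variable whose distribution is that of $\ell(w)$ for $w\in W$ uniformly random, i.e. $\mathbb{P}(X=k)=\#\{w\in W:\ell(w)=k\}/|W|$ for all integers $k\ge 0$. Let $d_1,\dots,d_n$ be the degrees of $W$, that is, the degrees of homogeneous, algebraically independent generators of the algebra of $W$-invariant polynomials on the geometric (reflection) representation; let $\Phi^+$ be the set of positive roots of $W$, and $h$ its Coxeter number (the order of a Coxeter element, i.e. of a product of all simple reflections, each taken once, in any order). Let $\kappa_r(X)$ be the $r$-th cumulant, defined by $\ln\mathbb{E}(e^{tX})=\sum_{r\ge 1}\kappa_r(X)\,t^r/r!$ near $t=0$, and let $B_r$ be the Bernoulli numbers with $\sum_{r\ge 0}B_r\,t^r/r!=t/(1-e^{-t})$ (so $B_1=+\tfrac12$). Define $\gamma$ as follows. If $W$ is the Weyl group of a reduced crystallographic root system, with highest root $\widetilde\alpha$ and highest short root $\widetilde\alpha_s$ (all roots count as short if they have the same length), put $$\gamma=\frac{\langle\widetilde\alpha,\widetilde\alpha\rangle}{\langle\widetilde\alpha_s,\widetilde\alpha_s\rangle}\,g\,g^\vee,$$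 where $g$ and $g^\vee$ are the dual Coxeter numbers of the root system and of its dual; the dual Coxeter number of an irreducible root system is $1$ plus the height of the coroot of its highest root with respect to the simple coroots. In the noncrystallographic types, put $\gamma=124$ for $H_3$, $\gamma=1116$ for $H_4$, and $\gamma=2m^2-5m+6$ for $I_2(m)$ ($m=5$ or $m\ge 7$). Then for every integer $r\ge 1$, $$\kappa_r(X)=\frac{B_r}{r}\sum_{i=1}^n\left(d_i^r-1\right),$$ and the expectation and the variance of $X$ are $$\mathbb{E}(X)=\frac{|\Phi^+|}{2},\qquad \mathbb{V}(X)=\frac{n(\gamma+5h+h^2)}{72}.$$ -/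

import Mathlib

noncomputable section

/-! ### The geometric representation of a Coxeter group -/

namespace CoxeterMatrix

/-- `M` is irreducible: its Coxeter diagram, in which two distinct vertices `i`, `j` are joined
when `M i j ≠ 2`, is connected (in particular nonempty). -/
def IsIrreducible {B : Type*} (M : CoxeterMatrix B) : Prop :=
  (SimpleGraph.fromRel fun i j : B => M i j ≠ 2).Connected

variable {B : Type*} [Fintype B] [DecidableEq B] (M : CoxeterMatrix B)

/-- The linear form `v ↦ 2 ⟨α_i, v⟩` on `ℝ^B`, where `⟨α_i, α_j⟩ = -cos (π / M i j)` on the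
standard basis `α`. (When `M i j = 0`, which stands for `∞`, Lean's `π / 0 = 0` gives the usual
value `⟨α_i, α_j⟩ = -1`.) -/
def simpleForm {B : Type*} [Fintype B] (M : CoxeterMatrix B) (i : B) : Module.Dual ℝ (B → ℝ) :=
  ∑ j, (-2 * Real.cos (Real.pi / M i j)) • LinearMap.proj j

lemma simpleForm_single (i j : B) :
    M.simpleForm i (Pi.single j 1) = -2 * Real.cos (Real.pi / M i j) := by
  simp [simpleForm, Pi.single_apply]

lemma simpleForm_self (i : B) : M.simpleForm i (Pi.single i 1) = 2 := by
  simp [simpleForm_single]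

/-- The simple reflection `v ↦ v - 2 ⟨α_i, v⟩ α_i` of `ℝ^B`. -/
def simpleReflection (i : B) : (B → ℝ) ≃ₗ[ℝ] (B → ℝ) :=
  Module.reflection (M.simpleForm_self i)

/-- The simple reflections satisfy the Coxeter relations. -/
lemma simpleReflection_isLiftable : M.IsLiftable M.simpleReflection := by
  intro i j
  by_cases hij : i = j
  · subst hij
    rw [M.diagonal, pow_one]
    ext1 v
    exact Module.involutive_reflection (M.simpleForm_self i) v
  obtain h0 | h2 | h3 : M i j = 0 ∨ M i j = 2 ∨ 3 ≤ M i j := by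
    have := M.off_diagonal i j hij
    omega
  · rw [h0, pow_zero]
  · have hf : M.simpleForm i (Pi.single j 1) = 0 := by simp [simpleForm_single, h2]
    have hg : M.simpleForm j (Pi.single i 1) = 0 := by
      simp [simpleForm_single, M.symmetric j i, h2]
    rw [h2]
    ext1 v
    simp only [pow_two, LinearEquiv.mul_apply, simpleReflection, Module.reflection_apply,
      map_sub, map_smul, hf, hg, simpleForm_self, LinearEquiv.coe_one, id_eq]
    module
  · set m := M i j with hm
    set φ : ℝ := 2 * (Real.pi / m) with hφ
    have hm0 : (0 : ℝ) < m := by positivity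
    have hs : Real.sin φ ≠ 0 := by
      refine (Real.sin_pos_of_pos_of_lt_pi (by positivity) ?_).ne'
      rw [hφ, ← mul_div_assoc, div_lt_iff₀ hm0]
      have : (3 : ℝ) ≤ m := by exact_mod_cast h3
      nlinarith [Real.pi_pos]
    have hmφ : (m : ℝ) * φ = 2 * Real.pi := by rw [hφ]; field_simp
    have ht : 2 * Real.cos φ =
        M.simpleForm i (Pi.single j 1) * M.simpleForm j (Pi.single i 1) - 2 := by
      rw [simpleForm_single, simpleForm_single, M.symmetric j i, ← hm, hφ, Real.cos_two_mul]
      ring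
    have key := Polynomial.Chebyshev.S_two_mul_real_cos φ
    have c1 : (Polynomial.Chebyshev.S ℝ (((m : ℤ) - 2) / 2)).eval (2 * Real.cos φ) *
        ((Polynomial.Chebyshev.S ℝ (((m : ℤ) - 1) / 2)).eval (2 * Real.cos φ) +
          (Polynomial.Chebyshev.S ℝ (((m : ℤ) - 3) / 2)).eval (2 * Real.cos φ)) = 0 ∧
        (Polynomial.Chebyshev.S ℝ (((m : ℤ) - 1) / 2)).eval (2 * Real.cos φ) *
        ((Polynomial.Chebyshev.S ℝ ((m : ℤ) / 2)).eval (2 * Real.cos φ) +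
          (Polynomial.Chebyshev.S ℝ (((m : ℤ) - 2) / 2)).eval (2 * Real.cos φ)) = 0 := by
      obtain ⟨k, hk⟩ | ⟨k, hk⟩ := Nat.even_or_odd m
      · have e1 : ((m : ℤ) - 2) / 2 = k - 1 := by omega
        have e2 : ((m : ℤ) - 1) / 2 = k - 1 := by omega
        have hz : (Polynomial.Chebyshev.S ℝ ((k : ℤ) - 1)).eval (2 * Real.cos φ) = 0 := by
          have := key (k - 1)
          have hk' : (((k : ℤ) - 1 : ℤ) + 1 : ℝ) * φ = Real.pi := by
            have : (m : ℝ) = k + k := by exact_mod_cast hk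
            rw [this] at hmφ
            push_cast
            linarith
          rw [hk', Real.sin_pi] at this
          exact (mul_eq_zero.mp this).resolve_right hs
        rw [e1, e2, hz]
        simp
      · have e1 : ((m : ℤ) - 2) / 2 = k - 1 := by omega
        have e2 : ((m : ℤ) - 1) / 2 = k := by omega
        have e3 : ((m : ℤ) - 3) / 2 = k - 1 := by omega
        have e4 : (m : ℤ) / 2 = k := by omega
        have hz : (Polynomial.Chebyshev.S ℝ (k : ℤ)).eval (2 * Real.cos φ) +
            (Polynomial.Chebyshev.S ℝ ((k : ℤ) - 1)).eval (2 * Real.cos φ) = 0 := by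
          have h1 := key k
          have h2 := key (k - 1)
          have hk' : (((k : ℤ) : ℝ) + 1) * φ =
              2 * Real.pi - (((k : ℤ) - 1 : ℤ) + 1 : ℝ) * φ := by
            have : (m : ℝ) = 2 * k + 1 := by exact_mod_cast hk
            rw [this] at hmφ
            push_cast
            linarith
          rw [hk', Real.sin_two_pi_sub] at h1
          refine (mul_eq_zero.mp ?_).resolve_right hs
          rw [add_mul, h1, h2]
          ring
        rw [e1, e2, e3, e4, hz]
        simp
    ext1 v
    rw [simpleReflection, simpleReflection,
      Module.reflection_mul_reflection_pow_apply (M.simpleForm_self i) (M.simpleForm_self j) m v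
        (2 * Real.cos φ) ht, c1.1, c1.2]
    simp

end CoxeterMatrix

namespace CoxeterSystem

section geometric

variable {B W : Type*} [Fintype B] [DecidableEq B] [Group W] {M : CoxeterMatrix B}
  (cs : CoxeterSystem M W)

/-- The geometric representation of `W` on `ℝ^B`: the simple generator `s_i` acts as the
reflection `v ↦ v - 2 ⟨α_i, v⟩ α_i`. -/
def geometricRep : W →* ((B → ℝ) ≃ₗ[ℝ] (B → ℝ)) :=
  cs.lift ⟨M.simpleReflection, M.simpleReflection_isLiftable⟩

/-- The root system `Φ = {w α_i}` of the Coxeter system. -/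
def roots : Set (B → ℝ) := {v | ∃ (w : W) (i : B), v = cs.geometricRep w (Pi.single i 1)}

/-- The positive roots `Φ⁺`: the roots that are nonnegative combinations of the simple roots. -/
def positiveRoots : Set (B → ℝ) := {v ∈ cs.roots | ∀ i, 0 ≤ v i}

/-- The algebra of `W`-invariant polynomial functions on the geometric representation. -/
def invariantPolynomials : Subalgebra ℝ (MvPolynomial B ℝ) where
  carrier := {p | ∀ (w : W) (v : B → ℝ),
    MvPolynomial.eval (cs.geometricRep w v) p = MvPolynomial.eval v p}
  mul_mem' := by
    intro p q hp hq w v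
    simp [hp w v, hq w v]
  add_mem' := by
    intro p q hp hq w v
    simp [hp w v, hq w v]
  algebraMap_mem' := by
    intro r w v
    simp [MvPolynomial.algebraMap_eq]

/-- `d_1, …, d_n` (with `n` the rank) are the degrees of `W`: the algebra of invariant polynomials
is freely generated by homogeneous polynomials `f_1, …, f_n` of degrees `d_1, …, d_n`. -/
def IsDegrees (d : Fin (Fintype.card B) → ℕ) : Prop :=
  ∃ f : Fin (Fintype.card B) → MvPolynomial B ℝ,
    (∀ k, (f k).IsHomogeneous (d k)) ∧ AlgebraicIndependent ℝ f ∧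
      Algebra.adjoin ℝ (Set.range f) = cs.invariantPolynomials

end geometric

/-- A Coxeter element: a product of all the simple reflections, each taken once, in some order. -/
def IsCoxeterElement {B W : Type*} [Group W] {M : CoxeterMatrix B} (cs : CoxeterSystem M W)
    (c : W) : Prop :=
  ∃ l : List B, l.Nodup ∧ (∀ i, i ∈ l) ∧ c = cs.wordProd l

/-- `h` is the Coxeter number of `W`: the order of a Coxeter element. -/
def IsCoxeterNumber {B W : Type*} [Group W] {M : CoxeterMatrix B} (cs : CoxeterSystem M W)
    (h : ℕ) : Prop :=
  ∃ c : W, cs.IsCoxeterElement c ∧ h = orderOf c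

end CoxeterSystem

/-! ### Highest roots and dual Coxeter numbers of crystallographic root systems -/

namespace RootPairing.Base

variable {ι V N : Type*} [AddCommGroup V] [Module ℝ V] [AddCommGroup N] [Module ℝ N]
  {P : RootPairing ι ℝ V N} (b : P.Base)

/-- The root with index `θ` is the highest root: for every root `β`, the difference `θ - β` is a
sum of simple roots. -/
def IsHighestRoot (θ : ι) : Prop :=
  ∀ j, P.root θ - P.root j ∈ AddSubmonoid.closure (P.root '' b.support)

/-- The root with index `i` is short: it has minimal length among all roots, for the invariant
inner product. (If all roots have the same length, they are all short.) -/
def _root_.RootPairing.IsShortRoot [Fintype ι] (P : RootPairing ι ℝ V N) (i : ι) : Prop :=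
  ∀ j, P.RootForm (P.root i) (P.root i) ≤ P.RootForm (P.root j) (P.root j)

/-- The root with index `θ` is the highest short root. -/
def IsHighestShortRoot [Fintype ι] (θ : ι) : Prop :=
  P.IsShortRoot θ ∧
    ∀ j, P.IsShortRoot j → P.root θ - P.root j ∈ AddSubmonoid.closure (P.root '' b.support)

/-- `g` is the dual Coxeter number `1 + ⟨ρ, θ^∨⟩`, where `θ` is the highest root; here `⟨ρ, θ^∨⟩`
is the height of the coroot `θ^∨` with respect to the simple coroots. -/
def IsDualCoxeterNumber (g : ℤ) : Prop :=
  ∃ θ, b.IsHighestRoot θ ∧ g = 1 + b.flip.height θ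

end RootPairing.Base

/-! ### The constant `γ` of a finite irreducible Coxeter group -/

/-- `cs.IsGamma γ` says that `γ` is the constant attached to the irreducible Coxeter system `cs`.
If `W` is the Weyl group of a reduced crystallographic root system `Φ`, then
`γ = (⟨θ, θ⟩ / ⟨θ_s, θ_s⟩) g g^∨` with `θ` the highest root, `θ_s` the highest short root, and
`g`, `g^∨` the dual Coxeter numbers of `Φ` and of the dual root system; in the noncrystallographic
types `H₃`, `H₄` and `I₂(m)`, `γ` is given by a table. -/
inductive CoxeterSystem.IsGamma {B W : Type*} [Group W] {M : CoxeterMatrix B}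
    (cs : CoxeterSystem M W) : ℝ → Prop
  | weyl {ι V N : Type} [Fintype ι] [AddCommGroup V] [Module ℝ V] [AddCommGroup N] [Module ℝ N]
      (P : RootPairing ι ℝ V N) [P.IsRootSystem] [P.IsCrystallographic] [P.IsReduced]
      (b : P.Base) (e : B ≃ b.support) (f : W ≃* P.weylGroup)
      (hf : ∀ i, f (cs.simple i) = RootPairing.weylGroup.ofIdx P (e i))
      (θ θs : ι) (g g' : ℤ) (hθ : b.IsHighestRoot θ) (hθs : b.IsHighestShortRoot θs)
      (hg : b.IsDualCoxeterNumber g) (hg' : b.flip.IsDualCoxeterNumber g') :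
      CoxeterSystem.IsGamma cs
        (P.RootForm (P.root θ) (P.root θ) / P.RootForm (P.root θs) (P.root θs) * g * g')
  | typeH3 (e : B ≃ Fin 3) (hM : M.reindex e = CoxeterMatrix.H₃) : CoxeterSystem.IsGamma cs 124
  | typeH4 (e : B ≃ Fin 4) (hM : M.reindex e = CoxeterMatrix.H₄) : CoxeterSystem.IsGamma cs 1116
  | typeI2 (m : ℕ) (hm : m = 5 ∨ 7 ≤ m) (e : B ≃ Fin 2)
      (hM : M.reindex e = CoxeterMatrix.I (m - 2)) :
      CoxeterSystem.IsGamma cs (2 * (m : ℝ) ^ 2 - 5 * m + 6)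

/-! ### Cumulants -/

/-- The `r`-th cumulant of a real random variable: the coefficient of `t ^ r / r!` in the Taylor
expansion at `0` of the cumulant generating function `log E[exp (t X)]`. -/
def ProbabilityTheory.cumulant {Ω : Type*} [MeasurableSpace Ω] (X : Ω → ℝ)
    (μ : MeasureTheory.Measure Ω) (r : ℕ) : ℝ :=
  iteratedDeriv r (ProbabilityTheory.cgf X μ) 0

end

/-!
Everything is computed from the action of `W` on its roots in the geometric representation, whose
invariant form is normalised by `(α_i, α_i) = 2`.

*Cumulants.* By Solomon's formula `∑_w t ^ ℓ(w) = ∏_i ((1 - t ^ d_i) / (1 - t))`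
(`CoxeterSystem.poincare_mul_pow`), the moment generating function of `X` is
`∏_i (E(d_i t) / E(t))` with `E(t) = (e ^ t - 1) / t`, and the Taylor coefficients of `log E` are
given by the Bernoulli numbers, since `t (log E)' + 1 = t e ^ t / (e ^ t - 1)`. Solomon's formula
needs no structure theory of the ring of invariants: the alternating sum of the permutation
characters on the cosets of the standard parabolic subgroups is the sign character
(`CoxeterSystem.sum_permChar_eq_sgn`), the anti-invariant polynomials are the multiples of the
product of the positive roots by invariants, and comparing dimensions shows that Poincaré series
times Hilbert series of the invariants is the same for all parabolic subgroups
(`CoxeterSystem.poincare_mul_hilbert`); the hypothesis on the degrees evaluates the Hilbert series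
of the invariants of `W`.

*Mean and variance.* The length counts the positive roots made negative, so mean and variance of
`X` are governed by the signs of the roots `w α`. Since `α` and `-α` have opposite signs, the mean
is half the number of positive roots. For two roots at angle `θ` the correlation of the signs of
`w α` and `w β` is `1 - 2 θ / π` (`CoxeterSystem.signCorr_eq`), obtained by counting sign changes
along the roots of the dihedral group generated by the two reflections. Averaging over `W` turns
the variance into `1/16` of the sum of the squared correlations over all pairs of roots
(`CoxeterSystem.sum_length_sub_sq`); no degrees enter.

*The constant `γ`.* The number of roots is `n h` (`CoxeterSystem.two_mul_card_posRoots`): a Coxeter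
element is conjugate to the product of two families of commuting reflections, which acts on a
plane, spanned by means of a Perron–Frobenius eigenvector, as a dihedral rotation. For a Weyl
group, `c = 4 cos² θ` is an integer on which the squared correlation depends affinely (apart from
pairs of equal or opposite roots, which are counted separately) as soon as the lengths of the two
roots are fixed, and the roots of each length form a tight frame (`CoxeterSystem.sum_cosForm_sq`),
so the sum of squared correlations is determined by the numbers of long and of short roots. These
are expressed by `h` and by the two dual Coxeter numbers, because the sum of the squares of the
pairings of all roots with the highest coroot is four times the dual Coxeter number
(`RootPairing.Base.IsHighestRoot.sum_pairing_sq`). For the dihedral groups and for `H₃`, `H₄` the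
roots are listed explicitly, the latter two with coordinates in `ℤ[φ]`.
-/

set_option linter.unusedSectionVars false
set_option linter.unusedSimpArgs false

noncomputable section

open CoxeterSystem

/-! ### The geometric representation: roots and length -/

/-- The sequence `0, 1, c, c² - 1, …` with `a (k + 2) = c * a (k + 1) - a k`; for `c = 2 cos θ` it is
`sin (k θ) / sin θ`. It records the coefficients of the roots of a dihedral group. -/
def recSeq (c : ℝ) : ℕ → ℝ
  | 0 => 0
  | 1 => 1
  | k + 2 => c * recSeq c (k + 1) - recSeq c k

lemma recSeq_add_two (c : ℝ) (k : ℕ) : recSeq c (k + 2) = c * recSeq c (k + 1) - recSeq c k := rfl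

lemma recSeq_two_mul_cos_mul_sin (θ : ℝ) (k : ℕ) :
    recSeq (2 * Real.cos θ) k * Real.sin θ = Real.sin (k * θ) := by
  induction k using Nat.twoStepInduction with
  | zero => simp [recSeq]
  | one => simp [recSeq]
  | more k h1 h2 =>
    rw [recSeq_add_two, sub_mul, mul_assoc, h1, h2]
    have e1 : ((k + 2 : ℕ) : ℝ) * θ = ((k + 1 : ℕ) : ℝ) * θ + θ := by push_cast; ring
    have e2 : (k : ℝ) * θ = ((k + 1 : ℕ) : ℝ) * θ - θ := by push_cast; ring
    rw [e1, e2, Real.sin_add, Real.sin_sub]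
    ring

lemma recSeq_two (k : ℕ) : recSeq 2 k = k := by
  induction k using Nat.twoStepInduction with
  | zero => simp [recSeq]
  | one => simp [recSeq]
  | more k h1 h2 => rw [recSeq_add_two, h1, h2]; push_cast; ring

/-- The coefficients of the roots of a dihedral group of order `2 m` stay nonnegative for the first
`m` steps (and for ever when `m = 0`, which stands for `∞`). -/
lemma recSeq_nonneg {m : ℕ} (hm : m ≠ 1) {k : ℕ} (hk : m = 0 ∨ k ≤ m) :
    0 ≤ recSeq (2 * Real.cos (Real.pi / m)) k := by
  obtain rfl | h2 : m = 0 ∨ 2 ≤ m := by omega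
  · simp [recSeq_two]
  have hm0 : (2 : ℝ) ≤ m := by exact_mod_cast h2
  have hs : 0 < Real.sin (Real.pi / m) := by
    apply Real.sin_pos_of_pos_of_lt_pi
    · positivity
    · rw [div_lt_iff₀ (by positivity)]; nlinarith [Real.pi_pos]
  have h := recSeq_two_mul_cos_mul_sin (Real.pi / m) k
  refine nonneg_of_mul_nonneg_left ?_ hs
  rw [h]
  apply Real.sin_nonneg_of_nonneg_of_le_pi
  · positivity
  · have : (k : ℝ) ≤ m := by exact_mod_cast hk.resolve_left (by omega)
    rw [mul_div_assoc', div_le_iff₀ (by positivity)]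
    nlinarith [Real.pi_pos]

namespace CoxeterMatrix

variable {B : Type*} [Fintype B] [DecidableEq B] (M : CoxeterMatrix B)

/-- The invariant symmetric bilinear form on `ℝ^B`, normalised so that `(α_i, α_i) = 2`. -/
def cosForm : LinearMap.BilinForm ℝ (B → ℝ) :=
  LinearMap.mk₂ ℝ (fun u v => ∑ i, u i * M.simpleForm i v)
    (by intros; simp [add_mul, Finset.sum_add_distrib])
    (by intros; simp [Finset.mul_sum, mul_assoc])
    (by intros; simp [mul_add, Finset.sum_add_distrib])
    (by intros; simp [Finset.mul_sum, mul_left_comm])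

lemma cosForm_apply (u v : B → ℝ) : M.cosForm u v = ∑ i, u i * M.simpleForm i v := rfl

lemma cosForm_single (i : B) (v : B → ℝ) : M.cosForm (Pi.single i 1) v = M.simpleForm i v := by
  rw [cosForm_apply, Finset.sum_eq_single i] <;> simp +contextual [Pi.single_apply]

lemma simpleForm_apply (i : B) (v : B → ℝ) :
    M.simpleForm i v = ∑ j, (-2 * Real.cos (Real.pi / M i j)) * v j := by
  simp [simpleForm]

lemma cosForm_comm (u v : B → ℝ) : M.cosForm u v = M.cosForm v u := by
  simp only [cosForm_apply, simpleForm_apply, Finset.mul_sum]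
  rw [Finset.sum_comm]
  refine Finset.sum_congr rfl fun i _ => Finset.sum_congr rfl fun j _ => ?_
  rw [M.symmetric j i]
  ring

lemma simpleReflection_apply (i : B) (v : B → ℝ) :
    M.simpleReflection i v = v - M.simpleForm i v • Pi.single i 1 := by
  simp [simpleReflection, Module.reflection_apply]

lemma cosForm_simpleReflection (i : B) (u v : B → ℝ) :
    M.cosForm (M.simpleReflection i u) (M.simpleReflection i v) = M.cosForm u v := by
  simp only [simpleReflection_apply, map_sub, LinearMap.sub_apply, map_smul, LinearMap.smul_apply,
    cosForm_single, M.cosForm_comm u (Pi.single i 1), simpleForm_self, smul_eq_mul]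
  ring

end CoxeterMatrix

namespace CoxeterSystem

variable {B W : Type*} [Fintype B] [DecidableEq B] [Group W] {M : CoxeterMatrix B}
  (cs : CoxeterSystem M W)

lemma geometricRep_simple (i : B) : cs.geometricRep (cs.simple i) = M.simpleReflection i := by
  simp [geometricRep]

lemma geometricRep_simple_apply (i : B) (v : B → ℝ) :
    cs.geometricRep (cs.simple i) v = v - M.simpleForm i v • Pi.single i 1 := by
  rw [geometricRep_simple, CoxeterMatrix.simpleReflection_apply]

lemma geometricRep_mul_apply (w w' : W) (v : B → ℝ) :
    cs.geometricRep (w * w') v = cs.geometricRep w (cs.geometricRep w' v) := by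
  rw [map_mul]; rfl

lemma geometricRep_one_apply (v : B → ℝ) : cs.geometricRep 1 v = v := by
  rw [map_one]; rfl

lemma geometricRep_inv_apply_self (w : W) (v : B → ℝ) :
    cs.geometricRep w⁻¹ (cs.geometricRep w v) = v := by
  rw [← geometricRep_mul_apply, inv_mul_cancel, geometricRep_one_apply]

lemma geometricRep_apply_inv_self (w : W) (v : B → ℝ) :
    cs.geometricRep w (cs.geometricRep w⁻¹ v) = v := by
  rw [← geometricRep_mul_apply, mul_inv_cancel, geometricRep_one_apply]

lemma cosForm_geometricRep (w : W) (u v : B → ℝ) :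
    M.cosForm (cs.geometricRep w u) (cs.geometricRep w v) = M.cosForm u v := by
  induction w using cs.simple_induction_left generalizing u v with
  | one => simp only [geometricRep_one_apply]
  | mul_simple_left w i ih =>
    rw [geometricRep_mul_apply, geometricRep_mul_apply, geometricRep_simple,
      CoxeterMatrix.cosForm_simpleReflection, ih]

lemma geometricRep_simple_self (i : B) :
    cs.geometricRep (cs.simple i) (Pi.single i 1) = -Pi.single i 1 := by
  rw [geometricRep_simple_apply, CoxeterMatrix.simpleForm_self, two_smul]
  abel

/-- The image of `α_i` under the alternating word `… s_i s_j` of length `k`. -/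
lemma geometricRep_alternatingWord (i j : B) (k : ℕ) :
    cs.geometricRep (cs.wordProd (alternatingWord i j k)) (Pi.single i 1) =
      if Even k then
        recSeq (2 * Real.cos (Real.pi / M i j)) (k + 1) • Pi.single i 1 +
          recSeq (2 * Real.cos (Real.pi / M i j)) k • Pi.single j 1
      else recSeq (2 * Real.cos (Real.pi / M i j)) k • Pi.single i 1 +
          recSeq (2 * Real.cos (Real.pi / M i j)) (k + 1) • Pi.single j 1 := by
  induction k with
  | zero => simp [alternatingWord, recSeq, geometricRep_one_apply]
  | succ k ih =>
    rw [alternatingWord_succ', wordProd_cons, geometricRep_mul_apply, ih]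
    by_cases hk : Even k
    · have hk' : ¬ Even (k + 1) := by simpa [Nat.even_add_one] using hk
      simp only [hk, hk', if_true, if_false, map_add, map_smul, geometricRep_simple_self,
        recSeq_add_two]
      rw [geometricRep_simple_apply, CoxeterMatrix.simpleForm_single, M.symmetric j i]
      module
    · have hk' : Even (k + 1) := by simpa [Nat.even_add_one] using hk
      simp only [hk, hk', if_true, if_false, map_add, map_smul, geometricRep_simple_self,
        recSeq_add_two]
      rw [geometricRep_simple_apply, CoxeterMatrix.simpleForm_single]
      module

lemma wordProd_alternatingWord_mul_simple (i j : B) (k : ℕ) :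
    cs.wordProd (alternatingWord i j k) * cs.simple i =
      cs.wordProd (alternatingWord j i (k + 1)) := by
  rw [alternatingWord_succ, List.concat_eq_append, wordProd_append, wordProd_singleton]

/-- If `s_i` lengthens `w` on the right, then `w α_i` is a nonnegative combination of simple roots.
By induction on the length: write `w = v u` with `u` an alternating word in `s_i`, `s_j` ending in
`s_j`, as long as possible; then neither `s_i` nor `s_j` shortens `v`, and `u α_i` is a nonnegative
combination of `α_i` and `α_j`. -/
theorem geometricRep_single_nonneg (w : W) (i : B)
    (h : cs.length w < cs.length (w * cs.simple i)) :
    0 ≤ cs.geometricRep w (Pi.single i 1) := by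
  induction hn : cs.length w using Nat.strong_induction_on generalizing w i with
  | _ n ih =>
  subst hn
  by_cases hw : w = 1
  · subst hw
    rw [geometricRep_one_apply]
    exact Pi.single_nonneg.mpr zero_le_one
  obtain ⟨j, hj⟩ := cs.exists_rightDescent_of_ne_one hw
  have hij : i ≠ j := by
    rintro rfl
    exact absurd hj (by unfold IsRightDescent; omega)
  classical
  let Q : ℕ → Prop := fun k => ∃ v, w = v * cs.wordProd (alternatingWord i j k) ∧
    cs.length v + k = cs.length w
  have hQ1 : Q 1 := ⟨w * cs.simple j, by
    simp [alternatingWord], by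
    have := (cs.isRightDescent_iff).mp hj
    omega⟩
  have hQle : ∀ k, Q k → k ≤ cs.length w := by
    rintro k ⟨v, -, hv⟩
    omega
  set k := Nat.findGreatest Q (cs.length w) with hk
  have hQk : Q k := Nat.findGreatest_spec (hQle 1 hQ1) hQ1
  have hk1 : 1 ≤ k := Nat.le_findGreatest (hQle 1 hQ1) hQ1
  have hQk' : ¬ Q (k + 1) := fun h => by
    have := Nat.le_findGreatest (hQle _ h) h
    omega
  obtain ⟨v, hv, hlv⟩ := hQk
  -- the next letter of the alternating word is not a descent of `v`, by maximality of `k`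
  have hnext : ¬ cs.IsRightDescent v (if Even k then j else i) := by
    intro hd
    refine hQk' ⟨v * cs.simple (if Even k then j else i), ?_, ?_⟩
    · rw [alternatingWord_succ', wordProd_cons, ← mul_assoc, mul_assoc v, simple_mul_simple_self,
        mul_one, ← hv]
    · have := (cs.isRightDescent_iff).mp hd
      omega
  have hprev : ¬ cs.IsRightDescent v (if Even k then i else j) := by
    intro hd
    obtain ⟨k', hk'⟩ : ∃ k', k = k' + 1 := ⟨k - 1, by omega⟩
    have hd' := (cs.isRightDescent_iff).mp hd
    have e : (if Even k then i else j) = if Even k' then j else i := by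
      simp only [hk', Nat.even_add_one]; split_ifs <;> rfl
    have : w = (v * cs.simple (if Even k then i else j)) *
        cs.wordProd (alternatingWord i j k') := by
      rw [hv, hk', alternatingWord_succ', wordProd_cons, ← hk', e, mul_assoc]
    have h1 := cs.length_mul_le (v * cs.simple (if Even k then i else j))
      (cs.wordProd (alternatingWord i j k'))
    rw [← this] at h1
    have h2 := cs.length_wordProd_le (alternatingWord i j k')
    rw [length_alternatingWord] at h2
    omega
  have hvi : ¬ cs.IsRightDescent v i := by split_ifs at hnext hprev <;> assumption
  have hvj : ¬ cs.IsRightDescent v j := by split_ifs at hnext hprev <;> assumption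
  have hkm : M i j = 0 ∨ k + 1 ≤ M i j := by
    by_contra! hcon
    have hred := cs.not_isReduced_alternatingWord j i (m := k + 1)
      (by rw [M.symmetric]; exact hcon.1) (by rw [M.symmetric]; exact hcon.2)
    have hle := cs.length_wordProd_le (alternatingWord j i (k + 1))
    have hwi : w * cs.simple i = v * cs.wordProd (alternatingWord j i (k + 1)) := by
      rw [hv, mul_assoc, wordProd_alternatingWord_mul_simple]
    have h1 := cs.length_mul_le v (cs.wordProd (alternatingWord j i (k + 1)))
    rw [← hwi] at h1
    rw [length_alternatingWord] at hle
    rw [IsReduced, length_alternatingWord] at hred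
    have h2 := cs.length_mul_simple w i
    omega
  have hM : M i j ≠ 1 := M.off_diagonal i j hij
  have h1 := ih (cs.length v) (by omega) v i
    (by rw [(cs.not_isRightDescent_iff).mp hvi]; omega) rfl
  have h2 := ih (cs.length v) (by omega) v j
    (by rw [(cs.not_isRightDescent_iff).mp hvj]; omega) rfl
  have a1 := recSeq_nonneg hM hkm
  have a2 := recSeq_nonneg (k := k) hM (by omega)
  rw [hv, geometricRep_mul_apply, geometricRep_alternatingWord]
  split_ifs
  · rw [map_add, map_smul, map_smul]
    exact add_nonneg (smul_nonneg a1 h1) (smul_nonneg a2 h2)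
  · rw [map_add, map_smul, map_smul]
    exact add_nonneg (smul_nonneg a2 h1) (smul_nonneg a1 h2)

lemma geometricRep_single_nonpos (w : W) (i : B)
    (h : cs.length (w * cs.simple i) < cs.length w) :
    cs.geometricRep w (Pi.single i 1) ≤ 0 := by
  have := cs.geometricRep_single_nonneg (w * cs.simple i) i (by simpa using h)
  rw [geometricRep_mul_apply, geometricRep_simple_self, map_neg] at this
  simpa using this

lemma single_mem_roots (i : B) : (Pi.single i 1 : B → ℝ) ∈ cs.roots :=
  ⟨1, i, by rw [geometricRep_one_apply]⟩

variable {cs} in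
lemma geometricRep_mem_roots (w : W) {β : B → ℝ} (h : β ∈ cs.roots) :
    cs.geometricRep w β ∈ cs.roots := by
  obtain ⟨w', i, rfl⟩ := h
  exact ⟨w * w', i, by rw [geometricRep_mul_apply]⟩

variable {cs} in
lemma cosForm_self_of_mem_roots {β : B → ℝ} (h : β ∈ cs.roots) : M.cosForm β β = 2 := by
  obtain ⟨w, i, rfl⟩ := h
  rw [cosForm_geometricRep, CoxeterMatrix.cosForm_single, CoxeterMatrix.simpleForm_self]

variable {cs} in
lemma ne_zero_of_mem_roots {β : B → ℝ} (h : β ∈ cs.roots) : β ≠ 0 := by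
  rintro rfl
  simpa using cosForm_self_of_mem_roots h

variable {cs} in
lemma neg_mem_roots {β : B → ℝ} (h : β ∈ cs.roots) : -β ∈ cs.roots := by
  obtain ⟨w, i, rfl⟩ := h
  exact ⟨w * cs.simple i, i, by rw [geometricRep_mul_apply, geometricRep_simple_self, map_neg]⟩

variable {cs} in
lemma nonneg_or_nonpos_of_mem_roots {β : B → ℝ} (h : β ∈ cs.roots) : 0 ≤ β ∨ β ≤ 0 := by
  obtain ⟨w, i, rfl⟩ := h
  rcases lt_or_gt_of_ne (cs.length_mul_simple_ne w i) with h | h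
  · exact Or.inr (cs.geometricRep_single_nonpos w i h)
  · exact Or.inl (cs.geometricRep_single_nonneg w i h)

lemma mem_positiveRoots {β : B → ℝ} : β ∈ cs.positiveRoots ↔ β ∈ cs.roots ∧ 0 ≤ β := Iff.rfl

variable {cs} in
lemma positiveRoots_of_coord_pos {β : B → ℝ} (h : β ∈ cs.roots) {k : B} (hk : 0 < β k) :
    β ∈ cs.positiveRoots :=
  ⟨h, (nonneg_or_nonpos_of_mem_roots h).resolve_right fun h' => absurd (h' k) (not_le.mpr hk)⟩

variable {cs} in
lemma positiveRoots_or_neg {β : B → ℝ} (h : β ∈ cs.roots) :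
    β ∈ cs.positiveRoots ∨ -β ∈ cs.positiveRoots :=
  (nonneg_or_nonpos_of_mem_roots h).imp (fun h' => ⟨h, h'⟩)
    fun h' => ⟨neg_mem_roots h, neg_nonneg.mpr h'⟩

variable {cs} in
lemma neg_notMem_positiveRoots {β : B → ℝ} (h : β ∈ cs.positiveRoots) :
    -β ∉ cs.positiveRoots := by
  rintro ⟨-, h'⟩
  exact ne_zero_of_mem_roots h.1 (le_antisymm (neg_nonneg.mp h') h.2)

lemma single_mem_positiveRoots (i : B) : (Pi.single i 1 : B → ℝ) ∈ cs.positiveRoots :=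
  cs.mem_positiveRoots.mpr ⟨cs.single_mem_roots i, Pi.single_nonneg.mpr zero_le_one⟩

variable {cs} in
lemma exists_ne_coord_pos {β : B → ℝ} (h : β ∈ cs.positiveRoots) {i : B}
    (hi : β ≠ Pi.single i 1) : ∃ k, k ≠ i ∧ 0 < β k := by
  by_contra! hcon
  have h0 : ∀ k, k ≠ i → β k = 0 := fun k hk => le_antisymm (hcon k hk) (h.2 k)
  have hβ : β = β i • (Pi.single i 1 : B → ℝ) := by
    ext k
    by_cases hk : k = i
    · subst hk; simp
    · simp [h0 k hk, hk]
  have h2 := cosForm_self_of_mem_roots h.1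
  rw [hβ] at h2
  simp only [map_smul, LinearMap.smul_apply, CoxeterMatrix.cosForm_single,
    CoxeterMatrix.simpleForm_self, smul_eq_mul] at h2
  have h1 : β i = 1 := by nlinarith [h.2 i, show (0 : B → ℝ) i = 0 from rfl]
  rw [h1, one_smul] at hβ
  exact hi hβ

/-- A simple reflection permutes the positive roots other than the corresponding simple root. -/
lemma geometricRep_simple_mem_positiveRoots {β : B → ℝ} (h : β ∈ cs.positiveRoots) {i : B}
    (hi : β ≠ Pi.single i 1) : cs.geometricRep (cs.simple i) β ∈ cs.positiveRoots := by
  obtain ⟨k, hk, hpos⟩ := exists_ne_coord_pos h hi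
  refine positiveRoots_of_coord_pos (geometricRep_mem_roots _ h.1) (k := k) ?_
  rw [geometricRep_simple_apply]
  simpa [hk] using hpos

section finite

variable [Finite W]

lemma finite_roots : cs.roots.Finite := by
  refine (Set.finite_range fun p : W × B => cs.geometricRep p.1 (Pi.single p.2 1)).subset ?_
  rintro _ ⟨w, i, rfl⟩
  exact ⟨(w, i), rfl⟩

/-- The positive roots, as a finset. -/
def posRoots : Finset (B → ℝ) := (cs.finite_roots.subset fun _ h => h.1 :
  cs.positiveRoots.Finite).toFinset

/-- The roots, as a finset. -/
def allRoots : Finset (B → ℝ) := cs.finite_roots.toFinset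

lemma mem_posRoots {β : B → ℝ} : β ∈ cs.posRoots ↔ β ∈ cs.positiveRoots := by simp [posRoots]

lemma mem_allRoots {β : B → ℝ} : β ∈ cs.allRoots ↔ β ∈ cs.roots := by simp [allRoots]

lemma ncard_positiveRoots : cs.positiveRoots.ncard = cs.posRoots.card :=
  Set.ncard_eq_toFinset_card _ _

open Classical in
/-- The inversions of `w`: the positive roots that `w` makes negative. -/
def inversions (w : W) : Finset (B → ℝ) := cs.posRoots.filter fun β => cs.geometricRep w β ≤ 0

variable {cs} in
lemma mem_inversions {w : W} {β : B → ℝ} :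
    β ∈ cs.inversions w ↔ β ∈ cs.positiveRoots ∧ cs.geometricRep w β ≤ 0 := by
  simp [inversions, mem_posRoots]

variable {cs} in
lemma notMem_inversions {w : W} {β : B → ℝ} (hβ : β ∈ cs.positiveRoots) :
    β ∉ cs.inversions w ↔ cs.geometricRep w β ∈ cs.positiveRoots := by
  have hr := geometricRep_mem_roots (cs := cs) w hβ.1
  rw [mem_inversions]
  constructor
  · intro h
    exact ⟨hr, (nonneg_or_nonpos_of_mem_roots hr).resolve_right fun h' => h ⟨hβ, h'⟩⟩
  · rintro ⟨-, h1⟩ ⟨-, h2⟩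
    exact ne_zero_of_mem_roots hr (le_antisymm h2 h1)

open Classical in
/-- If `s_i` lengthens `w` on the right, then the inversions of `w s_i` are `α_i` and the images
under `s_i` of the inversions of `w`. -/
lemma card_inversions_mul_simple (w : W) (i : B)
    (h : cs.length w < cs.length (w * cs.simple i)) :
    (cs.inversions (w * cs.simple i)).card = (cs.inversions w).card + 1 := by
  have hw := cs.geometricRep_single_nonneg w i h
  have hi : (Pi.single i 1 : B → ℝ) ∉ cs.inversions w := by
    rw [notMem_inversions (cs.single_mem_positiveRoots i)]
    exact ⟨geometricRep_mem_roots _ (cs.single_mem_roots i), hw⟩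
  have hss : ∀ v, cs.geometricRep (cs.simple i) (cs.geometricRep (cs.simple i) v) = v := by
    intro v
    rw [← geometricRep_mul_apply, simple_mul_simple_self, geometricRep_one_apply]
  have key : cs.inversions (w * cs.simple i) =
      insert (Pi.single i 1) ((cs.inversions w).image (cs.geometricRep (cs.simple i))) := by
    ext β
    simp only [Finset.mem_insert, Finset.mem_image, mem_inversions]
    constructor
    · rintro ⟨hβ, hneg⟩
      by_cases hβi : β = Pi.single i 1
      · exact Or.inl hβi
      · refine Or.inr ⟨cs.geometricRep (cs.simple i) β,
          ⟨cs.geometricRep_simple_mem_positiveRoots hβ hβi, ?_⟩, hss β⟩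
        rwa [← geometricRep_mul_apply]
    · rintro (rfl | ⟨γ, ⟨hγ, hneg⟩, rfl⟩)
      · refine ⟨cs.single_mem_positiveRoots i, ?_⟩
        rw [geometricRep_mul_apply, geometricRep_simple_self, map_neg]
        exact neg_nonpos.mpr hw
      · have hγi : γ ≠ Pi.single i 1 := by
          rintro rfl
          exact hi (mem_inversions.mpr ⟨hγ, hneg⟩)
        refine ⟨cs.geometricRep_simple_mem_positiveRoots hγ hγi, ?_⟩
        rwa [geometricRep_mul_apply, hss]
  rw [key, Finset.card_insert_of_notMem, Finset.card_image_of_injective _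
    (cs.geometricRep (cs.simple i)).injective]
  intro hmem
  obtain ⟨γ, hγ, hγi⟩ := Finset.mem_image.mp hmem
  have : γ = -Pi.single i 1 := by
    rw [← hss γ, hγi, geometricRep_simple_self]
  exact neg_notMem_positiveRoots (cs.single_mem_positiveRoots i) (this ▸ (mem_inversions.mp hγ).1)

/-- The length of `w` is the number of positive roots that `w` makes negative. -/
theorem card_inversions (w : W) : (cs.inversions w).card = cs.length w := by
  induction hn : cs.length w generalizing w with
  | zero =>
    rw [length_eq_zero_iff] at hn
    subst hn
    rw [Finset.card_eq_zero, Finset.eq_empty_iff_forall_notMem]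
    intro β hβ
    have hβ' := (mem_inversions.mp hβ).1
    exact (notMem_inversions hβ').mpr (by rwa [geometricRep_one_apply]) hβ
  | succ n ih =>
    have hw : w ≠ 1 := by rintro rfl; simp at hn
    obtain ⟨i, hi⟩ := cs.exists_rightDescent_of_ne_one hw
    have hlen := (cs.isRightDescent_iff).mp hi
    have := cs.card_inversions_mul_simple (w * cs.simple i) i
      (by rw [mul_assoc, simple_mul_simple_self, mul_one]; exact hi)
    rw [mul_assoc, simple_mul_simple_self, mul_one] at this
    rw [this, ih _ (by omega)]

lemma length_lt_mul_simple_iff (w : W) (i : B) :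
    cs.length w < cs.length (w * cs.simple i) ↔ 0 ≤ cs.geometricRep w (Pi.single i 1) := by
  refine ⟨cs.geometricRep_single_nonneg w i, fun h => ?_⟩
  by_contra hcon
  have h' := cs.geometricRep_single_nonpos w i
    (lt_of_le_of_ne (not_lt.mp hcon) (cs.length_mul_simple_ne w i))
  exact ne_zero_of_mem_roots (geometricRep_mem_roots w (cs.single_mem_roots i)) (le_antisymm h' h)

/-- Only the identity keeps all simple roots positive. -/
lemma eq_one_of_forall_nonneg {w : W} (h : ∀ i, 0 ≤ cs.geometricRep w (Pi.single i 1)) :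
    w = 1 := by
  by_contra hw
  obtain ⟨i, hi⟩ := cs.exists_rightDescent_of_ne_one hw
  have := (cs.length_lt_mul_simple_iff w i).mpr (h i)
  unfold IsRightDescent at hi
  omega

lemma geometricRep_injective : Function.Injective cs.geometricRep := by
  rw [injective_iff_map_eq_one]
  intro w hw
  refine cs.eq_one_of_forall_nonneg fun i => ?_
  rw [hw]
  exact Pi.single_nonneg.mpr zero_le_one

end finite

end CoxeterSystem

/-! ### Positive definiteness of the invariant form -/

namespace CoxeterMatrix

variable {B : Type*} [Fintype B] [DecidableEq B] {M : CoxeterMatrix B}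

lemma IsIrreducible.eq_of_forall_adj {B : Type*} {M : CoxeterMatrix B} (hirr : M.IsIrreducible)
    {X : Type*} (g : B → X)
    (hg : ∀ i j, i ≠ j → M i j ≠ 2 → g i = g j) (i j : B) : g i = g j := by
  obtain ⟨p⟩ := hirr.preconnected i j
  induction p with
  | nil => rfl
  | cons h _ ih =>
    refine Eq.trans ?_ ih
    rw [SimpleGraph.fromRel_adj] at h
    obtain ⟨hne, h | h⟩ := h
    · exact hg _ _ hne h
    · exact hg _ _ hne (by rwa [M.symmetric])

lemma simpleForm_single_comm (i j : B) :
    M.simpleForm i (Pi.single j 1) = M.simpleForm j (Pi.single i 1) := by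
  rw [simpleForm_single, simpleForm_single, M.symmetric]

lemma simpleForm_single_of_eq_two {i j : B} (h : M i j = 2) :
    M.simpleForm i (Pi.single j 1) = 0 := by
  simp [simpleForm_single, h]

/-- Joined simple roots have inner product at most `-1` (in the normalisation `(α_i, α_i) = 2`). -/
lemma simpleForm_single_le_neg_one {i j : B} (hij : i ≠ j) (h : M i j ≠ 2) :
    M.simpleForm i (Pi.single j 1) ≤ -1 := by
  rw [simpleForm_single]
  suffices 1 / 2 ≤ Real.cos (Real.pi / M i j) by linarith
  obtain h0 | h3 : M i j = 0 ∨ 3 ≤ M i j := by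
    have := M.off_diagonal i j hij
    omega
  · norm_num [h0]
  · have h3' : (3 : ℝ) ≤ M i j := by exact_mod_cast h3
    rw [← Real.cos_pi_div_three]
    refine Real.cos_le_cos_of_nonneg_of_le_pi (by positivity) (by linarith [Real.pi_pos]) ?_
    exact div_le_div_of_nonneg_left Real.pi_pos.le (by norm_num) h3'

lemma simpleForm_single_nonpos {i j : B} (hij : i ≠ j) :
    M.simpleForm i (Pi.single j 1) ≤ 0 := by
  by_cases h : M i j = 2
  · exact (simpleForm_single_of_eq_two h).le
  · linarith [simpleForm_single_le_neg_one hij h]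

end CoxeterMatrix

namespace CoxeterSystem

variable {B W : Type*} [Fintype B] [DecidableEq B] [Group W] {M : CoxeterMatrix B}

/-- The invariant form of a finite irreducible Coxeter group is positive definite: a `W`-invariant
inner product exists by averaging, and any invariant form is a multiple of `cosForm`. -/
theorem cosForm_self_pos (cs : CoxeterSystem M W) [Finite W] (hirr : M.IsIrreducible)
    {v : B → ℝ} (hv : v ≠ 0) :
    0 < M.cosForm v v := by
  have := Fintype.ofFinite W
  let g : LinearMap.BilinForm ℝ (B → ℝ) := LinearMap.mk₂ ℝ
    (fun u v => ∑ w : W, cs.geometricRep w u ⬝ᵥ cs.geometricRep w v)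
    (by intros; simp [Finset.sum_add_distrib]) (by intros; simp [Finset.mul_sum])
    (by intros; simp [Finset.sum_add_distrib]) (by intros; simp [Finset.mul_sum])
  have gdef : ∀ u v, g u v = ∑ w : W, cs.geometricRep w u ⬝ᵥ cs.geometricRep w v := fun _ _ => rfl
  have ginv : ∀ x u v, g (cs.geometricRep x u) (cs.geometricRep x v) = g u v := by
    intro x u v
    rw [gdef, gdef]
    simp only [← geometricRep_mul_apply]
    exact Fintype.sum_equiv (Equiv.mulRight x) _ _ fun w => rfl
  have gpos : ∀ v, v ≠ 0 → 0 < g v v := by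
    intro v hv
    rw [gdef]
    refine Finset.sum_pos' (fun w _ => ?_) ⟨1, Finset.mem_univ _, ?_⟩
    · exact Finset.sum_nonneg fun _ _ => mul_self_nonneg _
    · rw [geometricRep_one_apply]
      refine lt_of_le_of_ne (Finset.sum_nonneg fun _ _ => mul_self_nonneg _) ?_
      rw [ne_comm, Ne, dotProduct_self_eq_zero]
      exact hv
  have gi : ∀ i v, 2 * g (Pi.single i 1) v = g (Pi.single i 1) (Pi.single i 1) *
      M.simpleForm i v := by
    intro i v
    have h := ginv (cs.simple i) (Pi.single i 1) v
    rw [geometricRep_simple_self, geometricRep_simple_apply] at h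
    simp only [map_neg, map_sub, map_smul, LinearMap.neg_apply, smul_eq_mul] at h
    linarith
  have gsymm : ∀ u v, g u v = g v u := fun u v => by
    rw [gdef, gdef]
    exact Finset.sum_congr rfl fun _ _ => dotProduct_comm _ _
  have gconst := hirr.eq_of_forall_adj (fun i => g (Pi.single i 1) (Pi.single i 1)) (by
    intro i j hij h
    have h1 := gi i (Pi.single j 1)
    have h2 := gi j (Pi.single i 1)
    rw [gsymm] at h2
    have h3 := CoxeterMatrix.simpleForm_single_le_neg_one hij h
    rw [CoxeterMatrix.simpleForm_single_comm (M := M) j i] at h2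
    exact mul_right_cancel₀ (b := M.simpleForm i (Pi.single j 1)) (by linarith)
      (h1.symm.trans h2))
  obtain ⟨i₀⟩ := hirr.nonempty
  have h1 : g v v = g (Pi.single i₀ 1) (Pi.single i₀ 1) / 2 * M.cosForm v v := by
    have hv' : v = ∑ i, v i • (Pi.single i 1 : B → ℝ) := by
      ext k; simp [Finset.sum_apply, Pi.single_apply]
    conv_lhs => enter [1]; rw [hv']
    rw [CoxeterMatrix.cosForm_apply, map_sum, LinearMap.sum_apply, Finset.mul_sum]
    refine Finset.sum_congr rfl fun i _ => ?_
    have := gi i v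
    rw [gconst i i₀] at this
    rw [map_smul, LinearMap.smul_apply, smul_eq_mul]
    linear_combination v i / 2 * this
  have h2 := gpos v hv
  have h3 := gpos (Pi.single i₀ 1) (by simp)
  rw [h1] at h2
  exact pos_of_mul_pos_right h2 (by positivity)

lemma cosForm_self_nonneg (cs : CoxeterSystem M W) [Finite W] (hirr : M.IsIrreducible) (v : B → ℝ) :
    0 ≤ M.cosForm v v := by
  by_cases hv : v = 0
  · simp [hv]
  · exact (cs.cosForm_self_pos hirr hv).le

lemma eq_zero_of_cosForm_self (cs : CoxeterSystem M W) [Finite W] (hirr : M.IsIrreducible) {v : B → ℝ}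
    (h : M.cosForm v v = 0) : v = 0 := by
  by_contra hv
  exact (cs.cosForm_self_pos hirr hv).ne' h

/-- The reflection in a root is realised by an element of `W`, a conjugate of a simple generator. -/
lemma exists_reflection (cs : CoxeterSystem M W) {β : B → ℝ} (h : β ∈ cs.roots) :
    ∃ t : W, cs.IsReflection t ∧ ∀ v, cs.geometricRep t v = v - M.cosForm β v • β := by
  obtain ⟨w, i, rfl⟩ := h
  refine ⟨w * cs.simple i * w⁻¹, ⟨w, i, rfl⟩, fun v => ?_⟩
  rw [geometricRep_mul_apply, geometricRep_mul_apply, geometricRep_simple_apply, map_sub,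
    map_smul, geometricRep_apply_inv_self, ← CoxeterMatrix.cosForm_single,
    ← cs.cosForm_geometricRep w (Pi.single i 1), geometricRep_apply_inv_self]

end CoxeterSystem

/-! ### Sign changes of a sampled cosine -/

lemma neg_one_zpow_floor_mul_cos_nonneg (y : ℝ) :
    0 ≤ (-1 : ℝ) ^ ⌊y / Real.pi + 1 / 2⌋ * Real.cos y := by
  set a := ⌊y / Real.pi + 1 / 2⌋
  rw [← Real.cos_sub_int_mul_pi]
  have h1 := Int.floor_le (y / Real.pi + 1 / 2)
  have h2 := Int.lt_floor_add_one (y / Real.pi + 1 / 2)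
  have hpi := Real.pi_pos
  have hy : y / Real.pi * Real.pi = y := div_mul_cancel₀ _ hpi.ne'
  apply Real.cos_nonneg_of_neg_pi_div_two_le_of_le <;> nlinarith

/-- If `s j = ± 1` is the sign of `C cos (j θ - ψ)` with `0 ≤ θ ≤ π`, then the number of sign
changes among the first `n` steps differs from `n θ / π` by at most `1`. -/
lemma abs_sum_sign_changes_sub_le {C θ ψ : ℝ} (hC : 0 ≤ C) (h0 : 0 ≤ θ) (hpi : θ ≤ Real.pi)
    {s : ℕ → ℝ} (hs : ∀ j, s j = 1 ∨ s j = -1)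
    (hsx : ∀ j : ℕ, 0 < s j * (C * Real.cos (j * θ - ψ))) (n : ℕ) :
    |∑ j ∈ Finset.range n, (1 - s j * s (j + 1)) / 2 - n * θ / Real.pi| ≤ 1 := by
  have hp := Real.pi_pos
  let y : ℕ → ℝ := fun j => (j * θ - ψ) / Real.pi + 1 / 2
  let a : ℕ → ℤ := fun j => ⌊y j⌋
  have hsa : ∀ j, s j = (-1 : ℝ) ^ a j := by
    intro j
    have h1 := neg_one_zpow_floor_mul_cos_nonneg (j * θ - ψ)
    have h2 := hsx j
    change 0 ≤ (-1 : ℝ) ^ a j * _ at h1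
    rcases hs j with h | h <;> rcases Int.even_or_odd (a j) with e | e <;>
      rw [h] at h2 ⊢ <;> simp only [e.neg_one_zpow] at h1 ⊢
    · nlinarith
    · nlinarith
  have hstep : ∀ j, y (j + 1) = y j + θ / Real.pi := by
    intro j
    simp only [y]
    push_cast
    ring
  have hθ : 0 ≤ θ / Real.pi := by positivity
  have hθ' : θ / Real.pi ≤ 1 := (div_le_one hp).mpr hpi
  have hterm : ∀ j, (1 - s j * s (j + 1)) / 2 = (a (j + 1) : ℝ) - a j := by
    intro j
    have l1 : a j ≤ a (j + 1) := Int.floor_le_floor (by rw [hstep]; linarith)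
    have l2 : a (j + 1) ≤ a j + 1 := by
      have : a (j + 1) ≤ ⌊y j + 1⌋ := Int.floor_le_floor (by rw [hstep]; linarith)
      rwa [Int.floor_add_one] at this
    rw [hsa, hsa]
    obtain h | h : a (j + 1) = a j ∨ a (j + 1) = a j + 1 := by omega
    · rw [h, ← mul_zpow]; simp
    · rw [h, zpow_add₀ (by norm_num), ← mul_assoc, ← mul_zpow]
      push_cast
      norm_num
  rw [Finset.sum_congr rfl fun j _ => hterm j, Finset.sum_range_sub (fun j => (a j : ℝ))]
  have h1 := Int.floor_le (y n)
  have h2 := Int.lt_floor_add_one (y n)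
  have h3 := Int.floor_le (y 0)
  have h4 := Int.lt_floor_add_one (y 0)
  have e : y n - y 0 = n * θ / Real.pi := by
    simp only [y]
    push_cast
    ring
  rw [← e, abs_le]
  constructor <;> simp only [a] <;> linarith

/-- A solution of `x (j + 2) = 2 cos θ x (j + 1) - x j` is a sampled cosine. -/
lemma exists_eq_mul_cos {θ : ℝ} (hθ : Real.sin θ ≠ 0) {x : ℕ → ℝ}
    (hx : ∀ j, x (j + 2) = 2 * Real.cos θ * x (j + 1) - x j) :
    ∃ C ψ : ℝ, 0 ≤ C ∧ ∀ j : ℕ, x j = C * Real.cos (j * θ - ψ) := by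
  let z : ℂ := ⟨x 0, (x 1 - x 0 * Real.cos θ) / Real.sin θ⟩
  refine ⟨‖z‖, z.arg, norm_nonneg _, fun j => ?_⟩
  have hz1 : ‖z‖ * Real.cos z.arg = x 0 := Complex.norm_mul_cos_arg z
  have hz2 : ‖z‖ * Real.sin z.arg * Real.sin θ = x 1 - x 0 * Real.cos θ := by
    rw [Complex.norm_mul_sin_arg z]
    exact div_mul_cancel₀ _ hθ
  induction j using Nat.twoStepInduction with
  | zero => simp [hz1]
  | one =>
    rw [Nat.cast_one, one_mul, Real.cos_sub]
    linear_combination -hz2 - Real.cos θ * hz1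
  | more k h1 h2 =>
    rw [hx, h1, h2]
    have e1 : ((k + 2 : ℕ) : ℝ) * θ - z.arg = (((k + 1 : ℕ) : ℝ) * θ - z.arg) + θ := by
      push_cast; ring
    have e2 : (k : ℝ) * θ - z.arg = (((k + 1 : ℕ) : ℝ) * θ - z.arg) - θ := by push_cast; ring
    rw [e1, e2, Real.cos_add (_ - _), Real.cos_sub (_ - _) θ]
    ring

/-! ### Mean and variance of the length -/

namespace CoxeterSystem

variable {B W : Type*} [Fintype B] [DecidableEq B] [Group W] {M : CoxeterMatrix B}
  (cs : CoxeterSystem M W)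

open Classical in
/-- The sign of a root: `1` for positive roots, `-1` for negative ones. -/
def rootSign (β : B → ℝ) : ℝ := if β ∈ cs.positiveRoots then 1 else -1

lemma rootSign_eq_or (β : B → ℝ) : cs.rootSign β = 1 ∨ cs.rootSign β = -1 := by
  unfold rootSign; split_ifs <;> simp

lemma rootSign_mul_self (β : B → ℝ) : cs.rootSign β * cs.rootSign β = 1 := by
  rcases cs.rootSign_eq_or β with h | h <;> rw [h] <;> norm_num

variable {cs} in
lemma rootSign_of_pos {β : B → ℝ} (h : β ∈ cs.positiveRoots) : cs.rootSign β = 1 := if_pos h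

variable {cs} in
lemma rootSign_neg {β : B → ℝ} (h : β ∈ cs.roots) : cs.rootSign (-β) = -cs.rootSign β := by
  rcases positiveRoots_or_neg h with h' | h'
  · rw [rootSign_of_pos h', rootSign, if_neg (neg_notMem_positiveRoots h')]
  · have := neg_notMem_positiveRoots h'
    rw [neg_neg] at this
    rw [rootSign_of_pos h', rootSign, if_neg this, neg_neg]

variable {cs} in
lemma rootSign_mul_sum_pos {β : B → ℝ} (h : β ∈ cs.roots) :
    0 < cs.rootSign β * ∑ k, β k := by
  have key : ∀ γ ∈ cs.positiveRoots, 0 < ∑ k, γ k := by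
    intro γ hγ
    refine Finset.sum_pos' (fun k _ => hγ.2 k) ?_
    by_contra! hcon
    exact ne_zero_of_mem_roots hγ.1 (funext fun k => le_antisymm (hcon k (Finset.mem_univ _))
      (hγ.2 k))
  rcases positiveRoots_or_neg h with h' | h'
  · rw [rootSign_of_pos h', one_mul]
    exact key _ h'
  · have e := rootSign_neg h
    rw [rootSign_of_pos h'] at e
    have := key _ h'
    rw [show cs.rootSign β = -1 by linarith]
    simpa using this

section fintype

variable [Fintype W]

/-- The correlation of the signs of `w α` and `w β` for uniformly random `w`. -/
def signCorr (α β : B → ℝ) : ℝ :=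
  (∑ w : W, cs.rootSign (cs.geometricRep w α) * cs.rootSign (cs.geometricRep w β)) /
    Fintype.card W

lemma signCorr_comm (α β : B → ℝ) : cs.signCorr α β = cs.signCorr β α := by
  simp only [signCorr, mul_comm]

lemma signCorr_geometricRep (g : W) (α β : B → ℝ) :
    cs.signCorr (cs.geometricRep g α) (cs.geometricRep g β) = cs.signCorr α β := by
  simp only [signCorr, ← geometricRep_mul_apply]
  congr 1
  exact Fintype.sum_equiv (Equiv.mulRight g) _ _ fun w => rfl

lemma signCorr_self (α : B → ℝ) : cs.signCorr α α = 1 := by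
  simp only [signCorr, rootSign_mul_self]
  simp

variable {cs} in
lemma signCorr_neg_right {α β : B → ℝ} (hβ : β ∈ cs.roots) :
    cs.signCorr α (-β) = -cs.signCorr α β := by
  simp only [signCorr, map_neg]
  rw [← neg_div, ← Finset.sum_neg_distrib]
  congr 1
  refine Finset.sum_congr rfl fun w _ => ?_
  rw [rootSign_neg (geometricRep_mem_roots w hβ), mul_neg]

variable {cs} in
lemma signCorr_neg_left {α β : B → ℝ} (hα : α ∈ cs.roots) :
    cs.signCorr (-α) β = -cs.signCorr α β := by
  rw [signCorr_comm, signCorr_neg_right hα, signCorr_comm]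

variable {cs} in
lemma abs_cosForm_le_two (hirr : M.IsIrreducible) {α β : B → ℝ} (hα : α ∈ cs.roots)
    (hβ : β ∈ cs.roots) : |M.cosForm α β| ≤ 2 := by
  have h1 := cs.cosForm_self_nonneg hirr (α - β)
  have h2 := cs.cosForm_self_nonneg hirr (α + β)
  simp only [map_sub, map_add, LinearMap.sub_apply, LinearMap.add_apply,
    cosForm_self_of_mem_roots hα, cosForm_self_of_mem_roots hβ, M.cosForm_comm β α] at h1 h2
  rw [abs_le]
  constructor <;> linarith

variable {cs} in
lemma eq_of_cosForm_eq_two (hirr : M.IsIrreducible) {α β : B → ℝ} (hα : α ∈ cs.roots)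
    (hβ : β ∈ cs.roots) (h : M.cosForm α β = 2) : β = α := by
  have : α - β = 0 := cs.eq_zero_of_cosForm_self hirr (by
    simp only [map_sub, LinearMap.sub_apply, cosForm_self_of_mem_roots hα,
      cosForm_self_of_mem_roots hβ, M.cosForm_comm β α, h]
    norm_num)
  exact (sub_eq_zero.mp this).symm

variable {cs} in
lemma eq_neg_of_cosForm_eq_neg_two (hirr : M.IsIrreducible) {α β : B → ℝ} (hα : α ∈ cs.roots)
    (hβ : β ∈ cs.roots) (h : M.cosForm α β = -2) : β = -α := by
  have := eq_of_cosForm_eq_two hirr hα (neg_mem_roots hβ) (by rw [map_neg, h, neg_neg])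
  rw [← this, neg_neg]

/-- The roots `γ_0 = α`, `γ_1 = β`, `γ_{j+2} = (α, β) γ_{j+1} - γ_j` of the dihedral group generated
by the reflections in `α` and `β`. -/
def dihedralSeq (M : CoxeterMatrix B) (α β : B → ℝ) : ℕ → (B → ℝ)
  | 0 => α
  | 1 => β
  | j + 2 => M.cosForm α β • dihedralSeq M α β (j + 1) - dihedralSeq M α β j

lemma dihedralSeq_add_two (α β : B → ℝ) (j : ℕ) : dihedralSeq M α β (j + 2) =
    M.cosForm α β • dihedralSeq M α β (j + 1) - dihedralSeq M α β j := rfl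

variable {cs} in
/-- Consecutive terms of `dihedralSeq` are roots at a fixed angle, and they all have the same
correlation, because the reflection in `γ_{j+1}` maps `(γ_{j+1}, γ_j)` to
`(-γ_{j+1}, -γ_{j+2})`. -/
lemma dihedralSeq_spec {α β : B → ℝ} (hα : α ∈ cs.roots) (hβ : β ∈ cs.roots) (j : ℕ) :
    dihedralSeq M α β j ∈ cs.roots ∧ dihedralSeq M α β (j + 1) ∈ cs.roots ∧
      M.cosForm (dihedralSeq M α β j) (dihedralSeq M α β (j + 1)) = M.cosForm α β ∧
      cs.signCorr (dihedralSeq M α β j) (dihedralSeq M α β (j + 1)) = cs.signCorr α β := by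
  induction j with
  | zero => exact ⟨hα, hβ, rfl, rfl⟩
  | succ j ih =>
    obtain ⟨h0, h1, hf, hc⟩ := ih
    obtain ⟨t, -, ht⟩ := cs.exists_reflection h1
    have e : cs.geometricRep t (dihedralSeq M α β j) = -dihedralSeq M α β (j + 1 + 1) := by
      rw [ht, dihedralSeq_add_two, M.cosForm_comm, hf, neg_sub]
    have e' : cs.geometricRep t (dihedralSeq M α β (j + 1)) = -dihedralSeq M α β (j + 1) := by
      rw [ht, cosForm_self_of_mem_roots h1, two_smul]
      abel
    have h2 : dihedralSeq M α β (j + 1 + 1) ∈ cs.roots := by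
      rw [← neg_neg (dihedralSeq M α β (j + 1 + 1)), ← e]
      exact neg_mem_roots (geometricRep_mem_roots t h0)
    refine ⟨h1, h2, ?_, ?_⟩
    · have := cs.cosForm_geometricRep t (dihedralSeq M α β j) (dihedralSeq M α β (j + 1))
      rw [e, e', map_neg, map_neg, LinearMap.neg_apply, neg_neg, hf, M.cosForm_comm] at this
      exact this
    · rw [← hc, ← cs.signCorr_geometricRep t (dihedralSeq M α β j), e, e', signCorr_neg_left h2,
        signCorr_neg_right h1, neg_neg, signCorr_comm]

variable {cs} in
/-- Two roots at angle `θ` have sign correlation `1 - 2 θ / π`: along the sequence of roots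
`dihedralSeq`, the number of sign changes per step is `θ / π` on average, and each step has the
same probability of being a sign change. -/
theorem signCorr_eq (hirr : M.IsIrreducible) {α β : B → ℝ} (hα : α ∈ cs.roots)
    (hβ : β ∈ cs.roots) :
    cs.signCorr α β = 1 - 2 * Real.arccos (M.cosForm α β / 2) / Real.pi := by
  have hp := Real.pi_pos
  set θ := Real.arccos (M.cosForm α β / 2) with hθ
  have habs := abs_le.mp (abs_cosForm_le_two hirr hα hβ)
  have hcos : 2 * Real.cos θ = M.cosForm α β := by
    rw [hθ, Real.cos_arccos] <;> linarith
  by_cases hs : Real.sin θ = 0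
  · have hsq := Real.sin_sq_add_cos_sq θ
    have h4 : (M.cosForm α β - 2) * (M.cosForm α β + 2) = 0 := by
      rw [← hcos]; rw [hs] at hsq; linear_combination 4 * hsq
    rcases mul_eq_zero.mp h4 with h | h
    · have hb : M.cosForm α β = 2 := by linarith
      rw [hθ, hb, eq_of_cosForm_eq_two hirr hα hβ hb, signCorr_self]
      norm_num
    · have hb : M.cosForm α β = -2 := by linarith
      rw [hθ, hb, eq_neg_of_cosForm_eq_neg_two hirr hα hβ hb, signCorr_neg_right hα,
        signCorr_self]
      norm_num [hp.ne']
  have hspec := dihedralSeq_spec hα hβ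
  have hcard : (0 : ℝ) < Fintype.card W := by exact_mod_cast Fintype.card_pos
  have hbound : ∀ n : ℕ, |n * ((1 - cs.signCorr α β) / 2 - θ / Real.pi)| ≤ 1 := by
    intro n
    have hw : ∀ w : W, |∑ j ∈ Finset.range n,
        (1 - cs.rootSign (cs.geometricRep w (dihedralSeq M α β j)) *
          cs.rootSign (cs.geometricRep w (dihedralSeq M α β (j + 1)))) / 2 -
        n * θ / Real.pi| ≤ 1 := by
      intro w
      obtain ⟨C, ψ, hC, hx⟩ := exists_eq_mul_cos hs
        (x := fun j => ∑ k, cs.geometricRep w (dihedralSeq M α β j) k) (by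
          intro j
          rw [dihedralSeq_add_two, hcos, map_sub, map_smul]
          simp [Finset.sum_sub_distrib, Finset.mul_sum])
      refine abs_sum_sign_changes_sub_le hC (Real.arccos_nonneg _) (Real.arccos_le_pi _)
        (s := fun j => cs.rootSign (cs.geometricRep w (dihedralSeq M α β j)))
        (fun j => cs.rootSign_eq_or _) (fun j => ?_) n (ψ := ψ)
      rw [← hx j]
      exact rootSign_mul_sum_pos (geometricRep_mem_roots w (hspec j).1)
    have hsum : ∑ w : W, (∑ j ∈ Finset.range n,
        (1 - cs.rootSign (cs.geometricRep w (dihedralSeq M α β j)) *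
          cs.rootSign (cs.geometricRep w (dihedralSeq M α β (j + 1)))) / 2 -
        n * θ / Real.pi) =
        Fintype.card W * (n * ((1 - cs.signCorr α β) / 2 - θ / Real.pi)) := by
      rw [Finset.sum_sub_distrib, Finset.sum_comm]
      have : ∀ j ∈ Finset.range n, ∑ w : W,
          (1 - cs.rootSign (cs.geometricRep w (dihedralSeq M α β j)) *
          cs.rootSign (cs.geometricRep w (dihedralSeq M α β (j + 1)))) / 2 =
          Fintype.card W * ((1 - cs.signCorr α β) / 2) := by
        intro j _
        rw [← (hspec j).2.2.2, signCorr, ← Finset.sum_div, Finset.sum_sub_distrib]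
        simp only [Finset.sum_const, Finset.card_univ, nsmul_eq_mul, mul_one]
        field_simp
      rw [Finset.sum_congr rfl this]
      simp only [Finset.sum_const, Finset.card_univ, Finset.card_range, nsmul_eq_mul]
      ring
    have h1 : |∑ w : W, (∑ j ∈ Finset.range n,
        (1 - cs.rootSign (cs.geometricRep w (dihedralSeq M α β j)) *
          cs.rootSign (cs.geometricRep w (dihedralSeq M α β (j + 1)))) / 2 -
        n * θ / Real.pi)| ≤ Fintype.card W := by
      refine (Finset.abs_sum_le_sum_abs _ _).trans ((Finset.sum_le_sum fun w _ => hw w).trans ?_)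
      simp
    rw [hsum, abs_mul, abs_of_pos hcard] at h1
    exact le_of_mul_le_mul_left (by simpa using h1) hcard
  have hzero : (1 - cs.signCorr α β) / 2 - θ / Real.pi = 0 := by
    by_contra hne
    obtain ⟨n, hn⟩ := exists_nat_gt (1 / |(1 - cs.signCorr α β) / 2 - θ / Real.pi|)
    have := hbound n
    rw [abs_mul, Nat.abs_cast] at this
    rw [div_lt_iff₀ (abs_pos.mpr hne)] at hn
    linarith
  linear_combination -2 * hzero

lemma length_eq_sum_rootSign (w : W) :
    (cs.length w : ℝ) = ∑ β ∈ cs.posRoots, (1 - cs.rootSign (cs.geometricRep w β)) / 2 := by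
  classical
  rw [← card_inversions, inversions, Finset.card_filter]
  push_cast
  refine Finset.sum_congr rfl fun β hβ => ?_
  rw [mem_posRoots] at hβ
  have h := notMem_inversions (w := w) hβ
  rw [mem_inversions] at h
  by_cases hn : cs.geometricRep w β ≤ 0
  · rw [if_pos hn, rootSign, if_neg (fun h' => h.mpr h' ⟨hβ, hn⟩)]
    norm_num
  · rw [if_neg hn, rootSign, if_pos (h.mp fun h' => hn h'.2)]
    norm_num

variable {cs} in
lemma sum_rootSign {β : B → ℝ} (hβ : β ∈ cs.roots) :
    ∑ w : W, cs.rootSign (cs.geometricRep w β) = 0 := by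
  obtain ⟨t, -, ht⟩ := cs.exists_reflection hβ
  have e : cs.geometricRep t β = -β := by
    rw [ht, cosForm_self_of_mem_roots hβ, two_smul]; abel
  have h : ∑ w : W, cs.rootSign (cs.geometricRep w β) =
      ∑ w : W, cs.rootSign (cs.geometricRep (w * t) β) :=
    (Fintype.sum_equiv (Equiv.mulRight t) _ _ fun w => rfl).symm
  simp only [geometricRep_mul_apply, e, map_neg] at h
  rw [Finset.sum_congr rfl fun w _ => rootSign_neg (geometricRep_mem_roots w hβ),
    Finset.sum_neg_distrib] at h
  linarith

lemma sum_length : ∑ w : W, (cs.length w : ℝ) = Fintype.card W * (cs.posRoots.card / 2) := by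
  simp only [length_eq_sum_rootSign]
  rw [Finset.sum_comm]
  have : ∀ β ∈ cs.posRoots, ∑ w : W, (1 - cs.rootSign (cs.geometricRep w β)) / 2 =
      Fintype.card W / 2 := by
    intro β hβ
    rw [← Finset.sum_div, Finset.sum_sub_distrib, sum_rootSign (cs.mem_posRoots.mp hβ).1]
    simp
  rw [Finset.sum_congr rfl this]
  simp only [Finset.sum_const, nsmul_eq_mul]
  ring

/-- Sums over all roots of an even function are twice the sums over the positive roots. -/
lemma sum_allRoots {f : (B → ℝ) → ℝ} (hf : ∀ β ∈ cs.roots, f (-β) = f β) :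
    ∑ β ∈ cs.allRoots, f β = 2 * ∑ β ∈ cs.posRoots, f β := by
  classical
  have hu : cs.allRoots = cs.posRoots ∪ cs.posRoots.image (fun β => -β) := by
    ext β
    simp only [Finset.mem_union, Finset.mem_image, mem_allRoots, mem_posRoots]
    constructor
    · intro h
      exact (positiveRoots_or_neg h).imp_right fun h' => ⟨-β, h', neg_neg β⟩
    · rintro (h | ⟨γ, h, rfl⟩)
      · exact h.1
      · exact neg_mem_roots h.1
  have hd : Disjoint cs.posRoots (cs.posRoots.image (fun β => -β)) := by
    rw [Finset.disjoint_left]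
    intro β h h'
    obtain ⟨γ, hγ, rfl⟩ := Finset.mem_image.mp h'
    exact neg_notMem_positiveRoots (cs.mem_posRoots.mp hγ) (cs.mem_posRoots.mp h)
  rw [hu, Finset.sum_union hd, Finset.sum_image (by simp), two_mul]
  congr 1
  exact Finset.sum_congr rfl fun β hβ => hf β (cs.mem_posRoots.mp hβ).1

lemma card_allRoots : cs.allRoots.card = 2 * cs.posRoots.card := by
  have := cs.sum_allRoots (f := fun _ => 1) fun _ _ => rfl
  simp only [Finset.sum_const, nsmul_eq_mul, mul_one] at this
  exact_mod_cast this

variable {cs} in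
lemma sum_allRoots_geometricRep (w : W) (f : (B → ℝ) → ℝ) :
    ∑ β ∈ cs.allRoots, f (cs.geometricRep w β) = ∑ β ∈ cs.allRoots, f β := by
  refine Finset.sum_bij' (fun β _ => cs.geometricRep w β) (fun β _ => cs.geometricRep w⁻¹ β)
    ?_ ?_ ?_ ?_ ?_
  · intro β hβ
    exact cs.mem_allRoots.mpr (geometricRep_mem_roots w (cs.mem_allRoots.mp hβ))
  · intro β hβ
    exact cs.mem_allRoots.mpr (geometricRep_mem_roots _ (cs.mem_allRoots.mp hβ))
  · intro β _
    exact cs.geometricRep_inv_apply_self w β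
  · intro β _
    exact cs.geometricRep_apply_inv_self w β
  · intros; rfl

/-- The variance of the length as a sum over pairs of roots. -/
theorem sum_length_sub_sq :
    ∑ w : W, ((cs.length w : ℝ) - cs.posRoots.card / 2) ^ 2 =
      Fintype.card W * (1 / 16 * ∑ α ∈ cs.allRoots, ∑ β ∈ cs.allRoots, cs.signCorr α β ^ 2) := by
  have hcard : (Fintype.card W : ℝ) ≠ 0 := by exact_mod_cast Fintype.card_ne_zero
  have hcorr : ∀ α β, ∑ w : W, cs.rootSign (cs.geometricRep w α) *
      cs.rootSign (cs.geometricRep w β) = Fintype.card W * cs.signCorr α β := by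
    intro α β
    rw [signCorr, mul_div_cancel₀ _ hcard]
  have h1 : ∀ w : W, ((cs.length w : ℝ) - cs.posRoots.card / 2) ^ 2 =
      1 / 4 * ∑ α ∈ cs.posRoots, ∑ β ∈ cs.posRoots,
        cs.rootSign (cs.geometricRep w α) * cs.rootSign (cs.geometricRep w β) := by
    intro w
    rw [← Finset.sum_mul_sum, length_eq_sum_rootSign, ← Finset.sum_div, Finset.sum_sub_distrib]
    simp only [Finset.sum_const, nsmul_eq_mul, mul_one]
    ring
  have h2 : ∑ α ∈ cs.posRoots, ∑ β ∈ cs.posRoots, cs.signCorr α β = 1 / 4 *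
      ∑ α ∈ cs.allRoots, ∑ β ∈ cs.allRoots,
        cs.rootSign α * cs.rootSign β * cs.signCorr α β := by
    rw [cs.sum_allRoots]
    · rw [Finset.sum_congr rfl fun α hα => cs.sum_allRoots fun β hβ => by
        rw [rootSign_neg hβ, signCorr_neg_right hβ, mul_neg (cs.rootSign α), neg_mul_neg]]
      simp only [Finset.mul_sum]
      refine Finset.sum_congr rfl fun α hα => Finset.sum_congr rfl fun β hβ => ?_
      rw [rootSign_of_pos (cs.mem_posRoots.mp hα), rootSign_of_pos (cs.mem_posRoots.mp hβ)]
      ring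
    · intro α hα
      refine Finset.sum_congr rfl fun β hβ => ?_
      rw [rootSign_neg hα, signCorr_neg_left hα]
      ring
  have h3 : Fintype.card W * ∑ α ∈ cs.allRoots, ∑ β ∈ cs.allRoots,
        cs.rootSign α * cs.rootSign β * cs.signCorr α β =
      Fintype.card W * ∑ α ∈ cs.allRoots, ∑ β ∈ cs.allRoots, cs.signCorr α β ^ 2 := by
    have : ∀ w : W, ∑ α ∈ cs.allRoots, ∑ β ∈ cs.allRoots,
        cs.rootSign α * cs.rootSign β * cs.signCorr α β = ∑ α ∈ cs.allRoots, ∑ β ∈ cs.allRoots,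
        cs.rootSign (cs.geometricRep w α) * cs.rootSign (cs.geometricRep w β) *
          cs.signCorr α β := by
      intro w
      rw [← sum_allRoots_geometricRep w]
      refine Finset.sum_congr rfl fun α _ => ?_
      rw [← sum_allRoots_geometricRep w]
      refine Finset.sum_congr rfl fun β _ => ?_
      rw [signCorr_geometricRep]
    rw [← nsmul_eq_mul, ← Finset.card_univ, ← Finset.sum_const,
      Finset.sum_congr rfl fun w _ => this w, Finset.sum_comm, Finset.mul_sum]
    refine Finset.sum_congr rfl fun α _ => ?_
    rw [Finset.sum_comm, Finset.mul_sum]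
    refine Finset.sum_congr rfl fun β _ => ?_
    rw [← Finset.sum_mul, hcorr, Finset.card_univ]
    ring
  rw [Finset.sum_congr rfl fun w _ => h1 w, ← Finset.mul_sum, Finset.sum_comm]
  rw [Finset.sum_congr rfl fun α _ => Finset.sum_comm]
  simp only [hcorr, ← Finset.mul_sum]
  rw [h2]
  linear_combination 1 / 16 * h3

end fintype

end CoxeterSystem

/-! ### Coxeter elements are conjugate -/

namespace CoxeterMatrix

/-- The moves between orderings of the simple reflections that do not change the conjugacy class
of their product: interchange two adjacent commuting letters, or move the first letter to the
end. -/
inductive CoxeterMove {B : Type*} (M : CoxeterMatrix B) : List B → List B → Prop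
  | swap (l₁ l₂ : List B) (a b : B) (h : M a b = 2) :
      CoxeterMove M (l₁ ++ a :: b :: l₂) (l₁ ++ b :: a :: l₂)
  | rotate (a : B) (l : List B) : CoxeterMove M (a :: l) (l ++ [a])

variable {B : Type*} {M : CoxeterMatrix B}

lemma CoxeterMove.perm {l l' : List B} (h : M.CoxeterMove l l') : l.Perm l' := by
  cases h with
  | swap l₁ l₂ a b _ => exact (List.Perm.swap _ _ _).append_left l₁
  | rotate a l => exact (List.perm_append_singleton a l).symm

lemma eqvGen_coxeterMove_perm {l l' : List B} (h : Relation.EqvGen M.CoxeterMove l l') :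
    l.Perm l' := by
  induction h with
  | rel _ _ h => exact h.perm
  | refl _ => exact List.Perm.refl _
  | symm _ _ _ ih => exact ih.symm
  | trans _ _ _ _ _ ih ih' => exact ih.trans ih'

lemma eqvGen_coxeterMove_commute {x : B} {l : List B} (h : ∀ b ∈ l, M x b = 2) (l₁ l₂ : List B) :
    Relation.EqvGen M.CoxeterMove (l₁ ++ x :: (l ++ l₂)) (l₁ ++ (l ++ x :: l₂)) := by
  induction l generalizing l₁ with
  | nil => exact .refl _
  | cons b l ih =>
    refine .trans _ _ _ (.rel _ _ (CoxeterMove.swap l₁ (l ++ l₂) x b (h b (by simp)))) ?_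
    have := ih (fun b' hb' => h b' (by simp [hb'])) (l₁ ++ [b])
    simpa using this

/-- Moves can be performed below a letter that has at most one neighbour. -/
lemma CoxeterMove.cons {x : B} {l l' : List B} (h : M.CoxeterMove l l') (hl : l.Nodup)
    (hx : ∀ a ∈ l, ∀ b ∈ l, M x a ≠ 2 → M x b ≠ 2 → a = b) :
    Relation.EqvGen M.CoxeterMove (x :: l) (x :: l') := by
  cases h with
  | swap l₁ l₂ a b h => exact .rel _ _ (CoxeterMove.swap (x :: l₁) l₂ a b h)
  | rotate a l =>
    by_cases ha : M x a = 2
    · exact .trans _ _ _ (.rel _ _ (CoxeterMove.swap [] l x a ha))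
        (.rel _ _ (CoxeterMove.rotate a (x :: l)))
    · have hc : ∀ b ∈ l, M x b = 2 := by
        intro b hb
        by_contra hne
        have := hx a (by simp) b (by simp [hb]) ha hne
        exact (List.nodup_cons.mp hl).1 (this ▸ hb)
      refine .trans _ _ _ (.rel _ _ (CoxeterMove.rotate x (a :: l))) ?_
      refine .trans _ _ _ (.rel _ _ (CoxeterMove.rotate a (l ++ [x]))) ?_
      have := eqvGen_coxeterMove_commute hc [] [a]
      exact .symm _ _ (by simpa using this)

lemma eqvGen_coxeterMove_cons {x : B} {l l' : List B} (h : Relation.EqvGen M.CoxeterMove l l')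
    (hl : l.Nodup) (hx : ∀ a ∈ l, ∀ b ∈ l, M x a ≠ 2 → M x b ≠ 2 → a = b) :
    Relation.EqvGen M.CoxeterMove (x :: l) (x :: l') := by
  induction h with
  | rel _ _ h => exact h.cons hl hx
  | refl _ => exact .refl _
  | symm l l' h ih =>
    have hp := eqvGen_coxeterMove_perm h
    exact .symm _ _ (ih (hp.nodup_iff.mpr hl) fun a ha b hb => hx a (hp.mem_iff.mp ha) b
      (hp.mem_iff.mp hb))
  | trans l l' l'' h _ ih ih' =>
    have hp := eqvGen_coxeterMove_perm h
    exact .trans _ _ _ (ih hl hx) (ih' (hp.nodup_iff.mp hl) fun a ha b hb =>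
      hx a (hp.mem_iff.mpr ha) b (hp.mem_iff.mpr hb))

/-- A letter with at most one neighbour can be moved to the front. -/
lemma eqvGen_coxeterMove_front {x : B} {l₁ l₂ : List B} (hl : (l₁ ++ x :: l₂).Nodup)
    (hx : ∀ a ∈ l₁ ++ l₂, ∀ b ∈ l₁ ++ l₂, M x a ≠ 2 → M x b ≠ 2 → a = b) :
    Relation.EqvGen M.CoxeterMove (l₁ ++ x :: l₂) (x :: (l₁ ++ l₂)) := by
  by_cases h : ∃ a ∈ l₁, M x a ≠ 2
  · obtain ⟨a, ha, hxa⟩ := h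
    have hc : ∀ b ∈ l₂, M x b = 2 := by
      intro b hb
      by_contra hne
      have hab := hx a (by simp [ha]) b (by simp [hb]) hxa hne
      subst hab
      exact (List.nodup_append.mp hl).2.2 a ha a (by simp [hb]) rfl
    have h1 := eqvGen_coxeterMove_commute hc l₁ []
    simp only [List.append_nil] at h1
    refine .trans _ _ _ h1 (.symm _ _ (.rel _ _ ?_))
    have := CoxeterMove.rotate (M := M) x (l₁ ++ l₂)
    simpa using this
  · push Not at h
    have h1 := eqvGen_coxeterMove_commute h [] l₂
    exact .symm _ _ (by simpa using h1)

/-- If every set of vertices contains one with at most one neighbour in it (that is, if the Coxeter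
graph is a forest), then any two orderings of the same letters are related by moves. -/
lemma eqvGen_coxeterMove_of_perm [DecidableEq B]
    (hM : ∀ X : Finset B, X.Nonempty → ∃ x ∈ X, ∀ a ∈ X, ∀ b ∈ X, a ≠ x → b ≠ x →
      M x a ≠ 2 → M x b ≠ 2 → a = b)
    {l l' : List B} (hl : l.Nodup) (h : l.Perm l') : Relation.EqvGen M.CoxeterMove l l' := by
  induction hn : l.length generalizing l l' with
  | zero =>
    rw [List.length_eq_zero_iff] at hn
    subst hn
    rw [h.nil_eq]
    exact .refl _
  | succ n ih =>
    have hne : l.toFinset.Nonempty := by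
      rw [List.toFinset_nonempty_iff]
      rintro rfl
      simp at hn
    obtain ⟨x, hxl, hx⟩ := hM l.toFinset hne
    rw [List.mem_toFinset] at hxl
    have key : ∀ {m₁ m₂ : List B}, l.Perm (m₁ ++ x :: m₂) →
        Relation.EqvGen M.CoxeterMove (m₁ ++ x :: m₂) (x :: (m₁ ++ m₂)) ∧ (m₁ ++ m₂).Nodup ∧
        ∀ a ∈ m₁ ++ m₂, ∀ b ∈ m₁ ++ m₂, M x a ≠ 2 → M x b ≠ 2 → a = b := by
      intro m₁ m₂ hp
      have hnd := hp.nodup_iff.mp hl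
      have hnd' := (List.perm_middle.nodup_iff.mp hnd)
      have hx' : ∀ a ∈ m₁ ++ m₂, ∀ b ∈ m₁ ++ m₂, M x a ≠ 2 → M x b ≠ 2 → a = b := by
        intro a ha b hb
        have hmem : ∀ c ∈ m₁ ++ m₂, c ∈ l.toFinset ∧ c ≠ x := by
          intro c hc
          refine ⟨List.mem_toFinset.mpr (hp.mem_iff.mpr ?_), ?_⟩
          · exact List.perm_middle.mem_iff.mpr (List.mem_cons_of_mem _ hc)
          · rintro rfl
            exact (List.nodup_cons.mp hnd').1 hc
        exact hx a (hmem a ha).1 b (hmem b hb).1 (hmem a ha).2 (hmem b hb).2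
      exact ⟨eqvGen_coxeterMove_front hnd hx', (List.nodup_cons.mp hnd').2, hx'⟩
    obtain ⟨l₁, l₂, rfl⟩ := List.append_of_mem hxl
    obtain ⟨l₁', l₂', rfl⟩ := List.append_of_mem (h.mem_iff.mp hxl)
    obtain ⟨e1, nd, hx1⟩ := key (List.Perm.refl _)
    obtain ⟨e2, -, -⟩ := key h
    refine .trans _ _ _ e1 (.trans _ _ _ ?_ (.symm _ _ e2))
    refine eqvGen_coxeterMove_cons (ih nd ?_ ?_) nd hx1
    · exact (List.perm_cons x).mp (List.perm_middle.symm.trans (h.trans List.perm_middle))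
    · simp only [List.length_append, List.length_cons] at hn ⊢
      omega

end CoxeterMatrix

namespace CoxeterSystem

lemma orderOf_wordProd_eq_of_eqvGen {B W : Type*} [Group W] {M : CoxeterMatrix B}
    (cs : CoxeterSystem M W) {l l' : List B}
    (h : Relation.EqvGen M.CoxeterMove l l') :
    orderOf (cs.wordProd l) = orderOf (cs.wordProd l') := by
  induction h with
  | rel _ _ h =>
    cases h with
    | swap l₁ l₂ a b h =>
      have hc : cs.simple a * cs.simple b = cs.simple b * cs.simple a := by
        have h2 := cs.simple_mul_simple_pow a b
        rw [h, pow_two] at h2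
        have := eq_inv_of_mul_eq_one_left h2
        rwa [mul_inv_rev, inv_simple, inv_simple] at this
      simp only [wordProd_append, wordProd_cons]
      rw [← mul_assoc (cs.simple a), hc, mul_assoc]
    | rotate a l =>
      rw [wordProd_append, wordProd_cons, wordProd_singleton]
      have := orderOf_injective (MulAut.conj (cs.simple a)).toMonoidHom
        (MulAut.conj (cs.simple a)).injective (cs.wordProd l * cs.simple a)
      rw [← this]
      simp [mul_assoc]
  | refl _ => rfl
  | symm _ _ _ ih => exact ih.symm
  | trans _ _ _ _ _ ih ih' => exact ih.trans ih'

variable {B W : Type*} [Fintype B] [DecidableEq B] [Group W] {M : CoxeterMatrix B}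

/-- The Coxeter graph of a finite irreducible Coxeter group is a forest: otherwise the sum of the
simple roots in a cycle would have nonpositive norm. -/
lemma exists_leaf (cs : CoxeterSystem M W) [Finite W] (hirr : M.IsIrreducible)
    (X : Finset B) (hX : X.Nonempty) : ∃ x ∈ X, ∀ a ∈ X, ∀ b ∈ X, a ≠ x → b ≠ x →
      M x a ≠ 2 → M x b ≠ 2 → a = b := by
  by_contra! hcon
  have hform : M.cosForm (∑ x ∈ X, Pi.single x 1) (∑ x ∈ X, Pi.single x 1) =
      ∑ x ∈ X, ∑ y ∈ X, M.simpleForm x (Pi.single y 1) := by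
    simp only [map_sum, LinearMap.sum_apply, CoxeterMatrix.cosForm_single]
    exact Finset.sum_comm
  have hne : (∑ x ∈ X, Pi.single x 1 : B → ℝ) ≠ 0 := by
    obtain ⟨x, hx⟩ := hX
    intro h
    have := congrFun h x
    simp [Finset.sum_apply, Pi.single_apply, hx] at this
  have hpos := cs.cosForm_self_pos hirr hne
  rw [hform] at hpos
  refine absurd hpos (not_lt.mpr (Finset.sum_nonpos fun x hx => ?_))
  obtain ⟨a, ha, b, hb, hax, hbx, hMa, hMb, hab⟩ := hcon x hx
  have hsub : ({x, a, b} : Finset B) ⊆ X := by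
    intro y; simp only [Finset.mem_insert, Finset.mem_singleton]
    rintro (rfl | rfl | rfl) <;> assumption
  have h1 : ∑ y ∈ X, M.simpleForm x (Pi.single y 1) ≤
      ∑ y ∈ ({x, a, b} : Finset B), M.simpleForm x (Pi.single y 1) := by
    rw [← Finset.sum_sdiff hsub]
    have : ∑ y ∈ X \ {x, a, b}, M.simpleForm x (Pi.single y 1) ≤ 0 := by
      refine Finset.sum_nonpos fun y hy => CoxeterMatrix.simpleForm_single_nonpos ?_
      rintro rfl
      simp at hy
    linarith
  rw [Finset.sum_insert (by simp [hax.symm, hbx.symm]), Finset.sum_pair hab,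
    CoxeterMatrix.simpleForm_self] at h1
  have h2 := CoxeterMatrix.simpleForm_single_le_neg_one hax.symm hMa
  have h3 := CoxeterMatrix.simpleForm_single_le_neg_one hbx.symm hMb
  linarith

/-- The Coxeter graph is bipartite. -/
lemma exists_coloring (cs : CoxeterSystem M W) [Finite W] (hirr : M.IsIrreducible) :
    ∃ χ : B → Bool, ∀ i j, i ≠ j → χ i = χ j → M i j = 2 := by
  suffices ∀ X : Finset B, ∃ χ : B → Bool, ∀ i ∈ X, ∀ j ∈ X, i ≠ j → χ i = χ j → M i j = 2 by
    obtain ⟨χ, h⟩ := this Finset.univ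
    exact ⟨χ, fun i j => h i (Finset.mem_univ _) j (Finset.mem_univ _)⟩
  intro X
  induction hn : X.card generalizing X with
  | zero =>
    rw [Finset.card_eq_zero] at hn
    subst hn
    exact ⟨fun _ => true, by simp⟩
  | succ n ih =>
    have hX : X.Nonempty := Finset.card_pos.mp (by omega)
    obtain ⟨x, hxX, hx⟩ := cs.exists_leaf hirr X hX
    obtain ⟨χ, hχ⟩ := ih (X.erase x) (by rw [Finset.card_erase_of_mem hxX, hn]; rfl)
    -- colour `x` differently from its neighbour, if it has one
    obtain ⟨v, hv⟩ : ∃ v : Bool, ∀ j ∈ X, j ≠ x → v = χ j → M x j = 2 := by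
      by_cases h : ∃ a ∈ X, a ≠ x ∧ M x a ≠ 2
      · obtain ⟨a, ha, hax, hMa⟩ := h
        refine ⟨!χ a, fun j hj hjx hv => ?_⟩
        by_contra hne
        rw [hx a ha j hj hax hjx hMa hne] at hv
        simp at hv
      · push Not at h
        exact ⟨true, fun j hj hjx _ => h j hj hjx⟩
    refine ⟨Function.update χ x v, fun i hi j hj hij => ?_⟩
    by_cases hix : i = x
    · subst hix
      simp only [Function.update_self, Function.update_of_ne hij.symm]
      exact hv j hj hij.symm
    · by_cases hjx : j = x
      · subst hjx
        simp only [Function.update_self, Function.update_of_ne hij]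
        intro h
        rw [M.symmetric]
        exact hv i hi hij h.symm
      · simp only [Function.update_of_ne hix, Function.update_of_ne hjx]
        exact hχ i (by simp [hix, hi]) j (by simp [hjx, hj]) hij

/-! ### The Coxeter number -/

/-- Perron–Frobenius for the invariant form: it has an eigenvector with positive coordinates,
namely a nonnegative minimiser of `cosForm v v` on the unit sphere. -/
lemma exists_pos_eigenvector (hirr : M.IsIrreducible) :
    ∃ (x : B → ℝ) (ν : ℝ), (∀ i, 0 < x i) ∧ ∀ i, M.simpleForm i x = ν * x i := by
  obtain ⟨i₀⟩ := hirr.nonempty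
  let Sph : Set (B → ℝ) := {v | v ⬝ᵥ v = 1}
  have hcont : Continuous fun v : B → ℝ => M.cosForm v v := by
    simp only [CoxeterMatrix.cosForm_apply, CoxeterMatrix.simpleForm_apply]
    fun_prop
  have hdot : Continuous fun v : B → ℝ => v ⬝ᵥ v := by
    simp only [dotProduct]; fun_prop
  have hcomp : IsCompact Sph := by
    refine Metric.isCompact_of_isClosed_isBounded (isClosed_eq hdot continuous_const) ?_
    refine (Metric.isBounded_closedBall (x := (0 : B → ℝ)) (r := 1)).subset fun v hv => ?_
    rw [mem_closedBall_zero_iff, pi_norm_le_iff_of_nonneg zero_le_one]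
    intro i
    have h1 : v i * v i ≤ v ⬝ᵥ v := Finset.single_le_sum (f := fun i => v i * v i)
      (fun j _ => mul_self_nonneg (v j)) (Finset.mem_univ i)
    rw [Real.norm_eq_abs, ← abs_one, ← sq_le_sq]
    have : v ⬝ᵥ v = 1 := hv
    nlinarith
  obtain ⟨x, hx, hmin⟩ := hcomp.exists_isMinOn ⟨Pi.single i₀ 1, by simp [Sph]⟩ hcont.continuousOn
  set ν := M.cosForm x x with hν
  have hx1 : x ⬝ᵥ x = 1 := hx
  have hpsd : ∀ v : B → ℝ, ν * (v ⬝ᵥ v) ≤ M.cosForm v v := by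
    intro v
    by_cases hv : v = 0
    · simp [hv]
    have hvv : 0 < v ⬝ᵥ v := by
      refine lt_of_le_of_ne (Finset.sum_nonneg fun _ _ => mul_self_nonneg _) ?_
      rwa [ne_comm, Ne, dotProduct_self_eq_zero]
    set r := Real.sqrt (v ⬝ᵥ v)
    have hr : r * r = v ⬝ᵥ v := Real.mul_self_sqrt hvv.le
    have hr0 : r ≠ 0 := by intro h; rw [h] at hr; linarith
    have h1 : ν ≤ M.cosForm (r⁻¹ • v) (r⁻¹ • v) := hmin (by
      simp only [Sph, Set.mem_ofPred_eq, smul_dotProduct, dotProduct_smul, smul_eq_mul, ← hr]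
      field_simp)
    simp only [map_smul, LinearMap.smul_apply, smul_eq_mul] at h1
    rw [← hr]
    calc ν * (r * r) ≤ (r⁻¹ * (r⁻¹ * M.cosForm v v)) * (r * r) :=
          mul_le_mul_of_nonneg_right h1 (mul_self_nonneg r)
      _ = M.cosForm v v := by field_simp
  -- replacing the coordinates of `x` by their absolute values does not increase the form
  let y : B → ℝ := fun i => |x i|
  have hy1 : y ⬝ᵥ y = 1 := by
    rw [← hx1]; simp [dotProduct, y]
  have hyx : M.cosForm y y ≤ ν := by
    rw [hν]
    simp only [CoxeterMatrix.cosForm_apply, CoxeterMatrix.simpleForm_apply, Finset.mul_sum]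
    refine Finset.sum_le_sum fun i _ => Finset.sum_le_sum fun j _ => ?_
    rw [← CoxeterMatrix.simpleForm_single]
    by_cases hij : i = j
    · subst hij
      simp only [CoxeterMatrix.simpleForm_self, y]
      nlinarith [abs_mul_abs_self (x i)]
    · have h1 := CoxeterMatrix.simpleForm_single_nonpos (M := M) hij
      have h2 : x i * x j ≤ |x i| * |x j| := by rw [← abs_mul]; exact le_abs_self _
      simp only [y]
      nlinarith
  have hyν : M.cosForm y y = ν := le_antisymm hyx (by simpa [hy1] using hpsd y)
  have heig : ∀ i, M.simpleForm i y = ν * y i := by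
    intro i
    have hq : ∀ t : ℝ, 0 ≤ t * (2 * (M.simpleForm i y - ν * y i)) + t ^ 2 * (2 - ν) := by
      intro t
      have := hpsd (y + t • Pi.single i 1)
      simp only [map_add, map_smul, LinearMap.add_apply, LinearMap.smul_apply, smul_eq_mul,
        M.cosForm_comm y (Pi.single i 1), CoxeterMatrix.cosForm_single,
        CoxeterMatrix.simpleForm_self, hyν, add_dotProduct, dotProduct_add, smul_dotProduct,
        dotProduct_smul, hy1, single_dotProduct, dotProduct_single, Pi.single_eq_same,
        Pi.add_apply, Pi.smul_apply] at this
      linarith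
    by_contra hne
    set d := M.simpleForm i y - ν * y i with hd
    have hd0 : d ≠ 0 := sub_ne_zero.mpr hne
    have hC : 0 < |2 - ν| + 1 := by positivity
    have h1 := hq (-d / (|2 - ν| + 1))
    have h2 : -d / (|2 - ν| + 1) * (2 * d) + (-d / (|2 - ν| + 1)) ^ 2 * (2 - ν) =
        d ^ 2 / (|2 - ν| + 1) ^ 2 * ((2 - ν) - 2 * (|2 - ν| + 1)) := by
      field_simp
      ring
    rw [h2] at h1
    have h3 : 0 < d ^ 2 / (|2 - ν| + 1) ^ 2 := by positivity
    have h4 := le_abs_self (2 - ν)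
    have h5 := abs_nonneg (2 - ν)
    nlinarith
  refine ⟨y, ν, ?_, heig⟩
  have hy0 : ∀ i, 0 ≤ y i := fun i => abs_nonneg _
  have hnb : ∀ i j, i ≠ j → M i j ≠ 2 → y i = 0 → y j = 0 := by
    intro i j hij hM hyi
    have h1 := heig i
    rw [hyi, mul_zero, CoxeterMatrix.simpleForm_apply] at h1
    simp only [← CoxeterMatrix.simpleForm_single] at h1
    have h2 : ∀ k ∈ Finset.univ, M.simpleForm i (Pi.single k 1) * y k ≤ 0 := by
      intro k _
      by_cases hik : i = k
      · subst hik; simp [hyi]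
      · exact mul_nonpos_of_nonpos_of_nonneg (CoxeterMatrix.simpleForm_single_nonpos hik) (hy0 k)
    have h3 := (Finset.sum_eq_zero_iff_of_nonpos h2).mp h1 j (Finset.mem_univ _)
    have h4 := CoxeterMatrix.simpleForm_single_le_neg_one hij hM
    exact (mul_eq_zero.mp h3).resolve_left (by linarith)
  have hconst := hirr.eq_of_forall_adj (fun i => (y i = 0)) (fun i j hij hM =>
    propext ⟨hnb i j hij hM, hnb j i hij.symm (by rwa [M.symmetric])⟩)
  intro i
  refine lt_of_le_of_ne (hy0 i) fun h => ?_
  have hall : y = 0 := funext fun j => by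
    have : (y i = 0) = (y j = 0) := hconst i j
    exact this ▸ h.symm
  rw [hall] at hy1
  simp at hy1

end CoxeterSystem

lemma eq_recSeq {c : ℝ} {z : ℕ → ℝ} (hz : ∀ k, z (k + 2) = c * z (k + 1) - z k) (k : ℕ) :
    z (k + 1) = recSeq c (k + 1) * z 1 - recSeq c k * z 0 := by
  induction k using Nat.twoStepInduction with
  | zero => simp [recSeq]
  | one => rw [hz]; simp [recSeq]
  | more k h1 h2 =>
    rw [hz, h1, h2, recSeq_add_two c (k + 1), recSeq_add_two c k]
    ring

/-- A sequence satisfying the recurrence is determined by two consecutive terms, also backwards. -/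
lemma eq_recSeq_of_eq_zero {c : ℝ} {z : ℕ → ℝ} (hz : ∀ k, z (k + 2) = c * z (k + 1) - z k)
    {n : ℕ} (hn : z (n + 1) = 0) {j : ℕ} (hj : j ≤ n) : z (n - j) = recSeq c (j + 1) * z n := by
  induction j using Nat.twoStepInduction with
  | zero => simp [recSeq]
  | one =>
    obtain ⟨m, rfl⟩ : ∃ m, n = m + 1 := ⟨n - 1, by omega⟩
    have := hz m
    rw [show m + 2 = m + 1 + 1 by rfl, hn] at this
    simp only [recSeq, Nat.add_sub_cancel]
    linarith
  | more j h1 h2 =>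
    have h3 := hz (n - (j + 2))
    rw [show n - (j + 2) + 2 = n - j by omega, show n - (j + 2) + 1 = n - (j + 1) by omega,
      h1 (by omega), h2 (by omega)] at h3
    rw [recSeq_add_two c (j + 1)]
    linarith

lemma recSeq_invariant (c : ℝ) (k : ℕ) :
    recSeq c (k + 1) ^ 2 - c * recSeq c (k + 1) * recSeq c k + recSeq c k ^ 2 = 1 := by
  induction k with
  | zero => simp [recSeq]
  | succ k ih => rw [recSeq_add_two]; linear_combination ih

lemma recSeq_add {c : ℝ} {K : ℕ} (hK : recSeq c K = 0) (k : ℕ) :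
    recSeq c (k + K) = recSeq c (K + 1) * recSeq c k := by
  induction k using Nat.twoStepInduction with
  | zero => simp [recSeq, hK]
  | one => rw [add_comm 1 K]; simp [recSeq]
  | more k h1 h2 =>
    rw [show k + 2 + K = (k + K) + 2 by ring, recSeq_add_two, recSeq_add_two, h1,
      show k + K + 1 = k + 1 + K by ring, h2]
    ring

/-- If `K` is the first positive zero of `recSeq c`, and the sequence is positive before, then
`(recSeq c (2 m), recSeq c (2 m + 1)) = (0, 1)` first happens at `m = K`. -/
lemma recSeq_two_mul_eq {c : ℝ} {K : ℕ} (hK0 : 0 < K) (hK : recSeq c K = 0)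
    (hpos : ∀ k, 0 < k → k < K → 0 < recSeq c k) :
    (recSeq c (2 * K) = 0 ∧ recSeq c (2 * K + 1) = 1) ∧
      ∀ m, 0 < m → m < K → ¬ (recSeq c (2 * m) = 0 ∧ recSeq c (2 * m + 1) = 1) := by
  have hK1 : K ≠ 1 := by rintro rfl; simp [recSeq] at hK
  have hsq : recSeq c (K + 1) ^ 2 = 1 := by
    have := recSeq_invariant c K
    rw [hK] at this
    linarith
  have hneg : recSeq c (K + 1) = -1 := by
    obtain ⟨k, rfl⟩ : ∃ k, K = k + 1 := ⟨K - 1, by omega⟩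
    rw [recSeq_add_two, hK] at hsq ⊢
    have := hpos k (by omega) (by omega)
    nlinarith
  refine ⟨⟨?_, ?_⟩, ?_⟩
  · rw [two_mul, recSeq_add hK, hK, mul_zero]
  · rw [show 2 * K + 1 = (K + 1) + K by ring, recSeq_add hK, hneg]
    norm_num
  · rintro m hm0 hmK ⟨h0, h1⟩
    rcases lt_trichotomy (2 * m) K with h | h | h
    · exact (hpos (2 * m) (by omega) h).ne' h0
    · rw [h, hneg] at h1
      norm_num at h1
    · have e : 2 * m = (2 * m - K) + K := by omega
      rw [e, recSeq_add hK, hneg] at h0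
      have := hpos (2 * m - K) (by omega) (by omega)
      linarith

namespace CoxeterSystem

variable {B W : Type*} [Fintype B] [DecidableEq B] [Group W] {M : CoxeterMatrix B}
  (cs : CoxeterSystem M W)

lemma geometricRep_wordProd_of_commute {l : List B} (hl : l.Nodup)
    (hc : ∀ i ∈ l, ∀ j ∈ l, i ≠ j → M i j = 2) (v : B → ℝ) :
    cs.geometricRep (cs.wordProd l) v =
      v - ∑ i ∈ l.toFinset, M.simpleForm i v • Pi.single i 1 := by
  induction l with
  | nil => simp
  | cons a l ih =>
    have hal := (List.nodup_cons.mp hl).1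
    rw [wordProd_cons, geometricRep_mul_apply, ih (List.nodup_cons.mp hl).2
      fun i hi j hj => hc i (by simp [hi]) j (by simp [hj]), List.toFinset_cons,
      Finset.sum_insert (by simpa using hal), geometricRep_simple_apply]
    have h0 : M.simpleForm a (∑ i ∈ l.toFinset, M.simpleForm i v • Pi.single i 1) = 0 := by
      rw [map_sum]
      refine Finset.sum_eq_zero fun i hi => ?_
      have hi' : i ∈ l := by simpa using hi
      rw [map_smul, CoxeterMatrix.simpleForm_single_of_eq_two, smul_zero]
      exact hc a (by simp) i (by simp [hi']) (by rintro rfl; exact hal hi')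
    rw [map_sub, h0, sub_zero]
    abel

section bipartite

variable (χ : B → Bool)

/-- The letters of colour `p`, in some order. -/
def colorList (p : Bool) : List B := (Finset.univ.filter fun i => χ i = p).toList

/-- The product of the simple reflections of colour `p`. -/
def colorProd (p : Bool) : W := cs.wordProd (colorList χ p)

lemma mem_colorList {p : Bool} {i : B} : i ∈ colorList χ p ↔ χ i = p := by simp [colorList]

lemma colorList_toFinset (p : Bool) :
    (colorList χ p).toFinset = Finset.univ.filter fun i => χ i = p := by
  ext; simp [colorList]

/-- The products `1, c_p, c_{!p} c_p, c_p c_{!p} c_p, …` of the two commuting families. -/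
def colorWord (p : Bool) : ℕ → W
  | 0 => 1
  | k + 1 => cs.colorProd χ (xor p (k % 2 = 1)) * colorWord p k

lemma colorWord_succ (p : Bool) (k : ℕ) :
    cs.colorWord χ p (k + 1) = cs.colorProd χ (xor p (k % 2 = 1)) * cs.colorWord χ p k := rfl

lemma colorWord_two_mul (p : Bool) (m : ℕ) :
    cs.colorWord χ p (2 * m) = (cs.colorProd χ (!p) * cs.colorProd χ p) ^ m := by
  induction m with
  | zero => simp [colorWord]
  | succ m ih =>
    rw [show 2 * (m + 1) = 2 * m + 1 + 1 by ring, colorWord_succ, colorWord_succ, ih, pow_succ',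
      mul_assoc]
    have h1 : (2 * m + 1) % 2 = 1 := by omega
    have h2 : (2 * m) % 2 = 0 := by omega
    simp [h1, h2]

/-- The coordinates of `v` of colour `p`, summed with the weights `x`. -/
def colorSum (x : B → ℝ) (p : Bool) (v : B → ℝ) : ℝ :=
  ∑ i ∈ Finset.univ.filter (fun i => χ i = p), x i * v i

variable {χ}

lemma geometricRep_colorProd (hχ : ∀ i j, i ≠ j → χ i = χ j → M i j = 2) (p : Bool) (v : B → ℝ) :
    cs.geometricRep (cs.colorProd χ p) v =
      v - ∑ i ∈ Finset.univ.filter (fun i => χ i = p), M.simpleForm i v • Pi.single i 1 := by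
  rw [colorProd, geometricRep_wordProd_of_commute, colorList_toFinset]
  · exact Finset.nodup_toList _
  · intro i hi j hj hij
    rw [mem_colorList] at hi hj
    exact hχ i j hij (hi.trans hj.symm)

lemma geometricRep_colorProd_apply_of_ne (hχ : ∀ i j, i ≠ j → χ i = χ j → M i j = 2) {p : Bool}
    (v : B → ℝ) {k : B} (hk : χ k ≠ p) : cs.geometricRep (cs.colorProd χ p) v k = v k := by
  rw [geometricRep_colorProd _ hχ, Pi.sub_apply, Finset.sum_apply, Finset.sum_eq_zero, sub_zero]
  intro i hi
  have : k ≠ i := by rintro rfl; simp [hk] at hi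
  simp [this]

lemma geometricRep_colorProd_single (hχ : ∀ i j, i ≠ j → χ i = χ j → M i j = 2) (i : B) :
    cs.geometricRep (cs.colorProd χ (χ i)) (Pi.single i 1) = -Pi.single i 1 := by
  rw [geometricRep_colorProd _ hχ, Finset.sum_eq_single i]
  · rw [CoxeterMatrix.simpleForm_self, two_smul]; abel
  · intro j hj hji
    rw [CoxeterMatrix.simpleForm_single_of_eq_two, zero_smul]
    exact hχ j i hji (by simpa using hj)
  · simp

lemma colorSum_colorProd_not (hχ : ∀ i j, i ≠ j → χ i = χ j → M i j = 2) (x : B → ℝ) (p : Bool)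
    (v : B → ℝ) :
    colorSum χ x (!p) (cs.geometricRep (cs.colorProd χ p) v) = colorSum χ x (!p) v := by
  refine Finset.sum_congr rfl fun i hi => ?_
  rw [geometricRep_colorProd_apply_of_ne _ hχ]
  have : χ i = !p := by simpa using hi
  rw [this]
  cases p <;> simp

/-- On the plane of the two colour sums, the product of the reflections of one colour acts as a
reflection, because `x` is an eigenvector of the form. -/
lemma colorSum_colorProd (hχ : ∀ i j, i ≠ j → χ i = χ j → M i j = 2) {x : B → ℝ} {ν : ℝ}
    (hx : ∀ i, M.simpleForm i x = ν * x i) (p : Bool) (v : B → ℝ) :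
    colorSum χ x p (cs.geometricRep (cs.colorProd χ p) v) =
      (2 - ν) * colorSum χ x (!p) v - colorSum χ x p v := by
  have h1 : colorSum χ x p (cs.geometricRep (cs.colorProd χ p) v) = colorSum χ x p v -
      ∑ i ∈ Finset.univ.filter (fun i => χ i = p), x i * M.simpleForm i v := by
    rw [colorSum, colorSum, ← Finset.sum_sub_distrib]
    refine Finset.sum_congr rfl fun i hi => ?_
    rw [geometricRep_colorProd _ hχ, Pi.sub_apply, Finset.sum_apply, Finset.sum_eq_single i]
    · simp [mul_sub]
    · intro j _ hji
      simp [hji.symm]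
    · exact fun h => absurd hi h
  have hsame : ∀ q, ∀ j, χ j = q → ∑ i ∈ Finset.univ.filter (fun i => χ i = q),
      x i * M.simpleForm i (Pi.single j 1) = 2 * x j := by
    intro q j hj
    rw [Finset.sum_eq_single j]
    · rw [CoxeterMatrix.simpleForm_self]; ring
    · intro i hi hij
      rw [CoxeterMatrix.simpleForm_single_of_eq_two, mul_zero]
      exact hχ i j hij (by rw [hj]; simpa using hi)
    · simp [hj]
  have hall : ∀ j, ∑ i, x i * M.simpleForm i (Pi.single j 1) = ν * x j := by
    intro j
    rw [← hx, CoxeterMatrix.simpleForm_apply]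
    simp only [← CoxeterMatrix.simpleForm_single]
    exact Finset.sum_congr rfl fun i _ => by rw [CoxeterMatrix.simpleForm_single_comm, mul_comm]
  have hsplit : ∀ f : B → ℝ, ∑ i, f i = ∑ i ∈ Finset.univ.filter (fun i => χ i = p), f i +
      ∑ i ∈ Finset.univ.filter (fun i => χ i = !p), f i := by
    intro f
    rw [← Finset.sum_filter_add_sum_filter_not Finset.univ (fun i => χ i = p)]
    congr 2
    ext i
    cases p <;> simp
  have hother : ∀ j, χ j = (!p) → ∑ i ∈ Finset.univ.filter (fun i => χ i = p),
      x i * M.simpleForm i (Pi.single j 1) = (ν - 2) * x j := by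
    intro j hj
    have h2 := hall j
    rw [hsplit, hsame _ j hj] at h2
    linarith
  have h3 : ∑ i ∈ Finset.univ.filter (fun i => χ i = p), x i * M.simpleForm i v =
      2 * colorSum χ x p v + (ν - 2) * colorSum χ x (!p) v := by
    have e : ∀ i, x i * M.simpleForm i v = ∑ j, x i * M.simpleForm i (Pi.single j 1) * v j := by
      intro i
      rw [CoxeterMatrix.simpleForm_apply, Finset.mul_sum]
      simp only [← CoxeterMatrix.simpleForm_single, mul_assoc]
    simp only [e]
    rw [Finset.sum_comm, hsplit]
    simp only [← Finset.sum_mul, colorSum, Finset.mul_sum]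
    congr 1
    · refine Finset.sum_congr rfl fun j hj => ?_
      rw [hsame p j (by simpa using hj)]; ring
    · refine Finset.sum_congr rfl fun j hj => ?_
      rw [hother j (by simpa using hj)]; ring
  rw [h1, h3]
  ring

/-- The colour sums of the images of a vector under the alternating words satisfy the dihedral
recurrence. -/
lemma colorSum_colorWord (hχ : ∀ i j, i ≠ j → χ i = χ j → M i j = 2) {x : B → ℝ} {ν : ℝ}
    (hx : ∀ i, M.simpleForm i x = ν * x i) (p : Bool) (v : B → ℝ) :
    ∃ z : ℕ → ℝ, (∀ k, z (k + 2) = (2 - ν) * z (k + 1) - z k) ∧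
      ∀ k, z k = colorSum χ x (xor p (k % 2 = 1)) (cs.geometricRep (cs.colorWord χ p k) v) ∧
        z (k + 1) = colorSum χ x (!(xor p (k % 2 = 1)))
          (cs.geometricRep (cs.colorWord χ p k) v) := by
  have hpar : ∀ k : ℕ, xor p ((k + 1) % 2 = 1) = !(xor p (k % 2 = 1)) := by
    intro k
    rcases Nat.mod_two_eq_zero_or_one k with h | h
    · have : (k + 1) % 2 = 1 := by omega
      simp [h, this]
    · have : (k + 1) % 2 = 0 := by omega
      simp [h, this]
  have hz1 : ∀ k, colorSum χ x (xor p ((k + 1) % 2 = 1))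
      (cs.geometricRep (cs.colorWord χ p (k + 1)) v) = colorSum χ x (!(xor p (k % 2 = 1)))
          (cs.geometricRep (cs.colorWord χ p k) v) := by
    intro k
    rw [hpar, colorWord_succ, geometricRep_mul_apply, colorSum_colorProd_not _ hχ]
  refine ⟨fun k => colorSum χ x (xor p (k % 2 = 1)) (cs.geometricRep (cs.colorWord χ p k) v),
    fun k => ?_, fun k => ⟨rfl, hz1 k⟩⟩
  simp only
  rw [hz1 (k + 1), hz1 k, hpar, Bool.not_not, colorWord_succ, geometricRep_mul_apply,
    colorSum_colorProd _ hχ hx]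

lemma colorSum_nonneg {x : B → ℝ} (hx : ∀ i, 0 < x i) {v : B → ℝ} (hv : 0 ≤ v) (p : Bool) :
    0 ≤ colorSum χ x p v :=
  Finset.sum_nonneg fun i _ => mul_nonneg (hx i).le (hv i)

lemma colorSum_neg (x v : B → ℝ) (p : Bool) : colorSum χ x p (-v) = -colorSum χ x p v := by
  simp [colorSum]

lemma colorSum_add_colorSum_not (x v : B → ℝ) (p : Bool) :
    colorSum χ x p v + colorSum χ x (!p) v = ∑ i, x i * v i := by
  rw [colorSum, colorSum, ← Finset.sum_filter_add_sum_filter_not Finset.univ (fun i => χ i = p)]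
  congr 2
  ext i
  cases p <;> simp

variable {cs} in
/-- The sign of a root is the sign of its colour sums. -/
lemma mem_positiveRoots_iff_colorSum {x : B → ℝ} (hx : ∀ i, 0 < x i) {β : B → ℝ}
    (hβ : β ∈ cs.roots) (p : Bool) :
    β ∈ cs.positiveRoots ↔ 0 < colorSum χ x p β + colorSum χ x (!p) β := by
  rw [colorSum_add_colorSum_not]
  have key : ∀ γ ∈ cs.positiveRoots, 0 < ∑ i, x i * γ i := by
    intro γ hγ
    obtain ⟨k, hk⟩ : ∃ k, 0 < γ k := by
      by_contra! hcon
      exact ne_zero_of_mem_roots hγ.1 (funext fun k => le_antisymm (hcon k) (hγ.2 k))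
    exact Finset.sum_pos' (fun i _ => mul_nonneg (hx i).le (hγ.2 i))
      ⟨k, Finset.mem_univ _, mul_pos (hx k) hk⟩
  refine ⟨key β, fun h => ?_⟩
  refine (positiveRoots_or_neg hβ).resolve_right fun h' => ?_
  have := key _ h'
  simp only [Pi.neg_apply, mul_neg, Finset.sum_neg_distrib] at this
  linarith

variable {cs} in
/-- The positive roots made negative by the product of the reflections of one colour are the
simple roots of that colour. -/
lemma eq_single_of_colorProd (hχ : ∀ i j, i ≠ j → χ i = χ j → M i j = 2) {p : Bool} {β : B → ℝ}
    (hβ : β ∈ cs.positiveRoots)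
    (hneg : cs.geometricRep (cs.colorProd χ p) β ∉ cs.positiveRoots) :
    ∃ i, χ i = p ∧ β = Pi.single i 1 := by
  have hsupp : ∀ k, χ k ≠ p → β k = 0 := by
    intro k hk
    by_contra h0
    have hpos : 0 < β k := lt_of_le_of_ne (hβ.2 k) (Ne.symm h0)
    refine hneg (positiveRoots_of_coord_pos (geometricRep_mem_roots _ hβ.1) (k := k) ?_)
    rwa [geometricRep_colorProd_apply_of_ne _ hχ _ hk]
  obtain ⟨i, hi⟩ : ∃ i, 0 < β i := by
    by_contra! hcon
    exact ne_zero_of_mem_roots hβ.1 (funext fun k => le_antisymm (hcon k) (hβ.2 k))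
  have hip : χ i = p := by
    by_contra h
    rw [hsupp i h] at hi
    exact lt_irrefl _ hi
  refine ⟨i, hip, ?_⟩
  by_contra hne
  have h1 := (cs.geometricRep_simple_mem_positiveRoots hβ hne).2 i
  have h2 : M.simpleForm i β = 2 * β i := by
    rw [CoxeterMatrix.simpleForm_apply, Finset.sum_eq_single i]
    · rw [← CoxeterMatrix.simpleForm_single, CoxeterMatrix.simpleForm_self]
    · intro j _ hji
      rw [← CoxeterMatrix.simpleForm_single]
      by_cases hj : χ j = p
      · rw [CoxeterMatrix.simpleForm_single_of_eq_two (hχ i j hji.symm (hip.trans hj.symm)),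
          zero_mul]
      · rw [hsupp j hj, mul_zero]
    · simp
  rw [geometricRep_simple_apply, h2] at h1
  simp at h1
  linarith

end bipartite

end CoxeterSystem

namespace CoxeterSystem

variable {B W : Type*} [Fintype B] [DecidableEq B] [Group W] {M : CoxeterMatrix B}
  {cs : CoxeterSystem M W} {χ : B → Bool}

lemma colorSum_single (x : B → ℝ) (i : B) (p : Bool) :
    colorSum χ x p (Pi.single i 1) = if χ i = p then x i else 0 := by
  rw [colorSum]
  simp [Pi.single_apply, Finset.sum_filter]

/-- If `α_i` has the colour of the next letter, then the roots met on the way from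
`β = V_n⁻¹ α_i` to `α_i` have the colour sums of consecutive roots of a dihedral group. -/
lemma colorSum_of_colorWord_eq_single (hχ : ∀ i j, i ≠ j → χ i = χ j → M i j = 2) {x : B → ℝ}
    {ν : ℝ} (hx : ∀ i, M.simpleForm i x = ν * x i) {p : Bool} {n : ℕ} {i : B}
    (hi : χ i = xor p (n % 2 = 1)) {β : B → ℝ}
    (hβ : cs.geometricRep (cs.colorWord χ p n) β = Pi.single i 1) {j : ℕ} (hj : j ≤ n) :
    colorSum χ x (xor p ((n - j : ℕ) % 2 = 1))
        (cs.geometricRep (cs.colorWord χ p (n - j)) β) = recSeq (2 - ν) (j + 1) * x i ∧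
      colorSum χ x (!(xor p ((n - j : ℕ) % 2 = 1)))
        (cs.geometricRep (cs.colorWord χ p (n - j)) β) = recSeq (2 - ν) j * x i := by
  obtain ⟨z, hz, hzc⟩ := cs.colorSum_colorWord hχ hx p β
  have hn : z n = x i := by
    rw [(hzc n).1, hβ, colorSum_single, if_pos hi]
  have hn1 : z (n + 1) = 0 := by
    rw [(hzc n).2, hβ, colorSum_single, if_neg]
    rw [hi]
    simp
  rw [← (hzc (n - j)).1, ← (hzc (n - j)).2, ← hn]
  refine ⟨eq_recSeq_of_eq_zero hz hn1 hj, ?_⟩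
  rcases j with _ | j
  · rw [Nat.sub_zero, hn1]; simp [recSeq]
  · rw [← eq_recSeq_of_eq_zero hz hn1 (by omega : j ≤ n)]
    congr 1
    omega

/-- The first zero of the dihedral recurrence, and positivity before it. -/
lemma exists_first_zero (cs : CoxeterSystem M W) [Finite W]
    (hχ : ∀ i j, i ≠ j → χ i = χ j → M i j = 2) {x : B → ℝ}
    {ν : ℝ} (hpos : ∀ i, 0 < x i) (hx : ∀ i, M.simpleForm i x = ν * x i) (i₀ : B) :
    ∃ K, 0 < K ∧ recSeq (2 - ν) K = 0 ∧ ∀ k, 0 < k → k < K → 0 < recSeq (2 - ν) k := by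
  classical
  have hex : ∃ K, 0 < K ∧ recSeq (2 - ν) K = 0 := by
    set c := cs.colorProd χ (!χ i₀) * cs.colorProd χ (χ i₀)
    have hc := pow_orderOf_eq_one c
    refine ⟨2 * orderOf c, by have := orderOf_pos c; omega, ?_⟩
    obtain ⟨z, hz, hzc⟩ := cs.colorSum_colorWord hχ hx (χ i₀) (Pi.single i₀ 1)
    have h0 : z 0 = x i₀ := by
      rw [(hzc 0).1, colorWord, geometricRep_one_apply, colorSum_single]; simp
    have h1 : z 1 = 0 := by
      rw [(hzc 0).2, colorWord, geometricRep_one_apply, colorSum_single]; simp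
    have h2 : z (2 * orderOf c + 1) = 0 := by
      rw [(hzc (2 * orderOf c)).2, colorWord_two_mul, hc, geometricRep_one_apply,
        colorSum_single]
      have : (2 * orderOf c) % 2 = 0 := by omega
      simp [this]
    rw [eq_recSeq hz, h0, h1] at h2
    have := (hpos i₀).ne'
    have h3 : recSeq (2 - ν) (2 * orderOf c) * x i₀ = 0 := by linarith
    exact (mul_eq_zero.mp h3).resolve_right this
  refine ⟨Nat.find hex, (Nat.find_spec hex).1, (Nat.find_spec hex).2, ?_⟩
  have hnz : ∀ k, 0 < k → k < Nat.find hex → recSeq (2 - ν) k ≠ 0 := fun k h0 hk h =>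
    Nat.find_min hex hk ⟨h0, h⟩
  by_cases hν : 2 - ν = 0
  · have h2 : Nat.find hex ≤ 2 := Nat.find_min' hex ⟨by norm_num, by simp [recSeq, hν]⟩
    intro k h0 hk
    obtain rfl : k = 1 := by omega
    simp [recSeq]
  -- both colours occur
  have hcol : ∀ p, ∃ i, χ i = p := by
    have hopp : ∃ i, χ i ≠ χ i₀ := by
      by_contra! hall
      have h := hx i₀
      rw [CoxeterMatrix.simpleForm_apply, Finset.sum_eq_single i₀] at h
      · rw [← CoxeterMatrix.simpleForm_single, CoxeterMatrix.simpleForm_self] at h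
        have := (hpos i₀).ne'
        exact hν (by linarith [mul_right_cancel₀ this h])
      · intro j _ hj
        rw [← CoxeterMatrix.simpleForm_single,
          CoxeterMatrix.simpleForm_single_of_eq_two (hχ i₀ j hj.symm (hall j).symm), zero_mul]
      · simp
    obtain ⟨i₁, hi₁⟩ := hopp
    intro p
    by_cases h : χ i₀ = p
    · exact ⟨i₀, h⟩
    · refine ⟨i₁, ?_⟩
      cases h0 : χ i₀ <;> cases h1 : χ i₁ <;> cases p <;> simp_all
  intro k
  induction k with
  | zero => intro h; exact absurd h (lt_irrefl _)
  | succ k ih =>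
    intro _ hk
    rcases Nat.eq_zero_or_pos k with rfl | hk0
    · simp [recSeq]
    have hak := ih hk0 (by omega)
    refine lt_of_le_of_ne ?_ (hnz (k + 1) (by omega) hk).symm
    obtain ⟨i, hi⟩ := hcol (xor true (k % 2 = 1))
    set β := cs.geometricRep (cs.colorWord χ true k)⁻¹ (Pi.single i 1) with hβ
    have hβ' : cs.geometricRep (cs.colorWord χ true k) β = Pi.single i 1 :=
      cs.geometricRep_apply_inv_self _ _
    have hβr : β ∈ cs.roots := geometricRep_mem_roots _ (cs.single_mem_roots i)
    have h := colorSum_of_colorWord_eq_single hχ hx hi hβ' (le_refl k)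
    rw [Nat.sub_self, colorWord, geometricRep_one_apply] at h
    simp only [Nat.zero_mod, zero_ne_one, decide_false, Bool.xor_false, Bool.not_true] at h
    have hxi := hpos i
    rcases positiveRoots_or_neg hβr with h' | h'
    · have h1 := colorSum_nonneg (χ := χ) hpos h'.2 true
      rw [h.1] at h1
      exact nonneg_of_mul_nonneg_left h1 hxi
    · have h1 := colorSum_nonneg (χ := χ) hpos h'.2 false
      rw [colorSum_neg, h.2] at h1
      nlinarith

/-- Each positive root is made negative by exactly one of the first `K` letters of the alternating
product of the two commuting families. -/
lemma card_posRoots_eq_sum (cs : CoxeterSystem M W) [Finite W]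
    (hχ : ∀ i j, i ≠ j → χ i = χ j → M i j = 2) {x : B → ℝ}
    {ν : ℝ} (hpos : ∀ i, 0 < x i) (hx : ∀ i, M.simpleForm i x = ν * x i) {K : ℕ} (hK0 : 0 < K)
    (hK : recSeq (2 - ν) K = 0) (hKpos : ∀ k, 0 < k → k < K → 0 < recSeq (2 - ν) k) (p : Bool) :
    cs.posRoots.card = ∑ k ∈ Finset.range K,
      (Finset.univ.filter fun i => χ i = xor p (k % 2 = 1)).card := by
  classical
  have hK1 : K ≠ 1 := by rintro rfl; simp [recSeq] at hK
  have hnn : ∀ k, k ≤ K → 0 ≤ recSeq (2 - ν) k := by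
    intro k hk
    rcases Nat.eq_zero_or_pos k with rfl | h0
    · simp [recSeq]
    · rcases hk.eq_or_lt with rfl | h
      · exact hK.ge
      · exact (hKpos k h0 h).le
  -- all roots met before `V_n⁻¹ α_i` is made negative are positive
  have hA : ∀ n, n < K → ∀ i, χ i = xor p (n % 2 = 1) → ∀ β ∈ cs.roots,
      cs.geometricRep (cs.colorWord χ p n) β = Pi.single i 1 → ∀ j, j ≤ n →
      cs.geometricRep (cs.colorWord χ p j) β ∈ cs.positiveRoots := by
    intro n hn i hi β hβ hβi j hj
    have h := colorSum_of_colorWord_eq_single hχ hx hi hβi (j := n - j) (by omega)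
    rw [show n - (n - j) = j by omega] at h
    rw [mem_positiveRoots_iff_colorSum hpos (geometricRep_mem_roots _ hβ)
      (xor p (j % 2 = 1)), h.1, h.2, ← add_mul]
    refine mul_pos ?_ (hpos i)
    have h1 := hnn (n - j + 1) (by omega)
    have h2 := hnn (n - j) (by omega)
    rcases Nat.eq_zero_or_pos (n - j) with h0 | h0
    · rw [h0]; simp [recSeq]
    · have := hKpos (n - j) h0 (by omega)
      linarith
  -- `V_K` makes all positive roots negative
  have hB : ∀ β ∈ cs.positiveRoots,
      cs.geometricRep (cs.colorWord χ p K) β ∉ cs.positiveRoots := by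
    intro β hβ
    obtain ⟨z, hz, hzc⟩ := cs.colorSum_colorWord hχ hx p β
    rw [mem_positiveRoots_iff_colorSum hpos (geometricRep_mem_roots _ hβ.1)
      (xor p (K % 2 = 1)), ← (hzc K).1, ← (hzc K).2, not_lt]
    have h0 : z 0 + z 1 = colorSum χ x p β + colorSum χ x (!p) β := by
      rw [(hzc 0).1, (hzc 0).2, colorWord, geometricRep_one_apply]
      simp
    have h0' := (mem_positiveRoots_iff_colorSum (χ := χ) hpos hβ.1 p).mp hβ
    obtain ⟨k, rfl⟩ : ∃ k, K = k + 1 := ⟨K - 1, by omega⟩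
    rw [eq_recSeq hz k, eq_recSeq hz (k + 1), recSeq_add_two, hK]
    have := hKpos k (by omega) (by omega)
    nlinarith
  rw [← Finset.card_sigma]
  symm
  refine Finset.card_bij (fun s _ => cs.geometricRep (cs.colorWord χ p s.1)⁻¹ (Pi.single s.2 1))
    ?_ ?_ ?_
  · rintro ⟨n, i⟩ hs
    simp only [Finset.mem_sigma, Finset.mem_range, Finset.mem_filter, Finset.mem_univ,
      true_and] at hs
    rw [mem_posRoots]
    have := hA n hs.1 i hs.2 _ (geometricRep_mem_roots _ (cs.single_mem_roots i))
      (cs.geometricRep_apply_inv_self _ _) 0 (Nat.zero_le n)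
    rwa [colorWord, geometricRep_one_apply] at this
  · have hlt : ∀ n i n' i', n < n' → n' < K → χ i = xor p (n % 2 = 1) → χ i' = xor p (n' % 2 = 1) →
        cs.geometricRep (cs.colorWord χ p n)⁻¹ (Pi.single i 1) =
          cs.geometricRep (cs.colorWord χ p n')⁻¹ (Pi.single i' 1) → False := by
      intro n i n' i' hnn' hn' hi hi' heq
      have h1 := hA n' hn' i' hi' _ (geometricRep_mem_roots _ (cs.single_mem_roots i'))
        (cs.geometricRep_apply_inv_self _ _) (n + 1) (by omega)
      rw [← heq, colorWord_succ, geometricRep_mul_apply, geometricRep_apply_inv_self, ← hi,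
        geometricRep_colorProd_single _ hχ] at h1
      exact neg_notMem_positiveRoots (cs.single_mem_positiveRoots i) h1
    rintro ⟨n, i⟩ hs ⟨n', i'⟩ hs' heq
    simp only [Finset.mem_sigma, Finset.mem_range, Finset.mem_filter, Finset.mem_univ,
      true_and] at hs hs' heq
    rcases lt_trichotomy n n' with h | rfl | h
    · exact (hlt n i n' i' h hs'.1 hs.2 hs'.2 heq).elim
    · have h1 := (cs.geometricRep (cs.colorWord χ p n)⁻¹).injective heq
      have h2 := congrFun h1 i
      have : i = i' := by
        by_contra hne
        simp [hne] at h2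
      rw [this]
    · exact (hlt n' i' n i h hs.1 hs'.2 hs.2 heq.symm).elim
  · intro β hβ
    rw [mem_posRoots] at hβ
    have hex : ∃ k, cs.geometricRep (cs.colorWord χ p k) β ∉ cs.positiveRoots := ⟨K, hB β hβ⟩
    have hfind := Nat.find_spec hex
    have hle : Nat.find hex ≤ K := Nat.find_min' hex (hB β hβ)
    obtain ⟨n, hn⟩ : ∃ n, Nat.find hex = n + 1 := by
      refine Nat.exists_eq_succ_of_ne_zero fun h0 => ?_
      rw [h0, colorWord, geometricRep_one_apply] at hfind
      exact hfind hβ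
    have hprev : cs.geometricRep (cs.colorWord χ p n) β ∈ cs.positiveRoots :=
      not_not.mp (Nat.find_min hex (m := n) (by omega))
    rw [hn, colorWord_succ, geometricRep_mul_apply] at hfind
    obtain ⟨i, hi, hβi⟩ := eq_single_of_colorProd hχ hprev hfind
    refine ⟨⟨n, i⟩, ?_, ?_⟩
    · simp only [Finset.mem_sigma, Finset.mem_range, Finset.mem_filter, Finset.mem_univ,
        true_and]
      exact ⟨by omega, hi⟩
    · rw [← hβi, geometricRep_inv_apply_self]

/-- The two families generate a dihedral group acting faithfully through the colour sums, so the
order of the product is the first zero `K` of the dihedral recurrence. -/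
lemma orderOf_colorProd_mul (cs : CoxeterSystem M W) [Finite W]
    (hχ : ∀ i j, i ≠ j → χ i = χ j → M i j = 2) {x : B → ℝ}
    {ν : ℝ} (hpos : ∀ i, 0 < x i) (hx : ∀ i, M.simpleForm i x = ν * x i) {K : ℕ} (hK0 : 0 < K)
    (hK : recSeq (2 - ν) K = 0) (hKpos : ∀ k, 0 < k → k < K → 0 < recSeq (2 - ν) k) (i₀ : B) :
    orderOf (cs.colorProd χ (!χ i₀) * cs.colorProd χ (χ i₀)) = K := by
  set c := cs.colorProd χ (!χ i₀) * cs.colorProd χ (χ i₀)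
  obtain ⟨⟨h0, h1⟩, h2⟩ := recSeq_two_mul_eq hK0 hK hKpos
  have key : ∀ m, 0 < m → (c ^ m = 1 ↔ recSeq (2 - ν) (2 * m) = 0 ∧
      recSeq (2 - ν) (2 * m + 1) = 1) := by
    intro m hm
    have hpar : (2 * m) % 2 = 0 := by omega
    have hz : ∀ v, ∃ z : ℕ → ℝ, (∀ k, z (k + 2) = (2 - ν) * z (k + 1) - z k) ∧
        z 0 = colorSum χ x (χ i₀) v ∧ z 1 = colorSum χ x (!χ i₀) v ∧
        z (2 * m) = colorSum χ x (χ i₀) (cs.geometricRep (c ^ m) v) ∧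
        z (2 * m + 1) = colorSum χ x (!χ i₀) (cs.geometricRep (c ^ m) v) := by
      intro v
      obtain ⟨z, hz, hzc⟩ := cs.colorSum_colorWord hχ hx (χ i₀) v
      refine ⟨z, hz, ?_, ?_, ?_, ?_⟩
      · rw [(hzc 0).1, colorWord, geometricRep_one_apply]; simp
      · rw [(hzc 0).2, colorWord, geometricRep_one_apply]; simp
      · rw [(hzc (2 * m)).1, colorWord_two_mul, hpar]; simp [c]
      · rw [(hzc (2 * m)).2, colorWord_two_mul, hpar]; simp [c]
    obtain ⟨l, rfl⟩ : ∃ l, m = l + 1 := ⟨m - 1, by omega⟩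
    constructor
    · intro hc
      obtain ⟨z, hz, hz0, hz1, hz2, hz3⟩ := hz (Pi.single i₀ 1)
      rw [hc, geometricRep_one_apply] at hz2 hz3
      rw [← hz0] at hz2
      rw [← hz1] at hz3
      have e0 : z 0 = x i₀ := by rw [hz0, colorSum_single]; simp
      have e1 : z 1 = 0 := by rw [hz1, colorSum_single]; simp
      have hxi := (hpos i₀).ne'
      rw [eq_recSeq hz, e1, e0] at hz3
      have a0 : recSeq (2 - ν) (2 * (l + 1)) = 0 :=
        (mul_eq_zero.mp (by linarith : recSeq (2 - ν) (2 * (l + 1)) * x i₀ = 0)).resolve_right hxi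
      rw [show 2 * (l + 1) = 2 * l + 1 + 1 by ring, eq_recSeq hz, e1, e0] at hz2
      have a1 : recSeq (2 - ν) (2 * l + 1) = -1 :=
        mul_right_cancel₀ hxi (by linarith)
      refine ⟨a0, ?_⟩
      rw [show 2 * (l + 1) + 1 = 2 * l + 1 + 2 by ring, recSeq_add_two, a1,
        show 2 * l + 1 + 1 = 2 * (l + 1) by ring, a0]
      ring
    · rintro ⟨a0, a1⟩
      have a2 : recSeq (2 - ν) (2 * l + 1) = -1 := by
        rw [show 2 * (l + 1) + 1 = 2 * l + 1 + 2 by ring, recSeq_add_two,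
          show 2 * l + 1 + 1 = 2 * (l + 1) by ring, a0] at a1
        linarith
      refine cs.eq_one_of_forall_nonneg fun i => ?_
      obtain ⟨z, hz, hz0, hz1, hz2, hz3⟩ := hz (Pi.single i 1)
      have e3 : z (2 * (l + 1) + 1) = z 1 := by rw [eq_recSeq hz, a0, a1]; ring
      have e2 : z (2 * (l + 1)) = z 0 := by
        rw [show 2 * (l + 1) = 2 * l + 1 + 1 by ring, eq_recSeq hz, a2,
          show 2 * l + 1 + 1 = 2 * (l + 1) by ring, a0]
        ring
      refine ((mem_positiveRoots_iff_colorSum (χ := χ) hpos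
        (geometricRep_mem_roots _ (cs.single_mem_roots i)) (χ i₀)).mpr ?_).2
      rw [← hz2, ← hz3, e2, e3, hz0, hz1]
      exact (mem_positiveRoots_iff_colorSum hpos (cs.single_mem_roots i) (χ i₀)).mp
        (cs.single_mem_positiveRoots i)
  rw [orderOf_eq_iff hK0]
  refine ⟨(key K hK0).mpr ⟨h0, h1⟩, fun m hm hm0 h => h2 m hm0 hm ((key m hm0).mp h)⟩

/-- The number of roots of a finite irreducible Coxeter group is the rank times the Coxeter
number. -/
theorem two_mul_card_posRoots (cs : CoxeterSystem M W) [Finite W] (hirr : M.IsIrreducible) {h : ℕ}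
    (hh : cs.IsCoxeterNumber h) : 2 * cs.posRoots.card = Fintype.card B * h := by
  obtain ⟨χ, hχ⟩ := cs.exists_coloring hirr
  have hχ' : ∀ i j, i ≠ j → χ i = χ j → M i j = 2 := hχ
  obtain ⟨x, ν, hpos, hx⟩ := exists_pos_eigenvector (M := M) hirr
  obtain ⟨i₀⟩ := hirr.nonempty
  obtain ⟨K, hK0, hK, hKpos⟩ := cs.exists_first_zero hχ hpos hx i₀
  have hord := cs.orderOf_colorProd_mul hχ hpos hx hK0 hK hKpos i₀
  obtain ⟨c, ⟨l, hl, hmem, rfl⟩, rfl⟩ := hh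
  have hperm : l.Perm (colorList χ (!χ i₀) ++ colorList χ (χ i₀)) := by
    refine (List.perm_ext_iff_of_nodup hl ?_).mpr fun i => ?_
    · refine List.Nodup.append (Finset.nodup_toList _) (Finset.nodup_toList _) ?_
      intro i hi hi'
      rw [mem_colorList] at hi hi'
      rw [hi] at hi'
      simp at hi'
    · simp only [hmem, List.mem_append, mem_colorList, true_iff]
      cases χ i <;> cases χ i₀ <;> simp
  have hmoves := CoxeterMatrix.eqvGen_coxeterMove_of_perm (cs.exists_leaf hirr) hl hperm
  rw [cs.orderOf_wordProd_eq_of_eqvGen hmoves, wordProd_append]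
  change _ = _ * orderOf (cs.colorProd χ (!χ i₀) * cs.colorProd χ (χ i₀))
  rw [hord]
  have h1 := cs.card_posRoots_eq_sum hχ hpos hx hK0 hK hKpos true
  have h2 := cs.card_posRoots_eq_sum hχ hpos hx hK0 hK hKpos false
  have hsum : ∀ k, (Finset.univ.filter fun i => χ i = xor true (k % 2 = 1)).card +
      (Finset.univ.filter fun i => χ i = xor false (k % 2 = 1)).card = Fintype.card B := by
    intro k
    have e : (Finset.univ.filter fun i => χ i = xor false (k % 2 = 1)) =
        Finset.univ.filter fun i => ¬ χ i = xor true (k % 2 = 1) := by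
      ext i
      cases χ i <;> cases h : decide (k % 2 = 1) <;> simp [h]
    rw [e, Finset.card_filter_add_card_filter_not, Finset.card_univ]
  have h3 : cs.posRoots.card + cs.posRoots.card = ∑ k ∈ Finset.range K, Fintype.card B := by
    nth_rw 1 [h1]
    rw [h2, ← Finset.sum_add_distrib]
    exact Finset.sum_congr rfl fun k _ => hsum k
  rw [Finset.sum_const, Finset.card_range, smul_eq_mul] at h3
  linarith [mul_comm K (Fintype.card B)]

end CoxeterSystem

/-! ### Parabolic subgroups -/

namespace CoxeterSystem

variable {B W : Type*} [Fintype B] [DecidableEq B] [Group W] {M : CoxeterMatrix B}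
  (cs : CoxeterSystem M W)

/-- The standard parabolic subgroup `W_J`. -/
def parabolic (J : Finset B) : Subgroup W := Subgroup.closure (cs.simple '' J)

/-- `d` is minimal in its coset `d W_J`: it keeps the simple roots in `J` positive. -/
def IsCosetMin (J : Finset B) (d : W) : Prop :=
  ∀ i ∈ J, 0 ≤ cs.geometricRep d (Pi.single i 1)

variable {cs}

lemma simple_mem_parabolic {J : Finset B} {i : B} (hi : i ∈ J) : cs.simple i ∈ cs.parabolic J :=
  Subgroup.subset_closure ⟨i, hi, rfl⟩

lemma parabolic_mono {I J : Finset B} (h : I ⊆ J) : cs.parabolic I ≤ cs.parabolic J :=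
  Subgroup.closure_mono (Set.image_mono (by exact_mod_cast h))

lemma parabolic_univ : cs.parabolic Finset.univ = ⊤ := by
  simp [parabolic, cs.subgroup_closure_range_simple]

lemma parabolic_empty : cs.parabolic ∅ = ⊥ := by simp [parabolic]

/-- `W_J` changes only the coordinates in `J`. -/
lemma geometricRep_apply_of_notMem {J : Finset B} {w : W} (hw : w ∈ cs.parabolic J) {k : B}
    (hk : k ∉ J) (v : B → ℝ) : cs.geometricRep w v k = v k := by
  induction hw using Subgroup.closure_induction generalizing v with
  | mem w hw =>
    obtain ⟨i, hi, rfl⟩ := hw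
    have : k ≠ i := by rintro rfl; exact hk hi
    rw [geometricRep_simple_apply]
    simp [this]
  | one => rw [geometricRep_one_apply]
  | mul w w' _ _ ih ih' => rw [geometricRep_mul_apply, ih, ih']
  | inv w _ ih =>
    have := ih (cs.geometricRep w⁻¹ v)
    rw [geometricRep_apply_inv_self] at this
    exact this.symm

lemma IsCosetMin.nonneg {J : Finset B} {d : W} (hd : cs.IsCosetMin J d) {v : B → ℝ} (hv : 0 ≤ v)
    (hJ : ∀ k ∉ J, v k = 0) : 0 ≤ cs.geometricRep d v := by
  have : v = ∑ i ∈ J, v i • (Pi.single i 1 : B → ℝ) := by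
    ext k
    rw [Finset.sum_apply]
    by_cases hk : k ∈ J
    · rw [Finset.sum_eq_single k] <;> simp +contextual [hk, Pi.single_apply, eq_comm]
    · rw [hJ k hk, Finset.sum_eq_zero]
      intro i hi
      have : k ≠ i := by rintro rfl; exact hk hi
      simp [this]
  rw [this, map_sum]
  refine Finset.sum_nonneg fun i hi => ?_
  rw [map_smul]
  exact smul_nonneg (hv i) (hd i hi)

variable [Finite W]

variable (cs) in
open Classical in
/-- The positive roots of `W_J`. -/
def parabolicRoots (J : Finset B) : Finset (B → ℝ) :=
  cs.posRoots.filter fun β => ∀ k ∉ J, β k = 0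

lemma mem_parabolicRoots {J : Finset B} {β : B → ℝ} :
    β ∈ cs.parabolicRoots J ↔ β ∈ cs.positiveRoots ∧ ∀ k ∉ J, β k = 0 := by
  simp [parabolicRoots, mem_posRoots]

lemma geometricRep_mem_positiveRoots_of_notMem {J : Finset B} {w : W} (hw : w ∈ cs.parabolic J)
    {β : B → ℝ} (hβ : β ∈ cs.positiveRoots) (hJ : β ∉ cs.parabolicRoots J) :
    cs.geometricRep w β ∈ cs.positiveRoots := by
  rw [mem_parabolicRoots] at hJ
  push Not at hJ
  obtain ⟨k, hk, hne⟩ := hJ hβ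
  refine positiveRoots_of_coord_pos (geometricRep_mem_roots _ hβ.1) (k := k) ?_
  rw [geometricRep_apply_of_notMem hw hk]
  exact lt_of_le_of_ne (hβ.2 k) hne.symm

lemma inversions_subset_parabolicRoots {J : Finset B} {w : W} (hw : w ∈ cs.parabolic J) :
    cs.inversions w ⊆ cs.parabolicRoots J := by
  intro β hβ
  have hβ' := (mem_inversions.mp hβ).1
  by_contra h
  exact (notMem_inversions hβ').mpr (geometricRep_mem_positiveRoots_of_notMem hw hβ' h) hβ

lemma single_mem_parabolicRoots {J : Finset B} {i : B} (hi : i ∈ J) :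
    (Pi.single i 1 : B → ℝ) ∈ cs.parabolicRoots J := by
  refine mem_parabolicRoots.mpr ⟨cs.single_mem_positiveRoots i, fun k hk => ?_⟩
  have : k ≠ i := by rintro rfl; exact hk hi
  simp [this]

open Classical in
/-- Lengths add up in `d W_J` when `d` is minimal. -/
lemma IsCosetMin.length_mul {J : Finset B} {d u : W} (hd : cs.IsCosetMin J d)
    (hu : u ∈ cs.parabolic J) : cs.length (d * u) = cs.length d + cs.length u := by
  have hdJ : ∀ γ ∈ cs.parabolicRoots J, cs.geometricRep d γ ∈ cs.positiveRoots := fun γ hγ =>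
    ⟨geometricRep_mem_roots _ (mem_parabolicRoots.mp hγ).1.1,
      hd.nonneg (mem_parabolicRoots.mp hγ).1.2 (mem_parabolicRoots.mp hγ).2⟩
  have key : cs.inversions (d * u) =
      (cs.inversions d).image (cs.geometricRep u⁻¹) ∪ cs.inversions u := by
    ext β
    simp only [Finset.mem_union, Finset.mem_image]
    constructor
    · intro h
      have h' := mem_inversions.mp h
      by_cases hβu : β ∈ cs.inversions u
      · exact Or.inr hβu
      · refine Or.inl ⟨cs.geometricRep u β, mem_inversions.mpr
          ⟨(notMem_inversions h'.1).mp hβu, ?_⟩, cs.geometricRep_inv_apply_self _ _⟩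
        rw [← geometricRep_mul_apply]
        exact h'.2
    · rintro (⟨γ, hγ, rfl⟩ | h)
      · have hγ' := mem_inversions.mp hγ
        have hγJ : γ ∉ cs.parabolicRoots J := fun h =>
          (notMem_inversions hγ'.1).mpr (hdJ γ h) hγ
        refine mem_inversions.mpr ⟨geometricRep_mem_positiveRoots_of_notMem (inv_mem hu) hγ'.1 hγJ,
          ?_⟩
        rw [geometricRep_mul_apply, geometricRep_apply_inv_self]
        exact hγ'.2
      · have h' := mem_inversions.mp h
        have hβJ := mem_parabolicRoots.mp (inversions_subset_parabolicRoots hu h)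
        refine mem_inversions.mpr ⟨h'.1, ?_⟩
        have := hd.nonneg (neg_nonneg.mpr h'.2) fun k hk => by
          rw [Pi.neg_apply, geometricRep_apply_of_notMem hu hk, hβJ.2 k hk, neg_zero]
        rw [map_neg] at this
        rw [geometricRep_mul_apply]
        exact neg_nonneg.mp this
  rw [← card_inversions, ← card_inversions, ← card_inversions, key, Finset.card_union_of_disjoint,
    Finset.card_image_of_injective _ (cs.geometricRep u⁻¹).injective]
  rw [Finset.disjoint_left]
  intro β hβ hβu
  obtain ⟨γ, hγ, rfl⟩ := Finset.mem_image.mp hβ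
  have h2 := (mem_inversions.mp hβu).2
  rw [geometricRep_apply_inv_self] at h2
  have hγ' := (mem_inversions.mp hγ).1
  exact ne_zero_of_mem_roots hγ'.1 (le_antisymm h2 hγ'.2)

lemma exists_isCosetMin_mul (J : Finset B) (w : W) :
    ∃ d u, cs.IsCosetMin J d ∧ u ∈ cs.parabolic J ∧ w = d * u := by
  induction hn : cs.length w using Nat.strong_induction_on generalizing w with
  | _ n ih =>
  by_cases h : cs.IsCosetMin J w
  · exact ⟨w, 1, h, one_mem _, (mul_one w).symm⟩
  · simp only [IsCosetMin, not_forall] at h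
    obtain ⟨i, hi, hw⟩ := h
    rw [← length_lt_mul_simple_iff, not_lt] at hw
    have hlt := lt_of_le_of_ne hw (cs.length_mul_simple_ne w i)
    obtain ⟨d, u, hd, hu, e⟩ := ih _ (hn ▸ hlt) (w * cs.simple i) rfl
    refine ⟨d, u * cs.simple i, hd, mul_mem hu (simple_mem_parabolic hi), ?_⟩
    rw [← mul_assoc, ← e, mul_assoc, simple_mul_simple_self, mul_one]

lemma IsCosetMin.eq_of_mul_eq {J : Finset B} {d d' u u' : W} (hd : cs.IsCosetMin J d)
    (hd' : cs.IsCosetMin J d') (hu : u ∈ cs.parabolic J) (hu' : u' ∈ cs.parabolic J)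
    (h : d * u = d' * u') : d = d' ∧ u = u' := by
  have e1 : d = d' * (u' * u⁻¹) := by rw [← mul_assoc, ← h]; simp
  have e2 : d' = d * (u * u'⁻¹) := by rw [← mul_assoc, h]; simp
  have l1 := hd'.length_mul (mul_mem hu' (inv_mem hu))
  have l2 := hd.length_mul (mul_mem hu (inv_mem hu'))
  rw [← e1] at l1
  rw [← e2] at l2
  have : u * u'⁻¹ = 1 := by rw [← cs.length_eq_zero_iff]; omega
  have huu : u = u' := mul_inv_eq_one.mp this
  subst huu
  exact ⟨mul_right_cancel h, rfl⟩

/-- An element of `W_J` all of whose simple roots in `J` become negative. -/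
lemma exists_longest (J : Finset B) :
    ∃ w ∈ cs.parabolic J, ∀ i ∈ J, ¬ 0 ≤ cs.geometricRep w (Pi.single i 1) := by
  obtain ⟨⟨w, hw⟩, hmax⟩ := Finite.exists_max fun w : cs.parabolic J => cs.length w.1
  refine ⟨w, hw, fun i hi h => ?_⟩
  rw [← length_lt_mul_simple_iff] at h
  exact absurd (hmax ⟨w * cs.simple i, mul_mem hw (simple_mem_parabolic hi)⟩) (not_le.mpr h)

lemma inversions_eq_of_longest {J : Finset B} {w : W} (hw : w ∈ cs.parabolic J)
    (h : ∀ i ∈ J, ¬ 0 ≤ cs.geometricRep w (Pi.single i 1)) :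
    cs.inversions w = cs.parabolicRoots J := by
  refine (inversions_subset_parabolicRoots hw).antisymm fun β hβ => ?_
  obtain ⟨hβ, hJ⟩ := mem_parabolicRoots.mp hβ
  refine mem_inversions.mpr ⟨hβ, ?_⟩
  have : β = ∑ i ∈ J, β i • (Pi.single i 1 : B → ℝ) := by
    ext k
    rw [Finset.sum_apply]
    by_cases hk : k ∈ J
    · rw [Finset.sum_eq_single k] <;> simp +contextual [hk, Pi.single_apply, eq_comm]
    · rw [hJ k hk, Finset.sum_eq_zero]
      intro i hi
      have : k ≠ i := by rintro rfl; exact hk hi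
      simp [this]
  rw [this, map_sum]
  refine Finset.sum_nonpos fun i hi => ?_
  rw [map_smul]
  refine smul_nonpos_of_nonneg_of_nonpos (hβ.2 i) ?_
  exact (nonneg_or_nonpos_of_mem_roots
    (geometricRep_mem_roots w (cs.single_mem_roots i))).resolve_left (h i hi)

lemma length_of_longest {J : Finset B} {w : W} (hw : w ∈ cs.parabolic J)
    (h : ∀ i ∈ J, ¬ 0 ≤ cs.geometricRep w (Pi.single i 1)) :
    cs.length w = (cs.parabolicRoots J).card := by
  rw [← card_inversions, inversions_eq_of_longest hw h]

lemma neg_geometricRep_mem_of_longest {J : Finset B} {w : W} (hw : w ∈ cs.parabolic J)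
    (h : ∀ i ∈ J, ¬ 0 ≤ cs.geometricRep w (Pi.single i 1)) {β : B → ℝ}
    (hβ : β ∈ cs.parabolicRoots J) : -cs.geometricRep w β ∈ cs.parabolicRoots J := by
  have h1 := inversions_eq_of_longest hw h ▸ hβ
  rw [mem_inversions] at h1
  rw [mem_parabolicRoots] at hβ ⊢
  refine ⟨⟨neg_mem_roots (geometricRep_mem_roots _ hβ.1.1), neg_nonneg.mpr h1.2⟩, fun k hk => ?_⟩
  rw [Pi.neg_apply, geometricRep_apply_of_notMem hw hk, hβ.2 k hk, neg_zero]

/-- The inverse of a longest element is a longest element. -/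
lemma longest_inv {J : Finset B} {w : W} (hw : w ∈ cs.parabolic J)
    (h : ∀ i ∈ J, ¬ 0 ≤ cs.geometricRep w (Pi.single i 1)) :
    ∀ i ∈ J, ¬ 0 ≤ cs.geometricRep w⁻¹ (Pi.single i 1) := by
  classical
  intro i hi
  -- `β ↦ -w β` is an injection of the finite set of positive roots of `W_J`, hence a bijection
  have hinj : Set.InjOn (fun β => -cs.geometricRep w β) (cs.parabolicRoots J : Set (B → ℝ)) :=
    fun β _ γ _ e => (cs.geometricRep w).injective (neg_injective e)
  have hsurj := Finset.surjOn_of_injOn_of_card_le (fun β => -cs.geometricRep w β)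
    (fun β hβ => neg_geometricRep_mem_of_longest hw h hβ) hinj le_rfl
  obtain ⟨β, hβ, e⟩ := hsurj (single_mem_parabolicRoots hi)
  simp only at e
  rw [← e, map_neg, geometricRep_inv_apply_self, Left.nonneg_neg_iff]
  have hβ' := (mem_parabolicRoots.mp hβ).1
  exact fun h' => ne_zero_of_mem_roots hβ'.1 (le_antisymm h' hβ'.2)

lemma longest_unique {J : Finset B} {w w' : W} (hw : w ∈ cs.parabolic J)
    (h : ∀ i ∈ J, ¬ 0 ≤ cs.geometricRep w (Pi.single i 1)) (hw' : w' ∈ cs.parabolic J)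
    (h' : ∀ i ∈ J, ¬ 0 ≤ cs.geometricRep w' (Pi.single i 1)) : w = w' := by
  rw [← mul_inv_eq_one, ← inv_inj, inv_one, mul_inv_rev, inv_inv]
  have hm := mul_mem hw' (inv_mem hw)
  have hi := longest_inv hw h
  have h1 : cs.inversions (w' * w⁻¹) = ∅ := by
    rw [Finset.eq_empty_iff_forall_notMem]
    intro β hβ
    have hβJ := inversions_subset_parabolicRoots hm hβ
    refine (notMem_inversions (mem_inversions.mp hβ).1).mpr ?_ hβ
    have h2 := neg_geometricRep_mem_of_longest hw' h'
      (neg_geometricRep_mem_of_longest (inv_mem hw) hi hβJ)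
    rw [map_neg, neg_neg, ← geometricRep_mul_apply] at h2
    exact (mem_parabolicRoots.mp h2).1
  rw [← cs.length_eq_zero_iff, ← card_inversions, h1, Finset.card_empty]

/-- A positive root of `W_J` is `W_J`-conjugate to a simple root in `J`. -/
lemma exists_eq_of_mem_parabolicRoots {J : Finset B} {β : B → ℝ} (hβ : β ∈ cs.parabolicRoots J) :
    ∃ u ∈ cs.parabolic J, ∃ j ∈ J, β = cs.geometricRep u (Pi.single j 1) := by
  obtain ⟨w, hw, h⟩ := cs.exists_longest J
  have hinv : cs.geometricRep w β ∉ cs.positiveRoots := by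
    rw [← notMem_inversions (mem_parabolicRoots.mp hβ).1, inversions_eq_of_longest hw h, not_not]
    exact hβ
  have hβ' := (mem_parabolicRoots.mp hβ).1
  clear h hβ
  have hw' : w ∈ Submonoid.closure (cs.simple '' J) := by
    rw [parabolic] at hw
    have : Subgroup.closure (cs.simple '' J) ≤ Subgroup.closure (cs.simple '' J) := le_rfl
    rw [← Subgroup.mem_toSubmonoid, Subgroup.closure_toSubmonoid] at hw
    convert hw using 2
    ext x
    simp only [Set.mem_union, Set.mem_inv]
    constructor
    · exact Or.inl
    · rintro (h | ⟨i, hi, e⟩)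
      · exact h
      · exact ⟨i, hi, by rw [← inv_simple, e, inv_inv]⟩
  clear hw
  induction hw' using Submonoid.closure_induction_left with
  | one => rw [geometricRep_one_apply] at hinv; exact absurd hβ' hinv
  | mul_left s hs w hw ih =>
    obtain ⟨i, hi, rfl⟩ := hs
    by_cases h : cs.geometricRep w β ∈ cs.positiveRoots
    · have hwJ : w ∈ cs.parabolic J := by
        have : Submonoid.closure (cs.simple '' J) ≤ (cs.parabolic J).toSubmonoid :=
          Submonoid.closure_le.mpr Subgroup.subset_closure
        exact this hw
      refine ⟨w⁻¹, inv_mem hwJ, i, hi, ?_⟩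
      have : cs.geometricRep w β = Pi.single i 1 := by
        by_contra hne
        rw [geometricRep_mul_apply] at hinv
        exact hinv (cs.geometricRep_simple_mem_positiveRoots h hne)
      rw [← this, geometricRep_inv_apply_self]
    · exact ih h

/-- If `d` is minimal in `W_I d W_J`, then a simple reflection `s_i`, `i ∈ I`, that shortens an
element of `d W_J` can be moved past `d`. -/
lemma exists_simple_mul_eq {I J : Finset B} {d b : W} (hd : cs.IsCosetMin J d)
    (hd' : cs.IsCosetMin I d⁻¹) (hb : b ∈ cs.parabolic J) {i : B} (hi : i ∈ I)
    (hlt : cs.length (cs.simple i * (d * b)) < cs.length (d * b)) :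
    ∃ j ∈ J, cs.simple i * d = d * cs.simple j := by
  have hneg : ¬ 0 ≤ cs.geometricRep (d * b)⁻¹ (Pi.single i 1) := by
    have h1 : cs.length ((d * b)⁻¹ * cs.simple i) = cs.length (cs.simple i * (d * b)) := by
      rw [← cs.length_inv, mul_inv_rev, inv_simple, inv_inv (d * b)]
    rw [← length_lt_mul_simple_iff, h1, cs.length_inv]
    omega
  set β := cs.geometricRep d⁻¹ (Pi.single i 1) with hβ
  have hβpos : β ∈ cs.positiveRoots :=
    ⟨geometricRep_mem_roots _ (cs.single_mem_roots i), hd' i hi⟩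
  have hbβ : cs.geometricRep b⁻¹ β ∉ cs.positiveRoots := fun h => hneg (by
    rw [mul_inv_rev, geometricRep_mul_apply]; exact h.2)
  have hβJ : β ∈ cs.parabolicRoots J := by
    by_contra h
    exact hbβ (geometricRep_mem_positiveRoots_of_notMem (inv_mem hb) hβpos h)
  have hdβ : cs.geometricRep d β = Pi.single i 1 := cs.geometricRep_apply_inv_self _ _
  have hJ := (mem_parabolicRoots.mp hβJ).2
  obtain ⟨j, hj⟩ : ∃ j, 0 < β j := by
    by_contra! hcon
    exact ne_zero_of_mem_roots hβpos.1 (funext fun k => le_antisymm (hcon k) (hβpos.2 k))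
  have hjJ : j ∈ J := by
    by_contra h
    rw [hJ j h] at hj
    exact lt_irrefl _ hj
  -- `d α_j` is a positive root below a multiple of `α_i`, hence equal to `α_i`
  have hle : β j • cs.geometricRep d (Pi.single j 1) ≤ Pi.single i 1 := by
    have h1 : 0 ≤ cs.geometricRep d (β - β j • Pi.single j 1) := by
      refine hd.nonneg ?_ ?_
      · intro k
        by_cases hk : k = j
        · subst hk; simp
        · simpa [hk] using hβpos.2 k
      · intro k hk
        have : k ≠ j := by rintro rfl; exact hk hjJ
        simp [this, hJ k hk]
    rw [map_sub, map_smul, hdβ] at h1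
    exact sub_nonneg.mp h1
  have hdj : cs.geometricRep d (Pi.single j 1) ∈ cs.positiveRoots :=
    ⟨geometricRep_mem_roots _ (cs.single_mem_roots j), hd j hjJ⟩
  have heq : cs.geometricRep d (Pi.single j 1) = Pi.single i 1 := by
    by_contra hne
    obtain ⟨k, hk, hpos⟩ := exists_ne_coord_pos hdj hne
    have := hle k
    simp only [Pi.smul_apply, smul_eq_mul, Pi.single_eq_of_ne hk] at this
    nlinarith
  refine ⟨j, hjJ, ?_⟩
  apply cs.geometricRep_injective
  ext1 v
  rw [geometricRep_mul_apply, geometricRep_mul_apply, geometricRep_simple_apply,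
    geometricRep_simple_apply, map_sub, map_smul, heq, ← CoxeterMatrix.cosForm_single,
    ← CoxeterMatrix.cosForm_single, ← cs.cosForm_geometricRep d (Pi.single j 1), heq]

/-- A double coset `W_I d W_J` contains only one minimal element. -/
lemma eq_of_mul_mul_eq {I J : Finset B} {d d' a b : W} (hd : cs.IsCosetMin J d)
    (hdI : cs.IsCosetMin I d⁻¹) (hd' : cs.IsCosetMin J d') (hd'I : cs.IsCosetMin I d'⁻¹)
    (ha : a ∈ cs.parabolic I) (hb : b ∈ cs.parabolic J) (h : a * d' = d * b) : d = d' := by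
  induction hn : cs.length a generalizing a b with
  | zero =>
    rw [cs.length_eq_zero_iff] at hn
    subst hn
    exact (hd.eq_of_mul_eq hd' hb (one_mem _) (by rw [mul_one, ← h, one_mul])).1
  | succ n ih =>
    have ha1 : a ≠ 1 := by rintro rfl; simp at hn
    -- `a⁻¹ ≠ 1` makes some simple root in `I` negative
    have hex : ∃ i ∈ I, ¬ 0 ≤ cs.geometricRep a⁻¹ (Pi.single i 1) := by
      by_contra! hcon
      have h1 : cs.IsCosetMin I a⁻¹ := hcon
      have := h1.eq_of_mul_eq (d' := 1) (u := 1) (u' := a⁻¹) (fun i _ => by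
        rw [geometricRep_one_apply]; exact Pi.single_nonneg.mpr zero_le_one) (one_mem _)
        (inv_mem ha) (by simp)
      exact ha1 (inv_eq_one.mp this.1)
    obtain ⟨i, hi, hneg⟩ := hex
    have hsa : cs.length (cs.simple i * a) < cs.length a := by
      rw [← length_lt_mul_simple_iff, ← cs.length_inv (a⁻¹ * _), mul_inv_rev, inv_inv,
        inv_simple, cs.length_inv] at hneg
      exact lt_of_le_of_ne (not_lt.mp hneg) (cs.length_simple_mul_ne a i)
    have hlen : ∀ x ∈ cs.parabolic I, cs.length (x * d') = cs.length x + cs.length d' := by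
      intro x hx
      have := hd'I.length_mul (inv_mem hx)
      rw [← mul_inv_rev, cs.length_inv, cs.length_inv, cs.length_inv] at this
      omega
    have hlt : cs.length (cs.simple i * (d * b)) < cs.length (d * b) := by
      rw [← h, ← mul_assoc, hlen _ (mul_mem (simple_mem_parabolic hi) ha), hlen _ ha]
      omega
    obtain ⟨j, hj, e⟩ := exists_simple_mul_eq hd hdI hb hi hlt
    refine ih (a := cs.simple i * a) (b := cs.simple j * b)
      (mul_mem (simple_mem_parabolic hi) ha) (mul_mem (simple_mem_parabolic hj) hb) ?_ ?_
    · rw [mul_assoc, h, ← mul_assoc, e, mul_assoc]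
    · have := (cs.length_simple_mul a i)
      omega

lemma exists_mul_mul_eq (I J : Finset B) (w : W) :
    ∃ a d b, a ∈ cs.parabolic I ∧ b ∈ cs.parabolic J ∧ cs.IsCosetMin J d ∧
      cs.IsCosetMin I d⁻¹ ∧ a * d * b = w := by
  induction hn : cs.length w using Nat.strong_induction_on generalizing w with
  | _ n ih =>
  by_cases hJ : cs.IsCosetMin J w
  · by_cases hI : cs.IsCosetMin I w⁻¹
    · exact ⟨1, w, 1, one_mem _, one_mem _, hJ, hI, by simp⟩
    · simp only [IsCosetMin, not_forall] at hI
      obtain ⟨i, hi, hw⟩ := hI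
      rw [← length_lt_mul_simple_iff, not_lt] at hw
      have hlt := lt_of_le_of_ne hw (cs.length_mul_simple_ne w⁻¹ i)
      rw [← cs.length_inv (w⁻¹ * _), mul_inv_rev, inv_inv, inv_simple, cs.length_inv] at hlt
      obtain ⟨a, d, b, ha, hb, hd, hd', e⟩ := ih _ (hn ▸ hlt) _ rfl
      refine ⟨cs.simple i * a, d, b, mul_mem (simple_mem_parabolic hi) ha, hb, hd, hd', ?_⟩
      rw [mul_assoc, mul_assoc, ← mul_assoc a, e, simple_mul_simple_cancel_left]
  · simp only [IsCosetMin, not_forall] at hJ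
    obtain ⟨i, hi, hw⟩ := hJ
    rw [← length_lt_mul_simple_iff, not_lt] at hw
    have hlt := lt_of_le_of_ne hw (cs.length_mul_simple_ne w i)
    obtain ⟨a, d, b, ha, hb, hd, hd', e⟩ := ih _ (hn ▸ hlt) _ rfl
    refine ⟨a, d, b * cs.simple i, ha, mul_mem hb (simple_mem_parabolic hi), hd, hd', ?_⟩
    rw [← mul_assoc, e, mul_assoc, simple_mul_simple_self, mul_one]

end CoxeterSystem

/-! ### Poincaré series of parabolic subgroups and an alternating sum of permutation characters -/

namespace CoxeterSystem

variable {B W : Type*} [Fintype B] [DecidableEq B] [Group W] [Finite W] {M : CoxeterMatrix B}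
  (cs : CoxeterSystem M W)

open scoped Classical in
/-- The simple reflections in `K` that lengthen `d`. -/
def ascents (K : Finset B) (d : W) : Finset B :=
  K.filter fun i => 0 ≤ cs.geometricRep d (Pi.single i 1)

variable {cs}

lemma IsCosetMin_iff_subset_ascents {I K : Finset B} (hIK : I ⊆ K) {d : W} :
    cs.IsCosetMin I d ↔ I ⊆ cs.ascents K d := by
  constructor
  · intro h i hi
    simp [ascents, hIK hi, h i hi]
  · intro h i hi
    have := h hi
    simp only [ascents, Finset.mem_filter] at this
    exact this.2

open scoped Classical in
/-- The alternating sum over the `I ⊆ K` in whose cosets `d` is minimal detects the elements of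
`W_K` that have no ascent, i.e. the longest element. -/
lemma sum_isCosetMin (K : Finset B) (d : W) {R : Type*}
    [Ring R] :
    ∑ I ∈ K.powerset, (if cs.IsCosetMin I d then (-1 : R) ^ I.card else 0) =
      if cs.ascents K d = ∅ then 1 else 0 := by
  rw [← Finset.sum_filter]
  have : K.powerset.filter (fun I => cs.IsCosetMin I d) = (cs.ascents K d).powerset := by
    ext I
    simp only [Finset.mem_filter, Finset.mem_powerset]
    constructor
    · rintro ⟨h, h'⟩
      exact (IsCosetMin_iff_subset_ascents h).mp h'
    · intro h
      have hK : I ⊆ K := h.trans (Finset.filter_subset _ _)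
      exact ⟨hK, (IsCosetMin_iff_subset_ascents hK).mpr h⟩
  rw [this]
  have := Finset.sum_powerset_neg_one_pow_card (x := cs.ascents K d)
  have h2 := congrArg (Int.cast : ℤ → R) this
  push_cast at h2
  rw [h2]

lemma ascents_eq_empty_iff {K : Finset B} {d : W} :
    cs.ascents K d = ∅ ↔ ∀ i ∈ K, ¬ 0 ≤ cs.geometricRep d (Pi.single i 1) := by
  simp [ascents, Finset.filter_eq_empty_iff]

variable (cs) in
open scoped Classical in
/-- The elements of `W_J`, as a finite set. -/
def parabolicFinset [Fintype W] (J : Finset B) : Finset W :=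
  Finset.univ.filter (· ∈ cs.parabolic J)

variable [Fintype W]

@[simp] lemma mem_parabolicFinset {J : Finset B} {w : W} :
    w ∈ cs.parabolicFinset J ↔ w ∈ cs.parabolic J := by simp [parabolicFinset]

lemma parabolicFinset_univ : cs.parabolicFinset Finset.univ = Finset.univ := by
  ext w; simp [parabolic_univ]

lemma parabolicFinset_empty : cs.parabolicFinset ∅ = {1} := by
  ext w; simp [parabolic_empty, Subgroup.mem_bot]

lemma card_parabolicFinset_pos (J : Finset B) : 0 < (cs.parabolicFinset J).card :=
  Finset.card_pos.mpr ⟨1, by simp [one_mem]⟩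

/-- Exactly one element of `W_K` has no ascent in `K`, and its length is the number of positive
roots of `W_K`. -/
lemma sum_ascents_eq_empty (K : Finset B) {R : Type*} [AddCommMonoid R] (f : W → R) :
    ∃ w ∈ cs.parabolicFinset K, cs.ascents K w = ∅ ∧ cs.ascents K w⁻¹ = ∅ ∧
      cs.length w = (cs.parabolicRoots K).card ∧
      ∑ d ∈ cs.parabolicFinset K, (if cs.ascents K d = ∅ then f d else 0) = f w := by
  obtain ⟨w, hw, h⟩ := cs.exists_longest K
  refine ⟨w, by simpa using hw, ascents_eq_empty_iff.mpr h,
    ascents_eq_empty_iff.mpr (longest_inv hw h), length_of_longest hw h, ?_⟩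
  rw [Finset.sum_eq_single w, if_pos (ascents_eq_empty_iff.mpr h)]
  · intro d hd hne
    rw [if_neg]
    intro hd'
    exact hne (longest_unique (by simpa using hd) (ascents_eq_empty_iff.mp hd') hw h)
  · intro hw'
    exact absurd (mem_parabolicFinset.mpr hw) hw'

section poincare

open PowerSeries

variable (cs) in
/-- The Poincaré series `∑_{w ∈ W_J} t ^ ℓ(w)`. -/
def poincare (J : Finset B) : PowerSeries ℝ := ∑ w ∈ cs.parabolicFinset J, X ^ cs.length w

variable (cs) in
open scoped Classical in
/-- The length series of the minimal representatives of the cosets `d W_I` in `W_K`. -/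
def cosetPoincare (K I : Finset B) : PowerSeries ℝ :=
  ∑ d ∈ (cs.parabolicFinset K).filter (cs.IsCosetMin I), X ^ cs.length d

lemma poincare_empty : cs.poincare ∅ = 1 := by
  simp [poincare, parabolicFinset_empty]

lemma cosetPoincare_mul {I K : Finset B} (h : I ⊆ K) :
    cs.cosetPoincare K I * cs.poincare I = cs.poincare K := by
  classical
  rw [poincare, poincare, cosetPoincare, Finset.sum_mul_sum, ← Finset.sum_product']
  refine Finset.sum_bij (fun p _ => p.1 * p.2) ?_ ?_ ?_ ?_
  · rintro ⟨d, u⟩ hp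
    simp only [Finset.mem_product, Finset.mem_filter, mem_parabolicFinset] at hp ⊢
    exact mul_mem hp.1.1 (parabolic_mono h hp.2)
  · rintro ⟨d, u⟩ hp ⟨d', u'⟩ hp' heq
    simp only [Finset.mem_product, Finset.mem_filter, mem_parabolicFinset] at hp hp'
    obtain ⟨rfl, rfl⟩ := hp.1.2.eq_of_mul_eq hp'.1.2 hp.2 hp'.2 heq
    rfl
  · intro w hw
    obtain ⟨d, u, hd, hu, rfl⟩ := exists_isCosetMin_mul (cs := cs) I w
    refine ⟨(d, u), ?_, rfl⟩
    simp only [Finset.mem_product, Finset.mem_filter, mem_parabolicFinset] at hw ⊢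
    refine ⟨⟨?_, hd⟩, hu⟩
    have := mul_mem hw (inv_mem (parabolic_mono h hu))
    simpa using this
  · rintro ⟨d, u⟩ hp
    simp only [Finset.mem_product, Finset.mem_filter, mem_parabolicFinset] at hp
    rw [hp.1.2.length_mul hp.2, pow_add]

lemma sum_cosetPoincare (K : Finset B) :
    ∑ I ∈ K.powerset, (-1 : PowerSeries ℝ) ^ I.card * cs.cosetPoincare K I =
      X ^ (cs.parabolicRoots K).card := by
  classical
  obtain ⟨w, hw, -, -, hl, h⟩ := sum_ascents_eq_empty (cs := cs) K
    (fun d => (X : PowerSeries ℝ) ^ cs.length d)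
  rw [← hl, ← h]
  calc _ = ∑ I ∈ K.powerset, ∑ d ∈ cs.parabolicFinset K,
        (if cs.IsCosetMin I d then (-1 : PowerSeries ℝ) ^ I.card else 0) * X ^ cs.length d := by
        refine Finset.sum_congr rfl fun I _ => ?_
        rw [cosetPoincare, Finset.mul_sum, Finset.sum_filter]
        refine Finset.sum_congr rfl fun d _ => ?_
        split_ifs <;> simp
    _ = _ := by
        rw [Finset.sum_comm]
        refine Finset.sum_congr rfl fun d _ => ?_
        rw [← Finset.sum_mul, sum_isCosetMin]
        split_ifs <;> simp

end poincare

/-! ### The sign character as an alternating sum of permutation characters -/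

open scoped Classical in
/-- Counting the double cosets `W_J \ W_K / W_I` by their minimal representatives. -/
lemma card_conj_mem {I J K : Finset B} (hI : I ⊆ K) (hJ : J ⊆ K) :
    ((cs.parabolicFinset I ×ˢ cs.parabolicFinset K).filter
      fun p => p.2 * p.1 * p.2⁻¹ ∈ cs.parabolic J).card =
    (cs.parabolicFinset I).card * (cs.parabolicFinset J).card *
      ((cs.parabolicFinset K).filter fun d => cs.IsCosetMin I d ∧ cs.IsCosetMin J d⁻¹).card := by
  choose a d b ha hb hd hd' hx using exists_mul_mul_eq (cs := cs) J I
  have key : ∀ {x u e v a b : W}, x = u * e * v → a * e * b = x →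
      x * (v⁻¹ * b) * x⁻¹ = u * a⁻¹ := by
    intro x u e v a b h1 h2
    rw [mul_inv_eq_iff_eq_mul]
    conv_rhs => rw [← h2]
    rw [h1]
    group
  rw [← Finset.card_product, ← Finset.card_product]
  symm
  -- for each `x` fix `x = a d b`; another such decomposition corresponds to `u = b₁⁻¹ b`
  refine Finset.card_bij'
    (fun p _ => (p.1.1⁻¹ * b (p.1.2 * p.2 * p.1.1), p.1.2 * p.2 * p.1.1))
    (fun p _ => ((b p.2 * p.1⁻¹, p.2 * p.1 * p.2⁻¹ * a p.2), d p.2)) ?_ ?_ ?_ ?_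
  · rintro ⟨⟨v, u⟩, e⟩ hp
    simp only [Finset.mem_product, Finset.mem_filter, mem_parabolicFinset] at hp ⊢
    obtain ⟨⟨hv, hu⟩, he, heI, heJ⟩ := hp
    set x := u * e * v with hxdef
    have hde : d x = e := by
      refine eq_of_mul_mul_eq (a := (a x)⁻¹ * u) (b := b x * v⁻¹) (hd x) (hd' x) heI heJ
        (mul_mem (inv_mem (ha x)) hu) (mul_mem (hb x) (inv_mem hv)) ?_
      rw [mul_assoc, inv_mul_eq_iff_eq_mul, ← mul_assoc, ← mul_assoc, eq_mul_inv_iff_mul_eq,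
        ← hxdef, hx]
    refine ⟨⟨mul_mem (inv_mem hv) (hb x),
      mul_mem (mul_mem (parabolic_mono hJ hu) he) (parabolic_mono hI hv)⟩, ?_⟩
    have : x * (v⁻¹ * b x) * x⁻¹ = u * (a x)⁻¹ :=
      key hxdef (hde ▸ hx x)
    rw [this]
    exact mul_mem hu (inv_mem (ha x))
  · rintro ⟨u, x⟩ hp
    simp only [Finset.mem_product, Finset.mem_filter, mem_parabolicFinset] at hp ⊢
    obtain ⟨⟨hu, hxK⟩, hux⟩ := hp
    refine ⟨⟨mul_mem (hb x) (inv_mem hu), mul_mem hux (ha x)⟩, ?_, hd x, hd' x⟩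
    have : d x = (a x)⁻¹ * x * (b x)⁻¹ := by
      rw [eq_mul_inv_iff_mul_eq, eq_inv_mul_iff_mul_eq, ← mul_assoc, hx]
    rw [this]
    exact mul_mem (mul_mem (inv_mem (parabolic_mono hJ (ha x))) hxK)
      (inv_mem (parabolic_mono hI (hb x)))
  · rintro ⟨⟨v, u⟩, e⟩ hp
    simp only [Finset.mem_product, Finset.mem_filter, mem_parabolicFinset] at hp ⊢
    obtain ⟨⟨hv, hu⟩, he, heI, heJ⟩ := hp
    set x := u * e * v with hxdef
    have hde : d x = e := by
      refine eq_of_mul_mul_eq (a := (a x)⁻¹ * u) (b := b x * v⁻¹) (hd x) (hd' x) heI heJ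
        (mul_mem (inv_mem (ha x)) hu) (mul_mem (hb x) (inv_mem hv)) ?_
      rw [mul_assoc, inv_mul_eq_iff_eq_mul, ← mul_assoc, ← mul_assoc, eq_mul_inv_iff_mul_eq,
        ← hxdef, hx]
    refine Prod.ext (Prod.ext ?_ ?_) hde
    · simp
    · show x * (v⁻¹ * b x) * x⁻¹ * a x = u
      have : x * (v⁻¹ * b x) * x⁻¹ = u * (a x)⁻¹ := key hxdef (hde ▸ hx x)
      rw [this]; simp
  · rintro ⟨u, x⟩ hp
    have : x * u * x⁻¹ * a x * d x * (b x * u⁻¹) = x := by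
      calc _ = x * u * x⁻¹ * (a x * d x * b x) * u⁻¹ := by group
        _ = x := by rw [hx]; group
    simp only [this]
    refine Prod.ext ?_ rfl
    simp

variable (cs) in
open scoped Classical in
/-- The permutation character of `W_K` on the cosets of `W_I`. -/
def permChar (K I : Finset B) (w : W) : ℝ :=
  ((cs.parabolicFinset K).filter fun x => x * w * x⁻¹ ∈ cs.parabolic I).card /
    (cs.parabolicFinset I).card

lemma permChar_conj {K I : Finset B} {x : W} (hx : x ∈ cs.parabolic K) (w : W) :
    cs.permChar K I (x * w * x⁻¹) = cs.permChar K I w := by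
  classical
  rw [permChar, permChar]
  congr 2
  refine Finset.card_bij' (fun y _ => y * x) (fun y _ => y * x⁻¹) ?_ ?_ ?_ ?_
  · intro y hy
    simp only [Finset.mem_filter, mem_parabolicFinset] at hy ⊢
    refine ⟨mul_mem hy.1 hx, ?_⟩
    convert hy.2 using 1; group
  · intro y hy
    simp only [Finset.mem_filter, mem_parabolicFinset] at hy ⊢
    refine ⟨mul_mem hy.1 (inv_mem hx), ?_⟩
    convert hy.2 using 1; group
  · intro y _; simp
  · intro y _; simp

/-- Frobenius reciprocity for `permChar`. -/
lemma sum_permChar_mul {K I : Finset B} (h : I ⊆ K) (χ : W → ℝ)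
    (hχ : ∀ x ∈ cs.parabolic K, ∀ w, χ (x * w * x⁻¹) = χ w) :
    (∑ w ∈ cs.parabolicFinset K, cs.permChar K I w * χ w) / (cs.parabolicFinset K).card =
      (∑ u ∈ cs.parabolicFinset I, χ u) / (cs.parabolicFinset I).card := by
  classical
  have hK : ((cs.parabolicFinset K).card : ℝ) ≠ 0 := by
    exact_mod_cast (card_parabolicFinset_pos K).ne'
  have hI : ((cs.parabolicFinset I).card : ℝ) ≠ 0 := by
    exact_mod_cast (card_parabolicFinset_pos I).ne'
  rw [div_eq_div_iff hK hI, Finset.sum_mul]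
  calc _ = ∑ w ∈ cs.parabolicFinset K, ∑ x ∈ cs.parabolicFinset K,
        if x * w * x⁻¹ ∈ cs.parabolic I then χ (x * w * x⁻¹) else 0 := by
        refine Finset.sum_congr rfl fun w _ => ?_
        rw [permChar, ← Finset.sum_filter]
        rw [div_mul_eq_mul_div, div_mul_cancel₀ _ hI, ← nsmul_eq_mul, ← Finset.sum_const]
        refine Finset.sum_congr rfl fun x hx => ?_
        simp only [Finset.mem_filter, mem_parabolicFinset] at hx
        rw [hχ x hx.1]
    _ = ∑ x ∈ cs.parabolicFinset K, ∑ u ∈ cs.parabolicFinset I, χ u := by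
        rw [Finset.sum_comm]
        refine Finset.sum_congr rfl fun x hx => ?_
        rw [mem_parabolicFinset] at hx
        rw [← Finset.sum_filter]
        refine Finset.sum_bij' (fun w _ => x * w * x⁻¹) (fun u _ => x⁻¹ * u * x) ?_ ?_ ?_ ?_ ?_
        · intro w hw
          simp only [Finset.mem_filter, mem_parabolicFinset] at hw ⊢
          exact hw.2
        · intro u hu
          simp only [Finset.mem_filter, mem_parabolicFinset] at hu ⊢
          refine ⟨mul_mem (mul_mem (inv_mem hx) (parabolic_mono h hu)) hx, ?_⟩
          convert hu using 1; group
        · intro w _; group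
        · intro w _; group
        · intro w _; rfl
    _ = _ := by rw [Finset.sum_const, nsmul_eq_mul, mul_comm]

variable (cs) in
/-- The sign character, with real values. -/
def sgn (w : W) : ℝ := (-1) ^ cs.length w

lemma sgn_mul (w w' : W) : cs.sgn (w * w') = cs.sgn w * cs.sgn w' := by
  have := cs.length_mul_mod_two w w'
  rw [sgn, sgn, sgn, ← pow_add, neg_one_pow_eq_pow_mod_two, this, ← neg_one_pow_eq_pow_mod_two]

lemma sgn_one : cs.sgn 1 = 1 := by simp [sgn]

lemma sgn_simple (i : B) : cs.sgn (cs.simple i) = -1 := by simp [sgn]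

lemma sgn_mul_self (w : W) : cs.sgn w * cs.sgn w = 1 := by
  rw [sgn, ← pow_add, ← two_mul, pow_mul]; simp

lemma sgn_inv (w : W) : cs.sgn w⁻¹ = cs.sgn w := by simp [sgn]

lemma sgn_conj (x w : W) : cs.sgn (x * w * x⁻¹) = cs.sgn w := by
  rw [sgn_mul, sgn_mul, sgn_inv, mul_right_comm, sgn_mul_self, one_mul]

lemma sum_sgn {I : Finset B} :
    (∑ u ∈ cs.parabolicFinset I, cs.sgn u) / (cs.parabolicFinset I).card =
      if I = ∅ then 1 else 0 := by
  split_ifs with h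
  · subst h; simp [parabolicFinset_empty, sgn_one]
  · obtain ⟨i, hi⟩ := Finset.nonempty_iff_ne_empty.mpr h
    have : ∑ u ∈ cs.parabolicFinset I, cs.sgn u = -∑ u ∈ cs.parabolicFinset I, cs.sgn u := by
      rw [← Finset.sum_neg_distrib]
      refine Finset.sum_bij' (fun u _ => cs.simple i * u) (fun u _ => cs.simple i * u) ?_ ?_ ?_ ?_ ?_
      · intro u hu
        simp only [mem_parabolicFinset] at hu ⊢
        exact mul_mem (simple_mem_parabolic hi) hu
      · intro u hu
        simp only [mem_parabolicFinset] at hu ⊢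
        exact mul_mem (simple_mem_parabolic hi) hu
      · intro u _; simp
      · intro u _; simp
      · intro u _; rw [sgn_mul, sgn_simple]; ring
    rw [show ∑ u ∈ cs.parabolicFinset I, cs.sgn u = 0 by linarith, zero_div]

lemma _root_.sum_sum_mul_sum {ι κ R : Type*} [CommRing R] (s : Finset ι) (t : Finset κ)
    (F G : κ → ι → R) :
    ∑ w ∈ s, (∑ I ∈ t, F I w) * (∑ J ∈ t, G J w) = ∑ I ∈ t, ∑ J ∈ t, ∑ w ∈ s, F I w * G J w := by
  simp_rw [Finset.sum_mul_sum]
  rw [Finset.sum_comm]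
  refine Finset.sum_congr rfl fun I _ => ?_
  rw [Finset.sum_comm]

lemma sum_permChar_mul_permChar {I J K : Finset B} (hI : I ⊆ K) (hJ : J ⊆ K)
    [DecidablePred fun d => cs.IsCosetMin I d ∧ cs.IsCosetMin J d⁻¹] :
    (∑ w ∈ cs.parabolicFinset K, cs.permChar K I w * cs.permChar K J w) /
        (cs.parabolicFinset K).card =
      ((cs.parabolicFinset K).filter fun d => cs.IsCosetMin I d ∧ cs.IsCosetMin J d⁻¹).card := by
  classical
  have h1 : ((cs.parabolicFinset I).card : ℝ) ≠ 0 := by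
    exact_mod_cast (card_parabolicFinset_pos I).ne'
  have h2 : ((cs.parabolicFinset J).card : ℝ) ≠ 0 := by
    exact_mod_cast (card_parabolicFinset_pos J).ne'
  rw [sum_permChar_mul hI _ (fun x hx w => permChar_conj hx w)]
  simp only [permChar]
  rw [← Finset.sum_div, div_div, div_eq_iff (mul_ne_zero h2 h1)]
  have := card_conj_mem (cs := cs) hI hJ
  rw [Finset.card_filter, Finset.sum_product] at this
  simp only [Finset.card_filter]
  simp only [Finset.card_filter] at this
  have h3 := congrArg (Nat.cast : ℕ → ℝ) this
  push_cast at h3 ⊢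
  rw [h3]
  ring

/-- **Solomon's identity**: on `W_K`, the alternating sum of the permutation characters on the
cosets of the `W_I`, `I ⊆ K`, is the sign character. Both class functions have norm one (for the
alternating sum, by counting double cosets), and their inner product is one. -/
theorem sum_permChar_eq_sgn (K : Finset B) {w : W} (hw : w ∈ cs.parabolic K) :
    ∑ I ∈ K.powerset, (-1 : ℝ) ^ I.card * cs.permChar K I w = cs.sgn w := by
  classical
  set φ : W → ℝ := fun w => ∑ I ∈ K.powerset, (-1 : ℝ) ^ I.card * cs.permChar K I w with hφ
  have hK : ((cs.parabolicFinset K).card : ℝ) ≠ 0 := by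
    exact_mod_cast (card_parabolicFinset_pos K).ne'
  have hφφ : ∑ w ∈ cs.parabolicFinset K, φ w * φ w = (cs.parabolicFinset K).card := by
    rw [← div_eq_one_iff_eq hK]
    calc _ = ∑ I ∈ K.powerset, ∑ J ∈ K.powerset, (-1 : ℝ) ^ I.card * (-1) ^ J.card *
          ((∑ w ∈ cs.parabolicFinset K, cs.permChar K I w * cs.permChar K J w) /
            (cs.parabolicFinset K).card) := by
          simp only [hφ, sum_sum_mul_sum, Finset.sum_div]
          refine Finset.sum_congr rfl fun I _ => Finset.sum_congr rfl fun J _ => ?_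
          rw [Finset.mul_sum]
          refine Finset.sum_congr rfl fun w _ => ?_
          ring
      _ = ∑ I ∈ K.powerset, ∑ J ∈ K.powerset, ∑ d ∈ cs.parabolicFinset K,
          (if cs.IsCosetMin I d then (-1 : ℝ) ^ I.card else 0) *
            (if cs.IsCosetMin J d⁻¹ then (-1 : ℝ) ^ J.card else 0) := by
          refine Finset.sum_congr rfl fun I hI => Finset.sum_congr rfl fun J hJ => ?_
          rw [sum_permChar_mul_permChar (Finset.mem_powerset.mp hI) (Finset.mem_powerset.mp hJ),
            Finset.card_filter, Nat.cast_sum, Finset.mul_sum]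
          refine Finset.sum_congr rfl fun d _ => ?_
          by_cases h1 : cs.IsCosetMin I d <;> by_cases h2 : cs.IsCosetMin J d⁻¹ <;> simp [h1, h2]
      _ = ∑ d ∈ cs.parabolicFinset K, (if cs.ascents K d = ∅ then (1 : ℝ) else 0) *
            (if cs.ascents K d⁻¹ = ∅ then 1 else 0) := by
          simp_rw [← sum_isCosetMin K]
          rw [sum_sum_mul_sum]
      _ = 1 := by
          obtain ⟨w, -, -, h1, -, h2⟩ := sum_ascents_eq_empty (cs := cs) K
            (fun d => if cs.ascents K d⁻¹ = ∅ then (1 : ℝ) else 0)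
          rw [if_pos h1] at h2
          refine Eq.trans ?_ h2
          simp only [ite_mul, one_mul, zero_mul]
  have hφs : ∑ w ∈ cs.parabolicFinset K, φ w * cs.sgn w = (cs.parabolicFinset K).card := by
    rw [← div_eq_one_iff_eq hK]
    calc _ = ∑ I ∈ K.powerset, (-1 : ℝ) ^ I.card *
          ((∑ w ∈ cs.parabolicFinset K, cs.permChar K I w * cs.sgn w) /
            (cs.parabolicFinset K).card) := by
          simp only [hφ, Finset.sum_mul, Finset.sum_div, Finset.mul_sum]
          rw [Finset.sum_comm]
          refine Finset.sum_congr rfl fun I _ => Finset.sum_congr rfl fun w _ => ?_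
          ring
      _ = ∑ I ∈ K.powerset, (-1 : ℝ) ^ I.card * (if I = ∅ then 1 else 0) := by
          refine Finset.sum_congr rfl fun I hI => ?_
          rw [sum_permChar_mul (Finset.mem_powerset.mp hI) _ (fun x _ w => sgn_conj x w), sum_sgn]
      _ = 1 := by simp
  have hsum : ∑ w ∈ cs.parabolicFinset K, (φ w - cs.sgn w) ^ 2 = 0 := by
    have : ∀ w, (φ w - cs.sgn w) ^ 2 = φ w * φ w - 2 * (φ w * cs.sgn w) + 1 := fun w => by
      rw [← sgn_mul_self (cs := cs) w]; ring
    simp_rw [this]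
    rw [Finset.sum_add_distrib, Finset.sum_sub_distrib, ← Finset.mul_sum, hφφ, hφs]
    simp
    ring
  have := (Finset.sum_eq_zero_iff_of_nonneg fun _ _ => sq_nonneg _).mp hsum w (by simpa using hw)
  exact sub_eq_zero.mp (pow_eq_zero_iff two_ne_zero |>.mp this)

/-- Solomon's identity, paired with a class function. -/
theorem sum_average_eq (K : Finset B) (χ : W → ℝ) (hχ : ∀ x w, χ (x * w * x⁻¹) = χ w) :
    ∑ I ∈ K.powerset, (-1 : ℝ) ^ I.card *
        ((∑ u ∈ cs.parabolicFinset I, χ u) / (cs.parabolicFinset I).card) =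
      (∑ w ∈ cs.parabolicFinset K, cs.sgn w * χ w) / (cs.parabolicFinset K).card := by
  calc _ = ∑ I ∈ K.powerset, (-1 : ℝ) ^ I.card *
        ((∑ w ∈ cs.parabolicFinset K, cs.permChar K I w * χ w) / (cs.parabolicFinset K).card) := by
        refine Finset.sum_congr rfl fun I hI => ?_
        rw [sum_permChar_mul (Finset.mem_powerset.mp hI) _ (fun x _ w => hχ x w)]
    _ = _ := by
        simp only [Finset.sum_div, Finset.mul_sum]
        rw [Finset.sum_comm]
        refine Finset.sum_congr rfl fun w hw => ?_
        rw [← sum_permChar_eq_sgn K (mem_parabolicFinset.mp hw), Finset.sum_mul, Finset.sum_div]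
        refine Finset.sum_congr rfl fun I _ => ?_
        ring

end CoxeterSystem

/-! ### Anti-invariant polynomials and the Hilbert series of the invariants -/

namespace CoxeterMatrix

open MvPolynomial

variable {B : Type*} [Fintype B] [DecidableEq B] (M : CoxeterMatrix B)

/-- A linear form on `ℝ^B`, as a polynomial. -/
def _root_.MvPolynomial.ofDual {B : Type*} [Fintype B] [DecidableEq B]
    (f : Module.Dual ℝ (B → ℝ)) : MvPolynomial B ℝ :=
  ∑ j, C (f (Pi.single j 1)) * X j

lemma _root_.MvPolynomial.eval_ofDual {B : Type*} [Fintype B] [DecidableEq B]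
    (f : Module.Dual ℝ (B → ℝ)) (v : B → ℝ) : eval v (ofDual f) = f v := by
  simp only [ofDual, map_sum, map_mul, eval_C, eval_X]
  rw [LinearMap.pi_apply_eq_sum_univ f v]
  refine Finset.sum_congr rfl fun j _ => ?_
  rw [smul_eq_mul, mul_comm]
  congr 2
  ext i
  simp [Pi.single_apply, eq_comm]

lemma _root_.MvPolynomial.isHomogeneous_ofDual {B : Type*} [Fintype B] [DecidableEq B]
    (f : Module.Dual ℝ (B → ℝ)) : (ofDual f).IsHomogeneous 1 :=
  IsHomogeneous.sum _ _ _ fun _ _ => isHomogeneous_C_mul_X _ _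

lemma _root_.MvPolynomial.irreducible_ofDual {B : Type*} [Fintype B] [DecidableEq B]
    {f : Module.Dual ℝ (B → ℝ)} (hf : f ≠ 0) : Irreducible (ofDual f) := by
  obtain ⟨i, hi⟩ : ∃ i, f (Pi.single i 1) ≠ 0 := by
    by_contra! h
    refine hf (LinearMap.pi_ext' fun i => LinearMap.ext_ring ?_)
    simpa using h i
  set c : B →₀ ℝ := Finsupp.equivFunOnFinite.symm fun j => f (Pi.single j 1) with hc
  have h := irreducible_sumSMulX c ⟨i, by simpa [hc] using hi⟩ (fun r hr => by
    rw [isUnit_iff_ne_zero]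
    rintro rfl
    have := hr i
    rw [zero_dvd_iff] at this
    exact hi (by simpa [hc] using this))
  convert h using 1
  rw [sumSMulX, Finsupp.linearCombination_apply, Finsupp.sum_fintype _ _ (by simp), ofDual]
  simp [hc, smul_eq_C_mul]

/-- `p` and its image under the shear `v ↦ v - f v • b` differ by a multiple of `f`. -/
lemma _root_.MvPolynomial.ofDual_dvd_sub {B : Type*} [Fintype B] [DecidableEq B]
    (f : Module.Dual ℝ (B → ℝ)) (b : B → ℝ) (p : MvPolynomial B ℝ) :
    ofDual f ∣ p - aeval (fun i => X i - C (b i) * ofDual f) p := by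
  rw [← Ideal.mem_span_singleton, ← Ideal.Quotient.eq, ← Ideal.Quotient.mkₐ_eq_mk ℝ,
    ← AlgHom.comp_apply]
  conv_lhs => rw [← AlgHom.id_apply (R := ℝ) p, ← AlgHom.comp_apply]
  congr 1
  refine MvPolynomial.algHom_ext fun i => ?_
  simp only [AlgHom.comp_apply, AlgHom.id_apply, aeval_X, Ideal.Quotient.mkₐ_eq_mk]
  rw [Ideal.Quotient.eq, Ideal.mem_span_singleton]
  exact ⟨C (b i), by ring⟩

end CoxeterMatrix

namespace CoxeterSystem

open MvPolynomial

variable {B W : Type*} [Fintype B] [DecidableEq B] [Group W] {M : CoxeterMatrix B}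
  (cs : CoxeterSystem M W)

/-- The action of `W` on polynomial functions, `(w p)(v) = p (w⁻¹ v)`. -/
def polyAct (w : W) : MvPolynomial B ℝ →ₐ[ℝ] MvPolynomial B ℝ :=
  aeval fun i => ofDual (LinearMap.proj i ∘ₗ (cs.geometricRep w⁻¹).toLinearMap)

variable {cs}

lemma eval_polyAct (w : W) (p : MvPolynomial B ℝ) (v : B → ℝ) :
    eval v (cs.polyAct w p) = eval (cs.geometricRep w⁻¹ v) p := by
  induction p using MvPolynomial.induction_on with
  | C a => simp [polyAct]
  | add p q hp hq => simp [hp, hq]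
  | mul_X p i hp => rw [map_mul, map_mul, hp, map_mul]; simp [polyAct, eval_ofDual]

lemma polyAct_one (p : MvPolynomial B ℝ) : cs.polyAct 1 p = p :=
  MvPolynomial.funext fun v => by rw [eval_polyAct, inv_one, geometricRep_one_apply]

lemma polyAct_mul (w w' : W) (p : MvPolynomial B ℝ) :
    cs.polyAct (w * w') p = cs.polyAct w (cs.polyAct w' p) :=
  MvPolynomial.funext fun v => by
    rw [eval_polyAct, eval_polyAct, eval_polyAct, mul_inv_rev, geometricRep_mul_apply]

lemma _root_.MvPolynomial.isHomogeneous_aeval_linear {σ τ : Type*} {p : MvPolynomial σ ℝ} {k : ℕ}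
    (h : p.IsHomogeneous k) {g : σ → MvPolynomial τ ℝ} (hg : ∀ i, (g i).IsHomogeneous 1) :
    (aeval g p).IsHomogeneous k := by
  have := h.aeval g hg
  rwa [one_mul] at this

lemma isHomogeneous_polyAct {w : W} {p : MvPolynomial B ℝ} {k : ℕ} (h : p.IsHomogeneous k) :
    (cs.polyAct w p).IsHomogeneous k := by
  unfold polyAct
  exact isHomogeneous_aeval_linear h fun i => isHomogeneous_ofDual _

lemma polyAct_ofDual_cosForm (w : W) (β : B → ℝ) :
    cs.polyAct w (ofDual (M.cosForm β)) = ofDual (M.cosForm (cs.geometricRep w β)) :=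
  MvPolynomial.funext fun v => by
    rw [eval_polyAct, eval_ofDual, eval_ofDual, ← cs.cosForm_geometricRep w,
      geometricRep_apply_inv_self]

variable (cs) in
/-- The polynomials of degree `k` on which `W_J` acts through `ε`. -/
def semiInvariants (ε : W → ℝ) (J : Finset B) (k : ℕ) : Submodule ℝ (MvPolynomial B ℝ) where
  carrier := {p | p.IsHomogeneous k ∧ ∀ w ∈ cs.parabolic J, cs.polyAct w p = ε w • p}
  zero_mem' := ⟨isHomogeneous_zero _ _ _, fun w _ => by simp⟩
  add_mem' := fun hp hq => ⟨hp.1.add hq.1, fun w hw => by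
    rw [map_add, hp.2 w hw, hq.2 w hw, smul_add]⟩
  smul_mem' := fun c p hp => ⟨by rw [smul_eq_C_mul]; exact hp.1.C_mul c, fun w hw => by
    rw [map_smul, hp.2 w hw, smul_comm]⟩

lemma mem_semiInvariants {ε : W → ℝ} {J : Finset B} {k : ℕ} {p : MvPolynomial B ℝ} :
    p ∈ cs.semiInvariants ε J k ↔
      p.IsHomogeneous k ∧ ∀ w ∈ cs.parabolic J, cs.polyAct w p = ε w • p := Iff.rfl

instance (k : ℕ) : Module.Finite ℝ (homogeneousSubmodule B ℝ k) :=
  Module.Finite.iff_fg.mpr (homogeneousSubmodule_fg B ℝ k)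

variable (cs) in
/-- The action of `W` on the polynomials of degree `k`. -/
def polyRep (k : ℕ) (w : W) :
    homogeneousSubmodule B ℝ k →ₗ[ℝ] homogeneousSubmodule B ℝ k :=
  (cs.polyAct w).toLinearMap.restrict fun _ hp => isHomogeneous_polyAct hp

lemma coe_polyRep (k : ℕ) (w : W) (p : homogeneousSubmodule B ℝ k) :
    (cs.polyRep k w p : MvPolynomial B ℝ) = cs.polyAct w p := rfl

lemma polyRep_mul (k : ℕ) (w w' : W) : cs.polyRep k (w * w') = cs.polyRep k w ∘ₗ cs.polyRep k w' := by
  refine LinearMap.ext fun p => Subtype.ext ?_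
  rw [coe_polyRep, LinearMap.comp_apply, coe_polyRep, coe_polyRep, polyAct_mul]

lemma trace_polyRep_conj (k : ℕ) (x w : W) :
    LinearMap.trace ℝ _ (cs.polyRep k (x * w * x⁻¹)) = LinearMap.trace ℝ _ (cs.polyRep k w) := by
  rw [polyRep_mul, LinearMap.trace_comp_comm', ← polyRep_mul, ← mul_assoc, inv_mul_cancel,
    one_mul]

variable [Finite W] [Fintype W]

lemma _root_.trace_eq_finrank_of_isProj {V : Type*} [AddCommGroup V] [Module ℝ V]
    [Module.Finite ℝ V] {p : Submodule ℝ V} {f : V →ₗ[ℝ] V} (h : LinearMap.IsProj p f) :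
    LinearMap.trace ℝ V f = Module.finrank ℝ p := h.trace

/-- The dimension of the semi-invariants is the trace of the averaging projection. -/
lemma finrank_semiInvariants {ε : W → ℝ} (hmul : ∀ u w, ε (u * w) = ε u * ε w)
    (hsq : ∀ w, ε w * ε w = 1) (J : Finset B) (k : ℕ) :
    (Module.finrank ℝ (cs.semiInvariants ε J k) : ℝ) =
      (∑ u ∈ cs.parabolicFinset J, ε u * LinearMap.trace ℝ _ (cs.polyRep k u)) /
        (cs.parabolicFinset J).card := by
  have hcard : ((cs.parabolicFinset J).card : ℝ) ≠ 0 := by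
    exact_mod_cast (card_parabolicFinset_pos J).ne'
  set e : homogeneousSubmodule B ℝ k →ₗ[ℝ] homogeneousSubmodule B ℝ k :=
    ((cs.parabolicFinset J).card : ℝ)⁻¹ • ∑ u ∈ cs.parabolicFinset J, ε u • cs.polyRep k u with he
  have hle : cs.semiInvariants ε J k ≤ homogeneousSubmodule B ℝ k := fun p hp => hp.1
  set S := (cs.semiInvariants ε J k).comap (homogeneousSubmodule B ℝ k).subtype with hS
  have hmem : ∀ p : homogeneousSubmodule B ℝ k,
      p ∈ S ↔ ∀ w ∈ cs.parabolic J, cs.polyRep k w p = ε w • p := by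
    intro p
    rw [hS, Submodule.mem_comap, mem_semiInvariants]
    simp only [Submodule.subtype_apply, Subtype.ext_iff, coe_polyRep, Submodule.coe_smul]
    exact ⟨fun h => h.2, fun h => ⟨p.2, h⟩⟩
  have hproj : LinearMap.IsProj S e := by
    constructor
    · intro p
      rw [hmem]
      intro w hw
      simp only [he, LinearMap.smul_apply, LinearMap.sum_apply, map_smul, map_sum]
      rw [smul_comm (ε w)]
      congr 1
      rw [Finset.smul_sum]
      refine Finset.sum_bij' (fun u _ => w * u) (fun u _ => w⁻¹ * u) ?_ ?_ ?_ ?_ ?_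
      · intro u hu
        rw [mem_parabolicFinset] at hu ⊢
        exact mul_mem hw hu
      · intro u hu
        rw [mem_parabolicFinset] at hu ⊢
        exact mul_mem (inv_mem hw) hu
      · intro u _; simp
      · intro u _; simp
      · intro u _
        rw [polyRep_mul, LinearMap.comp_apply, smul_smul, hmul, ← mul_assoc, hsq, one_mul]
    · intro p hp
      rw [hmem] at hp
      simp only [he, LinearMap.smul_apply, LinearMap.sum_apply]
      rw [Finset.sum_congr rfl fun u hu => by
        rw [hp u (mem_parabolicFinset.mp hu), smul_smul, hsq, one_smul], Finset.sum_const,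
        ← Nat.cast_smul_eq_nsmul ℝ, smul_smul, inv_mul_cancel₀ hcard, one_smul]
  have hfin : Module.finrank ℝ (cs.semiInvariants ε J k) = Module.finrank ℝ S :=
    (Submodule.comapSubtypeEquivOfLe hle).finrank_eq.symm
  have htr := trace_eq_finrank_of_isProj hproj
  rw [hfin, ← htr, he]
  simp only [map_smul, map_sum, smul_eq_mul]
  rw [inv_mul_eq_div]

/-- Solomon's identity for the polynomials of degree `k`. -/
lemma sum_finrank_invariants (K : Finset B) (k : ℕ) :
    ∑ I ∈ K.powerset, (-1 : ℝ) ^ I.card * Module.finrank ℝ (cs.semiInvariants (fun _ => 1) I k) =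
      Module.finrank ℝ (cs.semiInvariants cs.sgn K k) := by
  rw [finrank_semiInvariants sgn_mul sgn_mul_self, ← sum_average_eq K _ (trace_polyRep_conj k)]
  refine Finset.sum_congr rfl fun I _ => ?_
  rw [finrank_semiInvariants (by simp) (by simp)]
  simp

/-! ### The product of the positive roots -/

variable (cs) in
/-- The product of the linear forms of the positive roots of `W_K`. -/
def rootProd (K : Finset B) : MvPolynomial B ℝ :=
  ∏ β ∈ cs.parabolicRoots K, ofDual (M.cosForm β)

lemma isHomogeneous_rootProd (K : Finset B) :
    (cs.rootProd K).IsHomogeneous (cs.parabolicRoots K).card := by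
  have := IsHomogeneous.prod (cs.parabolicRoots K) _ (fun _ => 1)
    fun β _ => isHomogeneous_ofDual (M.cosForm β)
  rwa [Finset.sum_const, smul_eq_mul, mul_one] at this

lemma ofDual_cosForm_ne_zero {β : B → ℝ} (hβ : β ∈ cs.roots) : ofDual (M.cosForm β) ≠ 0 := by
  intro h
  have := congrArg (eval β) h
  rw [eval_ofDual, cosForm_self_of_mem_roots hβ] at this
  simp at this

lemma rootProd_ne_zero (K : Finset B) : cs.rootProd K ≠ 0 :=
  Finset.prod_ne_zero_iff.mpr fun _ hβ => ofDual_cosForm_ne_zero (mem_parabolicRoots.mp hβ).1.1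

lemma polyAct_simple_rootProd {K : Finset B} {i : B} (hi : i ∈ K) :
    cs.polyAct (cs.simple i) (cs.rootProd K) = -cs.rootProd K := by
  have hmem := single_mem_parabolicRoots (cs := cs) hi
  rw [rootProd, map_prod, ← Finset.mul_prod_erase _ _ hmem, ← Finset.mul_prod_erase _ _ hmem,
    polyAct_ofDual_cosForm, geometricRep_simple_self, ← neg_mul]
  have hmaps : ∀ β ∈ (cs.parabolicRoots K).erase (Pi.single i 1),
      cs.geometricRep (cs.simple i) β ∈ (cs.parabolicRoots K).erase (Pi.single i 1) := by
    intro β hβ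
    rw [Finset.mem_erase, mem_parabolicRoots] at hβ ⊢
    obtain ⟨hne, hβ, hK⟩ := hβ
    refine ⟨fun h => ?_, cs.geometricRep_simple_mem_positiveRoots hβ hne, fun k hk => ?_⟩
    · have := congrArg (cs.geometricRep (cs.simple i)) h
      rw [← geometricRep_mul_apply, simple_mul_simple_self, geometricRep_one_apply,
        geometricRep_simple_self] at this
      exact neg_notMem_positiveRoots (cs.single_mem_positiveRoots i) (this ▸ hβ)
    · rw [geometricRep_apply_of_notMem (simple_mem_parabolic hi) hk, hK k hk]
  congr 1
  · refine MvPolynomial.funext fun v => ?_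
    simp [eval_ofDual]
  · refine Finset.prod_bij' (fun β _ => cs.geometricRep (cs.simple i) β)
      (fun β _ => cs.geometricRep (cs.simple i) β) hmaps hmaps ?_ ?_ ?_
    · intro β _
      rw [← geometricRep_mul_apply, simple_mul_simple_self, geometricRep_one_apply]
    · intro β _
      rw [← geometricRep_mul_apply, simple_mul_simple_self, geometricRep_one_apply]
    · intro β _
      rw [polyAct_ofDual_cosForm]

lemma polyAct_rootProd {K : Finset B} {w : W} (hw : w ∈ cs.parabolic K) :
    cs.polyAct w (cs.rootProd K) = cs.sgn w • cs.rootProd K := by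
  induction hw using Subgroup.closure_induction with
  | mem w hw =>
    obtain ⟨i, hi, rfl⟩ := hw
    rw [polyAct_simple_rootProd hi, sgn_simple, neg_one_smul]
  | one => rw [polyAct_one, sgn_one, one_smul]
  | mul w w' _ _ h h' => rw [polyAct_mul, h', map_smul, h, smul_smul, sgn_mul, mul_comm]
  | inv w _ h =>
    have := congrArg (cs.polyAct w⁻¹) h
    rw [← polyAct_mul, inv_mul_cancel, polyAct_one, map_smul] at this
    conv_rhs => rw [this]
    rw [smul_smul, sgn_inv, sgn_mul_self, one_smul]

/-- A polynomial that `W_K` multiplies by signs is divisible by every root of `W_K`. -/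
lemma ofDual_cosForm_dvd {K : Finset B} {p : MvPolynomial B ℝ}
    (hp : ∀ w ∈ cs.parabolic K, cs.polyAct w p = cs.sgn w • p) {β : B → ℝ}
    (hβ : β ∈ cs.parabolicRoots K) : ofDual (M.cosForm β) ∣ p := by
  obtain ⟨u, hu, j, hj, rfl⟩ := exists_eq_of_mem_parabolicRoots hβ
  set β := cs.geometricRep u (Pi.single j 1)
  set t := u * cs.simple j * u⁻¹ with ht
  have htK : t ∈ cs.parabolic K := mul_mem (mul_mem hu (simple_mem_parabolic hj)) (inv_mem hu)
  have htv : ∀ v, cs.geometricRep t⁻¹ v = v - M.cosForm β v • β := by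
    intro v
    have : t⁻¹ = t := by rw [ht]; simp [mul_assoc]
    rw [this, ht, geometricRep_mul_apply, geometricRep_mul_apply, geometricRep_simple_apply,
      map_sub, map_smul, geometricRep_apply_inv_self, ← CoxeterMatrix.cosForm_single,
      ← cs.cosForm_geometricRep u, geometricRep_apply_inv_self]
  have h1 : cs.polyAct t p = aeval (fun i => X i - C (β i) * ofDual (M.cosForm β)) p := by
    rw [polyAct]
    congr 2
    funext i
    refine MvPolynomial.funext fun v => ?_
    rw [eval_ofDual, LinearMap.comp_apply, LinearEquiv.coe_coe, htv]
    simp [eval_ofDual, mul_comm]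
  have h2 : cs.sgn t = -1 := by rw [ht, sgn_conj, sgn_simple]
  have h3 := ofDual_dvd_sub (M.cosForm β) β p
  rw [← h1, hp t htK, h2, neg_one_smul, sub_neg_eq_add, ← two_mul] at h3
  have h4 := h3.mul_left (C (1 / 2))
  have h5 : (C (1 / 2) : MvPolynomial B ℝ) * (2 * p) = p := by
    rw [← mul_assoc, show (2 : MvPolynomial B ℝ) = C 2 from rfl, ← C_mul]; norm_num
  rwa [h5] at h4

lemma rootProd_dvd (hirr : M.IsIrreducible) {K : Finset B} {p : MvPolynomial B ℝ}
    (hp : ∀ w ∈ cs.parabolic K, cs.polyAct w p = cs.sgn w • p) : cs.rootProd K ∣ p := by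
  refine Finset.prod_dvd_of_isRelPrime ?_ fun β hβ => ofDual_cosForm_dvd hp hβ
  intro β hβ γ hγ hne
  have hβ' := (mem_parabolicRoots.mp hβ).1
  have hγ' := (mem_parabolicRoots.mp hγ).1
  have h0 : M.cosForm β ≠ 0 := fun h => by
    have := cosForm_self_of_mem_roots hβ'.1
    simp [h] at this
  refine (irreducible_ofDual h0).isRelPrime_iff_not_dvd.mpr ?_
  rintro ⟨q, hq⟩
  -- evaluate at the projection of `γ` to the hyperplane orthogonal to `β`
  have := congrArg (eval (γ - (M.cosForm β γ / 2) • β)) hq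
  rw [map_mul, eval_ofDual, eval_ofDual] at this
  simp only [map_sub, map_smul, smul_eq_mul, cosForm_self_of_mem_roots hβ'.1,
    cosForm_self_of_mem_roots hγ'.1, M.cosForm_comm γ β] at this
  have h4 : (M.cosForm β γ - 2) * (M.cosForm β γ + 2) = 0 := by
    have h5 : M.cosForm β γ - M.cosForm β γ / 2 * 2 = 0 := by ring
    rw [h5, zero_mul] at this
    linarith
  rcases mul_eq_zero.mp h4 with h | h
  · exact hne (eq_of_cosForm_eq_two hirr hγ'.1 hβ'.1 (by rw [M.cosForm_comm]; linarith))
  · have := eq_neg_of_cosForm_eq_neg_two hirr hγ'.1 hβ'.1 (by rw [M.cosForm_comm]; linarith)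
    rw [this] at hβ'
    exact neg_notMem_positiveRoots hγ' hβ'

lemma _root_.MvPolynomial.IsHomogeneous.exists_of_mul {σ : Type*} {D q : MvPolynomial σ ℝ} {N k : ℕ}
    (hD : D.IsHomogeneous N) (hD0 : D ≠ 0) (h : (D * q).IsHomogeneous (N + k)) :
    q.IsHomogeneous k := by
  have h1 : D * q = D * homogeneousComponent k q := by
    have h2 : homogeneousComponent (N + k) (D * q) = D * q := homogeneousComponent_eq_self h
    rw [← h2]
    conv_lhs => rw [← sum_homogeneousComponent q, Finset.mul_sum, map_sum]
    have h3 : ∀ j, homogeneousComponent (N + k) (D * homogeneousComponent j q) =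
        if j = k then D * homogeneousComponent k q else 0 := by
      intro j
      rw [homogeneousComponent_of_mem (hD.mul (homogeneousComponent_isHomogeneous j q))]
      by_cases hj : j = k
      · subst hj; simp
      · rw [if_neg (by omega), if_neg hj]
    rw [Finset.sum_congr rfl fun j _ => h3 j, Finset.sum_ite_eq']
    split_ifs with hk
    · rfl
    · rw [homogeneousComponent_eq_zero, mul_zero]
      simpa using hk
  rw [mul_left_cancel₀ hD0 h1]
  exact homogeneousComponent_isHomogeneous k q

lemma finrank_antiInvariants (hirr : M.IsIrreducible) (K : Finset B) (k : ℕ) :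
    Module.finrank ℝ (cs.semiInvariants cs.sgn K ((cs.parabolicRoots K).card + k)) =
      Module.finrank ℝ (cs.semiInvariants (fun _ => 1) K k) := by
  have hinj : Function.Injective (LinearMap.mulLeft ℝ (cs.rootProd K)) := fun p q h =>
    mul_left_cancel₀ (rootProd_ne_zero K) h
  suffices hmap : cs.semiInvariants cs.sgn K ((cs.parabolicRoots K).card + k) =
      (cs.semiInvariants (fun _ => 1) K k).map (LinearMap.mulLeft ℝ (cs.rootProd K)) by
    rw [(Submodule.equivMapOfInjective _ hinj (cs.semiInvariants (fun _ => 1) K k)).finrank_eq,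
      hmap]
  ext p
  rw [Submodule.mem_map]
  constructor
  · rintro ⟨hp, hw⟩
    obtain ⟨q, rfl⟩ := rootProd_dvd hirr hw
    refine ⟨q, ⟨(isHomogeneous_rootProd K).exists_of_mul (rootProd_ne_zero K) hp, fun w hwK => ?_⟩,
      rfl⟩
    have := hw w hwK
    rw [map_mul, polyAct_rootProd hwK, smul_mul_assoc] at this
    have h2 := congrArg (cs.sgn w • ·) this
    simp only [smul_smul, sgn_mul_self, one_smul] at h2
    rw [one_smul]
    exact mul_left_cancel₀ (rootProd_ne_zero K) h2
  · rintro ⟨q, ⟨hq, hw⟩, rfl⟩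
    refine ⟨(isHomogeneous_rootProd K).mul hq, fun w hwK => ?_⟩
    rw [LinearMap.mulLeft_apply, map_mul, hw w hwK, polyAct_rootProd hwK, one_smul, smul_mul_assoc]

lemma finrank_antiInvariants_of_lt (hirr : M.IsIrreducible) {K : Finset B} {k : ℕ}
    (h : k < (cs.parabolicRoots K).card) :
    Module.finrank ℝ (cs.semiInvariants cs.sgn K k) = 0 := by
  have : cs.semiInvariants cs.sgn K k = ⊥ := by
    rw [eq_bot_iff]
    rintro p ⟨hp, hw⟩
    rw [Submodule.mem_bot]
    by_contra hp0
    obtain ⟨q, rfl⟩ := rootProd_dvd hirr hw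
    have hq : q ≠ 0 := right_ne_zero_of_mul hp0
    have h1 := totalDegree_mul_of_isDomain (rootProd_ne_zero (cs := cs) K) hq
    rw [hp.totalDegree hp0, (isHomogeneous_rootProd K).totalDegree (rootProd_ne_zero K)] at h1
    omega
  rw [this, finrank_bot]

/-! ### The Hilbert series -/

variable (cs) in
/-- The Hilbert series of the algebra of `W_J`-invariant polynomials. -/
def hilbert (J : Finset B) : PowerSeries ℝ :=
  PowerSeries.mk fun k => (Module.finrank ℝ (cs.semiInvariants (fun _ => 1) J k) : ℝ)

lemma sum_hilbert (hirr : M.IsIrreducible) (K : Finset B) :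
    ∑ I ∈ K.powerset, (-1 : PowerSeries ℝ) ^ I.card * cs.hilbert I =
      PowerSeries.X ^ (cs.parabolicRoots K).card * cs.hilbert K := by
  ext k
  rw [map_sum, PowerSeries.coeff_X_pow_mul']
  have : ∀ I : Finset B, PowerSeries.coeff k ((-1 : PowerSeries ℝ) ^ I.card * cs.hilbert I) =
      (-1 : ℝ) ^ I.card * Module.finrank ℝ (cs.semiInvariants (fun _ => 1) I k) := by
    intro I
    rw [show (-1 : PowerSeries ℝ) ^ I.card = PowerSeries.C ((-1 : ℝ) ^ I.card) by simp,
      PowerSeries.coeff_C_mul, hilbert, PowerSeries.coeff_mk]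
  rw [Finset.sum_congr rfl fun I _ => this I, sum_finrank_invariants]
  split_ifs with h
  · obtain ⟨m, rfl⟩ := Nat.exists_eq_add_of_le h
    rw [finrank_antiInvariants hirr, Nat.add_sub_cancel_left, hilbert, PowerSeries.coeff_mk]
  · rw [finrank_antiInvariants_of_lt hirr (not_le.mp h), Nat.cast_zero]

/-- The Poincaré series of `W_K` times the Hilbert series of its invariants is the Hilbert series
of the polynomial ring: both alternating sums have the same shape, so the parabolic subgroups can
be treated by induction. -/
theorem poincare_mul_hilbert (hirr : M.IsIrreducible) (K : Finset B) :
    cs.poincare K * cs.hilbert K = cs.hilbert ∅ := by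
  induction hn : K.card using Nat.strong_induction_on generalizing K with
  | _ n ih =>
  subst hn
  rcases K.eq_empty_or_nonempty with rfl | hK
  · rw [poincare_empty, one_mul]
  set N := (cs.parabolicRoots K).card with hN
  have hNpos : N ≠ 0 := by
    obtain ⟨i, hi⟩ := hK
    exact (Finset.card_pos.mpr ⟨_, single_mem_parabolicRoots (cs := cs) hi⟩).ne'
  have h1 := sum_hilbert (cs := cs) hirr K
  have h2 := sum_cosetPoincare (cs := cs) K
  have hKmem : K ∈ K.powerset := Finset.mem_powerset_self K
  have hQ : cs.cosetPoincare K K = 1 := by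
    have h := cosetPoincare_mul (cs := cs) (Finset.Subset.refl K)
    have hP : cs.poincare K ≠ 0 := by
      intro h0
      have := congrArg (PowerSeries.coeff 0) h0
      rw [poincare, map_sum] at this
      have h3 := (Finset.sum_eq_zero_iff_of_nonneg (fun w _ => by
        rw [PowerSeries.coeff_X_pow]; split_ifs <;> norm_num)).mp this 1 (by simp [one_mem])
      simp at h3
    exact mul_right_cancel₀ hP (h.trans (one_mul _).symm)
  rw [← Finset.add_sum_erase _ _ hKmem] at h1 h2
  rw [hQ, mul_one] at h2
  have h3 : cs.poincare K * ∑ I ∈ K.powerset.erase K, (-1 : PowerSeries ℝ) ^ I.card * cs.hilbert I =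
      (∑ I ∈ K.powerset.erase K, (-1 : PowerSeries ℝ) ^ I.card * cs.cosetPoincare K I) *
        cs.hilbert ∅ := by
    rw [Finset.mul_sum, Finset.sum_mul]
    refine Finset.sum_congr rfl fun I hI => ?_
    rw [Finset.mem_erase, Finset.mem_powerset] at hI
    rw [← ih I.card (Finset.card_lt_card (hI.2.ssubset_of_ne hI.1)) I rfl,
      ← cosetPoincare_mul hI.2]
    ring
  rw [eq_sub_of_add_eq' h1, eq_sub_of_add_eq' h2] at h3
  have h4 : ((PowerSeries.X : PowerSeries ℝ) ^ N - (-1) ^ K.card) ≠ 0 := by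
    intro h
    have := congrArg PowerSeries.constantCoeff h
    simp [hNpos] at this
  refine mul_left_cancel₀ h4 ?_
  linear_combination h3

end CoxeterSystem

/-! ### The degrees and the Poincaré polynomial -/

namespace MvPolynomial

variable {σ ι : Type*} [Fintype ι] [DecidableEq ι]

lemma mk_dvd_mul_one_sub {d : ℕ} (hd : 0 < d) :
    (PowerSeries.mk fun e => if d ∣ e then (1 : ℝ) else 0) * (1 - PowerSeries.X ^ d) = 1 := by
  ext e
  rw [mul_sub, mul_one, map_sub, PowerSeries.coeff_mul_X_pow', PowerSeries.coeff_mk,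
    PowerSeries.coeff_one]
  by_cases he : e = 0
  · subst he; simp [hd.ne']
  rw [if_neg he]
  by_cases hde : d ≤ e
  · rw [if_pos hde, PowerSeries.coeff_mk]
    have : d ∣ e - d ↔ d ∣ e := by rw [Nat.dvd_sub_iff_left hde (dvd_refl d)]
    simp [this]
  · have : ¬ d ∣ e := fun h => hde (Nat.le_of_dvd (Nat.pos_of_ne_zero he) h)
    rw [if_neg hde, if_neg this, sub_zero]

/-- The exponents of the monomials of degree `k`, when the variables have degrees `d`. -/
def weightedExponents (d : ι → ℕ) (k : ℕ) : Finset (ι →₀ ℕ) :=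
  (Finset.finsuppAntidiag Finset.univ k).filter (fun l => ∀ i, d i ∣ l i) |>.image
    fun l => Finsupp.equivFunOnFinite.symm fun i => l i / d i

lemma mem_weightedExponents {d : ι → ℕ} (hd : ∀ i, 0 < d i) {k : ℕ} {a : ι →₀ ℕ} :
    a ∈ weightedExponents d k ↔ ∑ i, d i * a i = k := by
  simp only [weightedExponents, Finset.mem_image, Finset.mem_filter, Finset.mem_finsuppAntidiag]
  constructor
  · rintro ⟨l, ⟨⟨h, -⟩, hdvd⟩, rfl⟩
    rw [← h]
    refine Finset.sum_congr rfl fun i _ => ?_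
    simp [Nat.mul_div_cancel' (hdvd i)]
  · intro h
    refine ⟨Finsupp.equivFunOnFinite.symm fun i => d i * a i, ⟨⟨by simpa using h, by simp⟩, ?_⟩, ?_⟩
    · intro i; simp
    · ext i; simp [hd i]

lemma card_weightedExponents {d : ι → ℕ} (hd : ∀ i, 0 < d i) :
    (PowerSeries.mk fun k => ((weightedExponents d k).card : ℝ)) *
      ∏ i, (1 - PowerSeries.X ^ d i) = 1 := by
  have h : (PowerSeries.mk fun k => ((weightedExponents d k).card : ℝ)) =
      ∏ i, PowerSeries.mk fun e => if d i ∣ e then (1 : ℝ) else 0 := by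
    ext k
    rw [PowerSeries.coeff_mk, PowerSeries.coeff_prod, weightedExponents, Finset.card_image_of_injOn]
    · rw [Finset.card_filter, Nat.cast_sum]
      refine Finset.sum_congr rfl fun l _ => ?_
      simp only [PowerSeries.coeff_mk]
      rw [Finset.prod_ite_zero]
      simp
    · intro l hl l' hl' h
      simp only [Finset.coe_filter, Set.mem_ofPred_eq] at hl hl'
      ext i
      have := DFunLike.congr_fun h i
      simp only [Finsupp.equivFunOnFinite_symm_apply_apply] at this
      rw [← Nat.mul_div_cancel' (hl.2 i), this, Nat.mul_div_cancel' (hl'.2 i)]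
  rw [h, ← Finset.prod_mul_distrib]
  exact Finset.prod_eq_one fun i _ => mk_dvd_mul_one_sub (hd i)

/-- The Hilbert series of an algebra freely generated by homogeneous elements. -/
theorem hilbert_adjoin {f : ι → MvPolynomial σ ℝ} {d : ι → ℕ} (hd : ∀ i, 0 < d i)
    (hf : ∀ i, (f i).IsHomogeneous (d i)) (hind : AlgebraicIndependent ℝ f)
    (S : ℕ → Submodule ℝ (MvPolynomial σ ℝ))
    (hS : ∀ k p, p ∈ S k ↔ p.IsHomogeneous k ∧ p ∈ Algebra.adjoin ℝ (Set.range f)) :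
    (PowerSeries.mk fun k => (Module.finrank ℝ (S k) : ℝ)) * ∏ i, (1 - PowerSeries.X ^ d i) = 1 := by
  refine Eq.trans ?_ (card_weightedExponents hd)
  congr 2
  funext k
  set g : weightedExponents d k → MvPolynomial σ ℝ := fun a => aeval f (monomial a.1 (1 : ℝ)) with hg
  have hhom : ∀ a : ι →₀ ℕ, (aeval f (monomial a (1 : ℝ))).IsHomogeneous (∑ i, d i * a i) := by
    intro a
    rw [aeval_monomial, map_one, one_mul, Finsupp.prod_fintype _ _ (by simp)]
    exact IsHomogeneous.prod _ _ _ fun i _ => (hf i).pow (a i)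
  have hlin : LinearIndependent ℝ g := by
    have h1 := (basisMonomials ι ℝ).linearIndependent.map' (aeval f).toLinearMap
      (LinearMap.ker_eq_bot.mpr hind)
    have h2 := h1.comp (fun a : weightedExponents d k => a.1) Subtype.val_injective
    have h3 : g = ((aeval f).toLinearMap ∘ basisMonomials ι ℝ) ∘
        fun a : weightedExponents d k => a.1 := by
      funext a
      rw [coe_basisMonomials]
      rfl
    rw [h3]
    exact h2
  have hspan : S k = Submodule.span ℝ (Set.range g) := by
    apply le_antisymm
    · intro p hp
      rw [hS] at hp
      obtain ⟨hp, hmem⟩ := hp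
      rw [Algebra.adjoin_range_eq_range_aeval] at hmem
      obtain ⟨q, rfl⟩ := hmem
      have h1 := homogeneousComponent_eq_self hp
      rw [← h1]
      change homogeneousComponent k (aeval f q) ∈ _
      rw [q.as_sum, map_sum, map_sum]
      refine Submodule.sum_mem _ fun a _ => ?_
      have h2 : monomial a (coeff a q) = coeff a q • monomial a (1 : ℝ) := by
        rw [smul_monomial, smul_eq_mul, mul_one]
      rw [h2, map_smul, map_smul, homogeneousComponent_of_mem (hhom a)]
      refine Submodule.smul_mem _ _ ?_
      split_ifs with h
      · exact Submodule.subset_span ⟨⟨a, (mem_weightedExponents hd).mpr h.symm⟩, rfl⟩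
      · exact Submodule.zero_mem _
    · rw [Submodule.span_le]
      rintro _ ⟨a, rfl⟩
      rw [SetLike.mem_coe, hS]
      refine ⟨?_, ?_⟩
      · have := hhom a.1
        rwa [(mem_weightedExponents hd).mp a.2] at this
      · rw [Algebra.adjoin_range_eq_range_aeval]
        exact ⟨_, rfl⟩
  rw [hspan, finrank_span_eq_card hlin]
  simp

end MvPolynomial

namespace CoxeterSystem

open MvPolynomial

variable {B W : Type*} [Fintype B] [DecidableEq B] [Group W] {M : CoxeterMatrix B}
  {cs : CoxeterSystem M W}

lemma mem_invariantPolynomials {p : MvPolynomial B ℝ} :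
    p ∈ cs.invariantPolynomials ↔ ∀ w, cs.polyAct w p = p := by
  constructor
  · intro h w
    refine MvPolynomial.funext fun v => ?_
    rw [eval_polyAct]
    exact h w⁻¹ v
  · intro h w v
    conv_rhs => rw [← h w⁻¹]
    rw [eval_polyAct, inv_inv]

lemma IsDegrees.pos {d : Fin (Fintype.card B) → ℕ} (h : cs.IsDegrees d) (i) : 0 < d i := by
  obtain ⟨f, hf, hind, -⟩ := h
  by_contra h0
  have h1 := hf i
  rw [Nat.eq_zero_of_not_pos h0, ← totalDegree_zero_iff_isHomogeneous,
    totalDegree_eq_zero_iff_eq_C] at h1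
  have := hind.transcendental i
  rw [h1] at this
  exact this (isAlgebraic_algebraMap _)

variable [Finite W] [Fintype W]

lemma hilbert_univ_mul {d : Fin (Fintype.card B) → ℕ} (h : cs.IsDegrees d) :
    cs.hilbert Finset.univ * ∏ i, (1 - PowerSeries.X ^ d i) = 1 := by
  have hd := h.pos
  obtain ⟨f, hf, hind, hadj⟩ := h
  refine hilbert_adjoin hd hf hind (cs.semiInvariants (fun _ => 1) Finset.univ) fun k p => ?_
  rw [hadj, mem_invariantPolynomials, mem_semiInvariants]
  simp [parabolic_univ]

lemma hilbert_empty_mul :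
    cs.hilbert ∅ * (1 - PowerSeries.X) ^ Fintype.card B = 1 := by
  have := hilbert_adjoin (σ := B) (f := X) (d := fun _ => 1) (fun _ => one_pos)
    (fun i => isHomogeneous_X ℝ i) (algebraicIndependent_X B ℝ)
    (cs.semiInvariants (fun _ => 1) ∅) fun k p => by
      rw [mem_semiInvariants, MvPolynomial.adjoin_range_X]
      simp [parabolic_empty, Subgroup.mem_bot, polyAct_one]
  rw [Finset.prod_const, pow_one, Finset.card_univ] at this
  exact this

/-- **Solomon's formula** for the Poincaré polynomial. -/
theorem poincare_mul_pow (hirr : M.IsIrreducible) {d : Fin (Fintype.card B) → ℕ}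
    (h : cs.IsDegrees d) :
    (∑ w : W, (PowerSeries.X : PowerSeries ℝ) ^ cs.length w) *
        (1 - PowerSeries.X) ^ Fintype.card B = ∏ i, (1 - PowerSeries.X ^ d i) := by
  have h1 := poincare_mul_hilbert (cs := cs) hirr Finset.univ
  have h2 := hilbert_univ_mul h
  have h3 := hilbert_empty_mul (cs := cs)
  rw [poincare, parabolicFinset_univ] at h1
  linear_combination (∏ i, (1 - PowerSeries.X ^ d i)) * h3 +
    (1 - PowerSeries.X) ^ Fintype.card B * (∏ i, (1 - PowerSeries.X ^ d i)) * h1 -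
    (1 - PowerSeries.X) ^ Fintype.card B * (∑ w : W, PowerSeries.X ^ cs.length w) * h2

open Polynomial in
theorem poincare_polynomial (hirr : M.IsIrreducible) {d : Fin (Fintype.card B) → ℕ}
    (h : cs.IsDegrees d) :
    (∑ w : W, (Polynomial.X : ℝ[X]) ^ cs.length w) * (1 - Polynomial.X) ^ Fintype.card B =
      ∏ i, (1 - Polynomial.X ^ d i) := by
  apply Polynomial.coe_injective
  have := poincare_mul_pow hirr h
  simp only [← Polynomial.coeToPowerSeries.ringHom_apply, map_mul, map_sum, map_pow, map_sub,
    map_one, map_prod]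
  simpa only [Polynomial.coeToPowerSeries.ringHom_apply, Polynomial.coe_X] using this

end CoxeterSystem

/-! ### Cumulants -/

namespace Real

/-- The entire function `(e ^ t - 1) / t`. -/
def expSlope (t : ℝ) : ℝ := dslope Real.exp 0 t

lemma mul_expSlope (t : ℝ) : t * expSlope t = Real.exp t - 1 := by
  have := sub_smul_dslope Real.exp 0 t
  simpa [expSlope] using this

lemma expSlope_zero : expSlope 0 = 1 := by simp [expSlope]

lemma expSlope_pos (t : ℝ) : 0 < expSlope t := by
  have h := mul_expSlope t
  rcases lt_trichotomy t 0 with ht | rfl | ht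
  · have : Real.exp t < 1 := by
      rw [← Real.exp_zero]; exact Real.exp_lt_exp.mpr ht
    by_contra! hn
    nlinarith
  · rw [expSlope_zero]; exact one_pos
  · have : 1 < Real.exp t := Real.one_lt_exp_iff.mpr ht
    by_contra! hn
    nlinarith

lemma analyticAt_expSlope (t : ℝ) : AnalyticAt ℝ expSlope t := by
  by_cases ht : t = 0
  · subst ht
    obtain ⟨p, hp⟩ := analyticAt_rexp (x := (0 : ℝ))
    exact ⟨_, hp.has_fpower_series_dslope_fslope⟩
  · have h : AnalyticAt ℝ (fun t : ℝ => (Real.exp t - 1) / t) t :=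
      ((analyticAt_rexp).sub analyticAt_const).div analyticAt_id ht
    refine h.congr ?_
    filter_upwards [isOpen_ne.mem_nhds ht] with s hs
    rw [← mul_expSlope, mul_div_cancel_left₀ _ hs]

lemma analyticAt_log_expSlope (t : ℝ) : AnalyticAt ℝ (fun t => Real.log (expSlope t)) t :=
  (analyticAt_log (expSlope_pos t)).comp (analyticAt_expSlope t)

/-- With `L = log ((e ^ t - 1) / t)`, the function `t L' + 1 = t e ^ t / (e ^ t - 1)` is the
generating function of the Bernoulli numbers. -/
lemma iteratedDeriv_mul_deriv_log_expSlope (n : ℕ) :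
    iteratedDeriv n (fun t => t * deriv (fun t => Real.log (expSlope t)) t + 1) 0 =
      bernoulli' n := by
  set G : ℝ → ℝ := fun t => t * deriv (fun t => Real.log (expSlope t)) t + 1 with hG
  have hGa : ∀ t, AnalyticAt ℝ G t := fun t =>
    (analyticAt_id.mul (analyticAt_log_expSlope t).deriv).add analyticAt_const
  have hEd : ∀ t, HasDerivAt expSlope (deriv expSlope t) t := fun t =>
    (analyticAt_expSlope t).differentiableAt.hasDerivAt
  have hGE : ∀ t, G t * expSlope t = Real.exp t := by
    intro t
    have h1 : t * deriv expSlope t + expSlope t = Real.exp t := by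
      have h2 : HasDerivAt (fun t => t * expSlope t) (1 * expSlope t + t * deriv expSlope t) t :=
        (hasDerivAt_id t).mul (hEd t)
      have h3 : HasDerivAt (fun t => t * expSlope t) (Real.exp t) t := by
        rw [funext mul_expSlope]
        exact (Real.hasDerivAt_exp t).sub_const 1
      linarith [h2.unique h3]
    have h4 := ((hEd t).log (expSlope_pos t).ne').deriv
    simp only [hG]
    rw [h4, ← h1]
    field_simp [(expSlope_pos t).ne']
  have hGexp : G * (fun t => Real.exp t - 1) = id * Real.exp := by
    funext t
    simp only [Pi.mul_apply, id]
    rw [← mul_expSlope, ← hGE]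
    ring
  have hexp : ∀ m, iteratedDeriv m (fun t => Real.exp t - 1) 0 = if m = 0 then 0 else 1 := by
    intro m
    rcases m with _ | m
    · simp
    · rw [iteratedDeriv_succ']
      have : deriv (fun t => Real.exp t - 1) = Real.exp := by
        funext t; simp
      rw [this, iteratedDeriv_eq_iterate, Real.iter_deriv_exp]
      simp
  have hrec : ∀ n : ℕ, ∑ i ∈ Finset.range n, (n.choose i : ℝ) * iteratedDeriv i G 0 = n := by
    intro n
    have h : iteratedDeriv n (G * fun t => Real.exp t - 1) 0 = iteratedDeriv n (id * Real.exp) 0 := by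
      rw [hGexp]
    have hea : AnalyticAt ℝ (fun t => Real.exp t - 1) 0 := analyticAt_rexp.sub analyticAt_const
    rw [iteratedDeriv_mul (hGa 0).contDiffAt hea.contDiffAt,
      iteratedDeriv_mul contDiffAt_id (analyticAt_rexp).contDiffAt, Finset.sum_range_succ,
      hexp] at h
    have h1 : ∀ i ∈ Finset.range n, (n.choose i : ℝ) * iteratedDeriv i G 0 *
        iteratedDeriv (n - i) (fun t => Real.exp t - 1) 0 = n.choose i * iteratedDeriv i G 0 := by
      intro i hi
      rw [hexp, if_neg (by have := Finset.mem_range.mp hi; omega), mul_one]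
    rw [Finset.sum_congr rfl h1] at h
    simp only [Nat.sub_self, if_true, mul_zero, add_zero] at h
    rw [h, Finset.sum_eq_single 1]
    · simp [iteratedDeriv_id, iteratedDeriv_eq_iterate (f := Real.exp)]
    · intro i _ hi
      rw [iteratedDeriv_id]
      by_cases h0 : i = 0 <;> simp [h0, hi]
    · intro h1
      have : n = 0 := by simpa using h1
      subst this; simp
  induction n using Nat.strong_induction_on with
  | _ n ih =>
  have h1 := hrec (n + 1)
  have h2 : ∑ k ∈ Finset.range (n + 1), ((n + 1).choose k : ℝ) * (bernoulli' k : ℝ) =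
      ((n + 1 : ℕ) : ℝ) := by exact_mod_cast sum_bernoulli' (n + 1)
  rw [Finset.sum_range_succ] at h1 h2
  rw [Finset.sum_congr rfl fun i hi => by rw [ih i (Finset.mem_range.mp hi)]] at h1
  have h3 : ((n + 1).choose n : ℝ) ≠ 0 := by
    rw [Nat.choose_succ_self_right]; positivity
  refine mul_left_cancel₀ h3 ?_
  linarith

lemma iteratedDeriv_log_expSlope {r : ℕ} (hr : 1 ≤ r) :
    iteratedDeriv r (fun t => Real.log (expSlope t)) 0 = bernoulli' r / r := by
  obtain ⟨n, rfl⟩ := Nat.exists_eq_add_of_le' hr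
  have h := iteratedDeriv_mul_deriv_log_expSlope (n + 1)
  set L' := deriv (fun t => Real.log (expSlope t)) with hL'
  have hL'a : AnalyticAt ℝ L' 0 := (analyticAt_log_expSlope 0).deriv
  have h1 : iteratedDeriv (n + 1) (fun t => t * L' t + 1) 0 = (n + 1) * iteratedDeriv n L' 0 := by
    have h2 : (fun t => t * L' t + 1) = (id * L') + fun _ => 1 := rfl
    rw [h2, iteratedDeriv_add (analyticAt_id.mul hL'a).contDiffAt analyticAt_const.contDiffAt,
      iteratedDeriv_mul contDiffAt_id hL'a.contDiffAt, Finset.sum_eq_single 1]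
    · simp [iteratedDeriv_id, iteratedDeriv_const]
    · intro i _ hi
      rw [iteratedDeriv_id]
      by_cases h0 : i = 0 <;> simp [h0, hi]
    · intro h1
      simp at h1
  rw [iteratedDeriv_succ', ← hL', ← h, h1]
  have : ((n + 1 : ℕ) : ℝ) ≠ 0 := by positivity
  field_simp
  push_cast
  ring

end Real

namespace CoxeterSystem

open MeasureTheory ProbabilityTheory

variable {B W : Type*} [Fintype B] [DecidableEq B] [Group W] [Fintype W] {M : CoxeterMatrix B}
  {cs : CoxeterSystem M W}

/-- A random variable distributed like the length of a uniformly random element. -/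
lemma integral_comp_of_law {Ω : Type*} [MeasurableSpace Ω] {μ : Measure Ω}
    [IsProbabilityMeasure μ] {X : Ω → ℕ} (hX : Measurable X)
    (hlaw : ∀ k : ℕ, μ.real (X ⁻¹' {k}) =
      (Nat.card {w : W // cs.length w = k} : ℝ) / Nat.card W) (f : ℕ → ℝ) :
    ∫ ω, f (X ω) ∂μ = (∑ w : W, f (cs.length w)) / Fintype.card W := by
  classical
  have hmap : μ.map X = ∑ w : W, ENNReal.ofReal (Fintype.card W : ℝ)⁻¹ •
      Measure.dirac (cs.length w) := by
    refine Measure.ext_of_singleton fun k => ?_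
    rw [Measure.map_apply hX (measurableSet_singleton k), Measure.finsetSum_apply,
      ← ofReal_measureReal, hlaw k]
    simp only [Measure.smul_apply, Measure.dirac_apply' _ (measurableSet_singleton k), smul_eq_mul]
    rw [← Finset.mul_sum]
    have : ∑ w : W, ({k} : Set ℕ).indicator (1 : ℕ → ENNReal) (cs.length w) =
        ENNReal.ofReal (Nat.card {w : W // cs.length w = k}) := by
      simp only [Set.indicator_apply, Set.mem_singleton_iff, Pi.one_apply]
      rw [Finset.sum_boole, ENNReal.ofReal_natCast, Nat.card_eq_fintype_card,
        Fintype.card_subtype]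
    rw [this, ← ENNReal.ofReal_mul (by positivity), Nat.card_eq_fintype_card (α := W)]
    congr 1
    ring
  have h1 : ∫ ω, f (X ω) ∂μ = ∫ k, f k ∂(μ.map X) :=
    (integral_map hX.aemeasurable (Measurable.aestronglyMeasurable (by fun_prop))).symm
  rw [h1, hmap, integral_finsetSum_measure]
  · simp only [integral_smul_measure, integral_dirac]
    rw [Finset.sum_div]
    refine Finset.sum_congr rfl fun w _ => ?_
    rw [ENNReal.toReal_ofReal (by positivity), smul_eq_mul]
    ring
  · intro w _
    exact (integrable_dirac (by simp)).smul_measure ENNReal.ofReal_ne_top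

/-- The moment generating function of the length is a quotient of products of `expSlope`s. -/
lemma sum_exp_length (hirr : M.IsIrreducible) {d : Fin (Fintype.card B) → ℕ}
    (h : cs.IsDegrees d) (t : ℝ) :
    (∑ w : W, Real.exp (t * cs.length w)) / Fintype.card W =
      ∏ i, (Real.expSlope (d i * t) / Real.expSlope t) := by
  have hd := h.pos
  have h1 : ∀ t : ℝ, t ≠ 0 → (∑ w : W, Real.exp (t * cs.length w)) =
      (∏ i, (d i : ℝ)) * ∏ i, (Real.expSlope (d i * t) / Real.expSlope t) := by
    intro t ht
    have h2 := congrArg (Polynomial.eval (Real.exp t)) (poincare_polynomial hirr h)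
    simp only [Polynomial.eval_mul, Polynomial.eval_finsetSum, Polynomial.eval_pow,
      Polynomial.eval_X, Polynomial.eval_sub, Polynomial.eval_one, Polynomial.eval_prod,
      ← Real.exp_nat_mul] at h2
    have h3 : ∀ i, (1 - Real.exp ((d i : ℝ) * t)) =
        ((d i : ℝ) * (Real.expSlope (d i * t) / Real.expSlope t)) * (1 - Real.exp t) := by
      intro i
      have e1 := Real.mul_expSlope (d i * t)
      have e2 := Real.mul_expSlope t
      have := (Real.expSlope_pos t).ne'
      rw [show 1 - Real.exp t = -(t * Real.expSlope t) by rw [e2]; ring,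
        show 1 - Real.exp ((d i : ℝ) * t) = -(d i * t * Real.expSlope (d i * t)) by rw [e1]; ring]
      field_simp
    simp_rw [h3] at h2
    rw [Finset.prod_mul_distrib, Finset.prod_const, Finset.card_univ, Fintype.card_fin,
      Finset.prod_mul_distrib] at h2
    have h4 : (1 - Real.exp t) ^ Fintype.card B ≠ 0 := by
      refine pow_ne_zero _ (sub_ne_zero.mpr fun h => ht ?_)
      rw [← Real.exp_zero] at h
      exact (Real.exp_injective h).symm
    rw [← mul_right_cancel₀ h4 h2]
    refine Finset.sum_congr rfl fun w _ => ?_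
    rw [mul_comm]
  -- both sides are continuous, so the identity persists at `t = 0` and evaluates the constant
  have h2 : ∀ t : ℝ, (∑ w : W, Real.exp (t * cs.length w)) =
      (∏ i, (d i : ℝ)) * ∏ i, (Real.expSlope (d i * t) / Real.expSlope t) := by
    have hE : Continuous Real.expSlope :=
      continuous_iff_continuousAt.mpr fun t => (Real.analyticAt_expSlope t).continuousAt
    have hc1 : Continuous fun t : ℝ => (∑ w : W, Real.exp (t * cs.length w)) := by fun_prop
    have hc2 : Continuous fun t : ℝ =>
        (∏ i, (d i : ℝ)) * ∏ i, (Real.expSlope (d i * t) / Real.expSlope t) := by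
      refine continuous_const.mul (continuous_finsetProd _ fun i _ => ?_)
      exact (hE.comp (continuous_const.mul continuous_id)).div hE
        fun t => (Real.expSlope_pos t).ne'
    have := Continuous.ext_on (s := {t : ℝ | t ≠ 0}) (dense_compl_singleton 0) hc1 hc2
      fun t ht => h1 t ht
    exact fun t => congrFun this t
  have h0 := h2 0
  simp only [zero_mul, Real.exp_zero, mul_zero, Real.expSlope_zero, div_one, Finset.prod_const_one,
    mul_one, Finset.sum_const, Finset.card_univ, nsmul_eq_mul] at h0
  rw [h2 t, h0, mul_div_cancel_left₀]
  rw [← h0]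
  exact_mod_cast Fintype.card_ne_zero

theorem cumulant_eq (hirr : M.IsIrreducible) {Ω : Type*} [MeasurableSpace Ω] {μ : Measure Ω}
    [IsProbabilityMeasure μ] {X : Ω → ℕ} (hX : Measurable X)
    (hlaw : ∀ k : ℕ, μ.real (X ⁻¹' {k}) =
      (Nat.card {w : W // cs.length w = k} : ℝ) / Nat.card W)
    {d : Fin (Fintype.card B) → ℕ} (h : cs.IsDegrees d) {r : ℕ} (hr : 1 ≤ r) :
    cumulant (fun ω => (X ω : ℝ)) μ r = (bernoulli' r : ℝ) / r * ∑ i, ((d i : ℝ) ^ r - 1) := by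
  have hcgf : cgf (fun ω => (X ω : ℝ)) μ = fun t =>
      ∑ i, ((fun t => Real.log (Real.expSlope (d i * t))) t -
        (fun t => Real.log (Real.expSlope t)) t) := by
    funext t
    rw [cgf, mgf, integral_comp_of_law (cs := cs) hX hlaw fun k => Real.exp (t * k),
      sum_exp_length hirr h, Real.log_prod fun i _ =>
        (div_pos (Real.expSlope_pos _) (Real.expSlope_pos _)).ne']
    refine Finset.sum_congr rfl fun i _ => ?_
    rw [Real.log_div (Real.expSlope_pos _).ne' (Real.expSlope_pos _).ne']
  have ha : ∀ c t : ℝ, AnalyticAt ℝ (fun t => Real.log (Real.expSlope (c * t))) t := fun c t =>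
    (Real.analyticAt_log_expSlope (c * t)).comp (analyticAt_const.mul analyticAt_id)
  have hL : ContDiff ℝ r fun t => Real.log (Real.expSlope t) :=
    contDiff_iff_contDiffAt.mpr fun t => (Real.analyticAt_log_expSlope t).contDiffAt
  rw [cumulant, hcgf, iteratedDeriv_fun_sum (f := fun i t =>
    (fun t => Real.log (Real.expSlope (d i * t))) t - (fun t => Real.log (Real.expSlope t)) t)
    fun i _ => ((ha (d i) 0).contDiffAt).sub (Real.analyticAt_log_expSlope 0).contDiffAt,
    Finset.mul_sum]
  refine Finset.sum_congr rfl fun i _ => ?_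
  rw [iteratedDeriv_fun_sub (ha (d i) 0).contDiffAt (Real.analyticAt_log_expSlope 0).contDiffAt,
    iteratedDeriv_comp_const_mul (f := fun t => Real.log (Real.expSlope t)) hL]
  simp only [mul_zero]
  rw [Real.iteratedDeriv_log_expSlope hr]
  ring

/-- The expectation: half the number of positive roots. -/
theorem integral_eq {Ω : Type*} [MeasurableSpace Ω] {μ : Measure Ω}
    [IsProbabilityMeasure μ] {X : Ω → ℕ} (hX : Measurable X)
    (hlaw : ∀ k : ℕ, μ.real (X ⁻¹' {k}) =
      (Nat.card {w : W // cs.length w = k} : ℝ) / Nat.card W) :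
    ∫ ω, (X ω : ℝ) ∂μ = (cs.posRoots.card : ℝ) / 2 := by
  rw [integral_comp_of_law (cs := cs) hX hlaw fun k => (k : ℝ), sum_length, mul_div_cancel_left₀]
  exact_mod_cast Fintype.card_ne_zero

theorem variance_eq {Ω : Type*} [MeasurableSpace Ω] {μ : Measure Ω}
    [IsProbabilityMeasure μ] {X : Ω → ℕ} (hX : Measurable X)
    (hlaw : ∀ k : ℕ, μ.real (X ⁻¹' {k}) =
      (Nat.card {w : W // cs.length w = k} : ℝ) / Nat.card W) :
    variance (fun ω => (X ω : ℝ)) μ =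
      1 / 16 * ∑ α ∈ cs.allRoots, ∑ β ∈ cs.allRoots, cs.signCorr α β ^ 2 := by
  rw [variance_eq_integral (by fun_prop), integral_eq (cs := cs) hX hlaw,
    integral_comp_of_law (cs := cs) hX hlaw fun k => ((k : ℝ) - cs.posRoots.card / 2) ^ 2,
    sum_length_sub_sq, mul_div_cancel_left₀]
  exact_mod_cast Fintype.card_ne_zero

end CoxeterSystem

/-! ### Highest roots and dual Coxeter numbers -/

namespace RootPairing

variable {ι V N : Type*} [Fintype ι] [AddCommGroup V] [Module ℝ V] [AddCommGroup N] [Module ℝ N]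

/-- `ℓ` behaves like the square of the length of the roots: it is positive, symmetrises the
pairing and is invariant under the reflections. -/
structure IsSqLength (P : RootPairing ι ℝ V N) (ℓ : ι → ℝ) : Prop where
  pos : ∀ i, 0 < ℓ i
  mul_pairing : ∀ i j, ℓ i * P.pairing j i = ℓ j * P.pairing i j
  reflectionPerm : ∀ i j, ℓ (P.reflectionPerm i j) = ℓ j

lemma IsSqLength.flip {P : RootPairing ι ℝ V N} {ℓ : ι → ℝ} (h : P.IsSqLength ℓ) :
    P.flip.IsSqLength fun i => (ℓ i)⁻¹ where
  pos i := inv_pos.mpr (h.pos i)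
  mul_pairing i j := by
    have h1 := h.mul_pairing i j
    have hi := (h.pos i).ne'
    have hj := (h.pos j).ne'
    rw [pairing_flip, pairing_flip]
    field_simp
    linarith
  reflectionPerm i j := by
    rw [flip_reflectionPerm, h.reflectionPerm]

lemma isSqLength_rootForm (P : RootPairing ι ℝ V N) :
    P.IsSqLength fun i => P.RootForm (P.root i) (P.root i) where
  pos i := by
    rw [rootForm_root_self]
    refine Finset.sum_pos' (fun j _ => mul_self_nonneg _) ⟨i, Finset.mem_univ _, ?_⟩
    rw [pairing_same]; norm_num
  mul_pairing := by
    have key : ∀ i j, P.RootForm (P.root i) (P.root i) * P.pairing j i =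
        2 * P.RootForm (P.root i) (P.root j) := by
      intro i j
      have h := congrArg (fun x => P.toLinearMap (P.root j) x) (P.rootForm_self_smul_coroot i)
      simp only [map_smul, map_nsmul, smul_eq_mul, root_coroot_eq_pairing,
        toLinearMap_apply_apply_Polarization] at h
      rw [h]
      simp
    intro i j
    rw [key, key]
    congr 1
    simp only [rootForm_apply_apply, mul_comm]
  reflectionPerm i j := by
    rw [root_reflectionPerm, rootForm_reflection_reflection_apply]

variable {P : RootPairing ι ℝ V N} {ℓ : ι → ℝ}

lemma IsSqLength.pairing_nonneg_iff (h : P.IsSqLength ℓ) (i j : ι) :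
    0 ≤ P.pairing i j ↔ 0 ≤ P.pairing j i := by
  have h1 := h.mul_pairing i j
  rw [← mul_nonneg_iff_of_pos_left (h.pos j), ← h1, mul_nonneg_iff_of_pos_left (h.pos i)]

namespace Base

variable (b : P.Base)

/-- A difference of roots in the positive cone is a nonnegative combination of simple roots. -/
lemma exists_nat_of_mem_closure {m : V} (hm : m ∈ AddSubmonoid.closure (P.root '' b.support)) :
    ∃ f : ι → ℕ, m = ∑ j ∈ b.support, (f j : ℤ) • P.root j := by
  classical
  induction hm using AddSubmonoid.closure_induction with
  | mem x hx =>
    obtain ⟨j, hj, rfl⟩ := hx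
    refine ⟨Pi.single j 1, ?_⟩
    rw [Finset.sum_eq_single_of_mem j hj]
    · simp
    · intro k _ hk
      simp [hk]
  | zero => exact ⟨0, by simp⟩
  | add x y _ _ hx hy =>
    obtain ⟨f, rfl⟩ := hx
    obtain ⟨g, rfl⟩ := hy
    exact ⟨f + g, by simp [add_smul, Finset.sum_add_distrib]⟩

variable {b}

lemma IsHighestRoot.height_le {θ : ι} (hθ : b.IsHighestRoot θ) (j : ι) :
    b.height j ≤ b.height θ := by
  obtain ⟨f, hf⟩ := b.exists_nat_of_mem_closure (hθ j)
  obtain ⟨g, -, -, hg⟩ := b.exists_root_eq_sum_int j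
  have : P.root θ = ∑ k ∈ b.support, (f k + g k) • P.root k := by
    simp only [add_smul, Finset.sum_add_distrib]
    rw [← hf, ← hg]
    abel
  rw [height_eq_sum this, height_eq_sum hg, Finset.sum_add_distrib]
  have : 0 ≤ ∑ k ∈ b.support, (f k : ℤ) := Finset.sum_nonneg fun _ _ => by positivity
  omega

lemma IsPos.exists_eq_sum {β : ι} (h : b.IsPos β) :
    ∃ g : ι → ℤ, 0 ≤ g ∧ P.root β = ∑ j ∈ b.support, g j • P.root j := by
  obtain ⟨g, -, hg | hg, hs⟩ := b.exists_root_eq_sum_int β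
  · exact ⟨g, hg.le, hs⟩
  · exfalso
    rw [isPos_iff, height_eq_sum hs] at h
    have : ∑ j ∈ b.support, g j ≤ 0 := Finset.sum_nonpos fun j _ => hg.le j
    omega

lemma pairing_eq_sum {β : ι} {g : ι → ℤ} {v : V} (hv : v = ∑ j ∈ b.support, g j • P.root j) :
    P.toLinearMap v (P.coroot β) = ∑ j ∈ b.support, (g j : ℝ) * P.pairing j β := by
  rw [hv, map_sum, LinearMap.sum_apply]
  refine Finset.sum_congr rfl fun j _ => ?_
  rw [← Int.cast_smul_eq_zsmul ℝ, map_smul, LinearMap.smul_apply, root_coroot_eq_pairing,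
    smul_eq_mul]

variable [P.IsCrystallographic]

lemma height_reflectionPerm {i : ι} (hi : i ∈ b.support) (j : ι) :
    b.height (P.reflectionPerm i j) = b.height j - P.pairingIn ℤ j i := by
  have h : P.root (P.reflectionPerm i j) = P.root j + (-P.pairingIn ℤ j i) • P.root i := by
    rw [root_reflectionPerm, neg_smul, reflection_apply_root' ℤ, sub_eq_add_neg]
  rw [b.height_add_zsmul h, height_one_of_mem_support hi]
  simp [sub_eq_add_neg]

lemma cast_pairingIn (i j : ι) : ((P.pairingIn ℤ i j : ℤ) : ℝ) = P.pairing i j :=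
  P.algebraMap_pairingIn ℤ i j

lemma IsHighestRoot.pairing_nonneg {θ : ι} (hθ : b.IsHighestRoot θ) {i : ι} (hi : i ∈ b.support) :
    0 ≤ P.pairing θ i := by
  have := hθ.height_le (P.reflectionPerm i θ)
  rw [height_reflectionPerm hi] at this
  rw [← cast_pairingIn]
  exact_mod_cast (by omega : 0 ≤ P.pairingIn ℤ θ i)

/-- A root of maximal height among the roots of its length is dominant. -/
lemma exists_dominant (h : P.IsSqLength ℓ) (b : P.Base) (i : ι) :
    ∃ μ, ℓ μ = ℓ i ∧ ∀ j ∈ b.support, 0 ≤ P.pairing μ j := by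
  classical
  obtain ⟨μ, hμ, hmax⟩ := (Finset.univ.filter fun k => ℓ k = ℓ i).exists_max_image b.height
    ⟨i, by simp⟩
  simp only [Finset.mem_filter, Finset.mem_univ, true_and] at hμ hmax
  refine ⟨μ, hμ, fun j hj => ?_⟩
  have := hmax (P.reflectionPerm j μ) (by rw [h.reflectionPerm, hμ])
  rw [height_reflectionPerm hj] at this
  rw [← cast_pairingIn]
  exact_mod_cast (by omega : 0 ≤ P.pairingIn ℤ μ j)

lemma IsHighestRoot.two_le_pairing {θ μ : ι} (hθ : b.IsHighestRoot θ) (h : P.IsSqLength ℓ)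
    (hμ : ∀ j ∈ b.support, 0 ≤ P.pairing μ j) : 2 ≤ P.pairing θ μ := by
  obtain ⟨f, hf⟩ := b.exists_nat_of_mem_closure (hθ μ)
  have h1 := pairing_eq_sum (β := μ) hf
  rw [map_sub, LinearMap.sub_apply, root_coroot_eq_pairing, root_coroot_eq_pairing,
    pairing_same] at h1
  have : 0 ≤ ∑ j ∈ b.support, (((f j : ℕ) : ℤ) : ℝ) * P.pairing j μ :=
    Finset.sum_nonneg fun j hj =>
      mul_nonneg (by positivity) ((h.pairing_nonneg_iff _ _).mp (hμ j hj))
  linarith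

/-- The highest root is as long as any root. -/
lemma IsHighestRoot.sqLength_le {θ : ι} (hθ : b.IsHighestRoot θ) (h : P.IsSqLength ℓ) (j : ι) :
    ℓ j ≤ ℓ θ := by
  obtain ⟨μ, hμ, hdom⟩ := exists_dominant h b j
  have h1 := hθ.two_le_pairing h hdom
  rw [← hμ]
  have h2 := P.coxeterWeightIn_mem_set_of_isCrystallographic θ μ
  have h3 : P.pairingIn ℤ θ μ * P.pairingIn ℤ μ θ ≤ 4 := by
    simp only [Set.mem_insert_iff, Set.mem_singleton_iff, coxeterWeightIn] at h2
    omega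
  have h4 := h.mul_pairing θ μ
  rw [← cast_pairingIn, ← cast_pairingIn] at h4
  rw [← cast_pairingIn] at h1
  have h1' : 2 ≤ P.pairingIn ℤ θ μ := by exact_mod_cast h1
  have h5 : P.pairingIn ℤ μ θ ≤ 2 := by nlinarith
  have h6 : ((P.pairingIn ℤ μ θ : ℤ) : ℝ) ≤ 2 := by exact_mod_cast h5
  have := h.pos θ
  have := h.pos μ
  nlinarith

lemma IsHighestRoot.pairing_nonneg_of_isPos {θ β : ι} (hθ : b.IsHighestRoot θ)
    (h : P.IsSqLength ℓ) (hβ : b.IsPos β) : 0 ≤ P.pairing β θ := by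
  obtain ⟨g, hg, hs⟩ := hβ.exists_eq_sum
  rw [← root_coroot_eq_pairing, pairing_eq_sum hs]
  refine Finset.sum_nonneg fun j hj => mul_nonneg (by exact_mod_cast hg j) ?_
  rw [h.pairing_nonneg_iff]
  exact hθ.pairing_nonneg hj

variable [P.IsReduced]

lemma IsHighestRoot.pairing_sq_of_isPos {θ β : ι} (hθ : b.IsHighestRoot θ)
    (h : P.IsSqLength ℓ) (hβ : b.IsPos β) (hne : β ≠ θ) : P.pairing β θ ^ 2 = P.pairing β θ := by
  have h0 := hθ.pairing_nonneg_of_isPos h hβ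
  have hmem := P.pairingIn_pairingIn_mem_set_of_isCrystal_of_isRed' β θ
    (fun hr => hne (P.root.injective hr)) (fun hr => by
      have : P.pairing β θ = -2 := by
        rw [← root_coroot_eq_pairing, hr, map_neg, LinearMap.neg_apply, root_coroot_eq_pairing,
          pairing_same]
      linarith)
  have hle := hθ.sqLength_le h β
  have hmul := h.mul_pairing θ β
  have := h.pos β
  rw [← cast_pairingIn] at h0 ⊢
  rw [← cast_pairingIn, ← cast_pairingIn] at hmul
  simp only [Set.mem_insert_iff, Set.mem_singleton_iff, Prod.mk.injEq] at hmem
  rcases hmem with ⟨h1, h2⟩ | ⟨h1, h2⟩ | ⟨h1, h2⟩ | ⟨h1, h2⟩ | ⟨h1, h2⟩ | ⟨h1, h2⟩ | ⟨h1, h2⟩ |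
    ⟨h1, h2⟩ | ⟨h1, h2⟩ | ⟨h1, h2⟩ | ⟨h1, h2⟩ <;> rw [h1] at h0 hmul ⊢ <;> rw [h2] at hmul <;>
    push_cast at * <;> first | (exfalso; linarith) | norm_num

open scoped Classical in
/-- The sum `2ρ` of the positive roots pairs to `2` with every simple coroot. -/
lemma sum_isPos_pairing {j : ι} (hj : j ∈ b.support) :
    ∑ β ∈ Finset.univ.filter b.IsPos, P.pairing β j = 2 := by
  rw [← Finset.add_sum_erase _ _ (a := j) (by simp [isPos_of_mem_support hj]), pairing_same]
  set S := (Finset.univ.filter b.IsPos).erase j with hS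
  have hmaps : ∀ β ∈ S, P.reflectionPerm j β ∈ S := by
    intro β hβ
    simp only [hS, Finset.mem_erase, Finset.mem_filter, Finset.mem_univ, true_and] at hβ ⊢
    refine ⟨fun h => ?_, hβ.2.reflectionPerm hj hβ.1⟩
    have h1 : β = P.reflectionPerm j j := by
      have h2 := P.reflectionPerm_self j β
      rw [h] at h2
      exact h2.symm
    have h2 := isPos_of_mem_support hj
    rw [isPos_iff] at h2
    have h3 := hβ.2
    rw [h1, isPos_iff, b.height_reflectionPerm hj, pairingIn_same, height_one_of_mem_support hj]
      at h3
    omega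
  have : ∑ β ∈ S, P.pairing β j = ∑ β ∈ S, -P.pairing β j :=
    Finset.sum_bij' (fun β _ => P.reflectionPerm j β) (fun β _ => P.reflectionPerm j β) hmaps hmaps
      (fun β _ => by simp) (fun β _ => by simp) fun β _ => by
        rw [← pairing_reflectionPerm, pairing_reflectionPerm_self_right, neg_neg]
  rw [Finset.sum_neg_distrib] at this
  linarith

open scoped Classical in
/-- The sum of the squares of the pairings with the highest coroot, in terms of the dual Coxeter
number: the positive roots other than `θ` pair to `0` or `1`. -/
lemma IsHighestRoot.sum_pairing_sq {θ : ι} (hθ : b.IsHighestRoot θ) (h : P.IsSqLength ℓ) :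
    ∑ j, P.pairing j θ ^ 2 = 4 * (1 + b.flip.height θ : ℤ) := by
  have h1 : ∑ β ∈ Finset.univ.filter b.IsPos, P.pairing β θ = 2 * b.flip.height θ := by
    obtain ⟨f, -, -, hf⟩ := b.flip.exists_root_eq_sum_int θ
    rw [height_eq_sum hf]
    have h2 : ∀ β, P.pairing β θ = ∑ j ∈ b.support, (f j : ℝ) * P.pairing β j := fun β => by
      have := pairing_eq_sum (b := b.flip) (β := β) hf
      rw [root_coroot_eq_pairing] at this
      simpa using this
    simp only [h2]
    rw [Finset.sum_comm]
    simp only [← Finset.mul_sum]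
    rw [Finset.sum_congr rfl fun j hj => by rw [sum_isPos_pairing hj]]
    rw [← Finset.sum_mul]
    push_cast
    rw [flip_support]
    ring
  have hpos : b.IsPos θ := by
    rw [isPos_iff]
    obtain ⟨j, hj⟩ : b.support.Nonempty := by
      have : Nonempty ι := ⟨θ⟩
      exact b.support_nonempty
    have := hθ.height_le j
    rw [height_one_of_mem_support hj] at this
    omega
  have h2 : ∑ β ∈ Finset.univ.filter b.IsPos, P.pairing β θ ^ 2 = 2 * b.flip.height θ + 2 := by
    have hmem : θ ∈ Finset.univ.filter b.IsPos := by simp [hpos]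
    have h3 : ∀ β ∈ (Finset.univ.filter b.IsPos).erase θ, P.pairing β θ ^ 2 = P.pairing β θ := by
      intro β hβ
      rw [Finset.mem_erase, Finset.mem_filter] at hβ
      exact hθ.pairing_sq_of_isPos h hβ.2.2 hβ.1
    rw [← Finset.add_sum_erase _ _ hmem] at h1 ⊢
    rw [pairing_same] at h1 ⊢
    rw [Finset.sum_congr rfl h3]
    linarith
  rw [← Finset.sum_filter_add_sum_filter_not _ b.IsPos, h2]
  have h3 : ∑ β ∈ Finset.univ.filter (fun β => ¬ b.IsPos β), P.pairing β θ ^ 2 =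
      ∑ β ∈ Finset.univ.filter b.IsPos, P.pairing β θ ^ 2 := by
    have hneg : ∀ β, b.IsPos (P.reflectionPerm β β) ↔ ¬ b.IsPos β := fun β =>
      IsPos.neg_iff_not b β
    refine Finset.sum_bij' (fun β _ => P.reflectionPerm β β) (fun β _ => P.reflectionPerm β β)
      ?_ ?_ ?_ ?_ ?_
    · intro β hβ
      simpa [hneg] using hβ
    · intro β hβ
      simpa [hneg] using hβ
    · intro β _
      exact @neg_neg ι P.indexNeg β
    · intro β _
      exact @neg_neg ι P.indexNeg β
    · intro β _
      rw [pairing_reflectionPerm_self_left, neg_sq]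
  rw [h3, h2]
  push_cast
  ring

end Base

end RootPairing

/-! ### The order of a product of two reflections -/

namespace Module

variable {V : Type*} [AddCommGroup V] [Module ℝ V] {x y : V} {f g : Dual ℝ V}

lemma dual_reflection_mul_reflection_apply (hf : f x = 2) (hg : g y = 2) (v : V) :
    f ((reflection hf * reflection hg) v) = g v * f y - f v ∧
      g ((reflection hf * reflection hg) v) = (f y * g x - 1) * g v - f v * g x := by
  simp only [LinearEquiv.mul_apply, reflection_apply, map_sub, map_smul, smul_eq_mul, hf, hg]
  constructor <;> ring

lemma eq_of_reflection_mul_reflection_sq (hf : f x = 2) (hg : g y = 2)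
    (h : (reflection hf * reflection hg) ^ 2 = 1) : f y * g x = 0 ∨ f y * g x = 4 := by
  have h1 := congrArg f (LinearEquiv.congr_fun h x)
  simp only [pow_succ, pow_zero, one_mul, LinearEquiv.mul_apply (_ * _),
    dual_reflection_mul_reflection_apply, LinearEquiv.coe_one, id_eq, hf] at h1
  rw [← sub_eq_zero (b := (4 : ℝ)), ← mul_eq_zero]
  linear_combination h1

lemma eq_of_reflection_mul_reflection_pow_three (hf : f x = 2) (hg : g y = 2)
    (h : (reflection hf * reflection hg) ^ 3 = 1) : f y * g x = 1 ∨ f y * g x = 4 := by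
  have h1 := congrArg f (LinearEquiv.congr_fun h x)
  simp only [pow_succ, pow_zero, one_mul, LinearEquiv.mul_apply (_ * _),
    dual_reflection_mul_reflection_apply, LinearEquiv.coe_one, id_eq, hf] at h1
  have h2 : (f y * g x - 1) ^ 2 * (f y * g x - 4) = 0 := by linear_combination h1
  rcases mul_eq_zero.mp h2 with h3 | h3
  · left; linarith [pow_eq_zero_iff (two_ne_zero) |>.mp h3]
  · right; linarith

lemma eq_of_reflection_mul_reflection_pow_four (hf : f x = 2) (hg : g y = 2)
    (h : (reflection hf * reflection hg) ^ 4 = 1) :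
    f y * g x = 0 ∨ f y * g x = 2 ∨ f y * g x = 4 := by
  have h1 := congrArg f (LinearEquiv.congr_fun h x)
  simp only [pow_succ, pow_zero, one_mul, LinearEquiv.mul_apply (_ * _),
    dual_reflection_mul_reflection_apply, LinearEquiv.coe_one, id_eq, hf] at h1
  have h2 : (f y * g x - 2) ^ 2 * (f y * g x * (f y * g x - 4)) = 0 := by linear_combination h1
  rcases mul_eq_zero.mp h2 with h3 | h3
  · right; left; linarith [pow_eq_zero_iff (two_ne_zero) |>.mp h3]
  · rcases mul_eq_zero.mp h3 with h3 | h3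
    · exact Or.inl h3
    · right; right; linarith

lemma eq_of_reflection_mul_reflection_pow_six (hf : f x = 2) (hg : g y = 2)
    (h : (reflection hf * reflection hg) ^ 6 = 1) :
    f y * g x = 0 ∨ f y * g x = 1 ∨ f y * g x = 3 ∨ f y * g x = 4 := by
  have h1 := congrArg f (LinearEquiv.congr_fun h x)
  simp only [pow_succ, pow_zero, one_mul, LinearEquiv.mul_apply (_ * _),
    dual_reflection_mul_reflection_apply, LinearEquiv.coe_one, id_eq, hf] at h1
  have h2 : ((f y * g x - 1) * (f y * g x - 3)) ^ 2 * (f y * g x * (f y * g x - 4)) = 0 := by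
    linear_combination h1
  rcases mul_eq_zero.mp h2 with h3 | h3
  · rcases mul_eq_zero.mp (pow_eq_zero_iff (two_ne_zero) |>.mp h3) with h3 | h3
    · right; left; linarith
    · right; right; left; linarith
  · rcases mul_eq_zero.mp h3 with h3 | h3
    · exact Or.inl h3
    · right; right; right; linarith

lemma reflection_mul_reflection_sq (hf : f x = 2) (hg : g y = 2) (h1 : f y = 0) (h2 : g x = 0) :
    (reflection hf * reflection hg) ^ 2 = 1 := by
  ext1 v
  simp only [pow_two, LinearEquiv.mul_apply, reflection_apply, map_sub, map_smul, hf, hg, h1, h2,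
    LinearEquiv.coe_one, id_eq]
  module

lemma reflection_mul_reflection_pow_three (hf : f x = 2) (hg : g y = 2) (h : f y * g x = 1) :
    (reflection hf * reflection hg) ^ 3 = 1 := by
  ext1 v
  rw [reflection_mul_reflection_pow_apply hf hg 3 v (-1) (by rw [h]; norm_num)]
  norm_num

lemma reflection_mul_reflection_pow_four (hf : f x = 2) (hg : g y = 2) (h : f y * g x = 2) :
    (reflection hf * reflection hg) ^ 4 = 1 := by
  ext1 v
  rw [reflection_mul_reflection_pow_apply hf hg 4 v 0 (by rw [h]; norm_num)]
  norm_num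

lemma reflection_mul_reflection_pow_six (hf : f x = 2) (hg : g y = 2) (h : f y * g x = 3) :
    (reflection hf * reflection hg) ^ 6 = 1 := by
  ext1 v
  rw [reflection_mul_reflection_pow_apply hf hg 6 v 1 (by rw [h]; norm_num)]
  norm_num [Polynomial.Chebyshev.S_two]

/-- The product `f y * g x` attached to two reflections is determined by the powers of their
product that are trivial, provided that it is one of `0`, `1`, `2`, `3`. -/
lemma eq_of_reflection_mul_reflection_pow_iff {V' : Type*} [AddCommGroup V'] [Module ℝ V']
    {x' y' : V'} {f' g' : Dual ℝ V'} (hf : f x = 2) (hg : g y = 2) (hf' : f' x' = 2)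
    (hg' : g' y' = 2) (hc : f y * g x = 0 ∨ f y * g x = 1 ∨ f y * g x = 2 ∨ f y * g x = 3)
    (h0 : f y * g x = 0 → f y = 0 ∧ g x = 0) (h0' : f' y' * g' x' = 0 → f' y' = 0 ∧ g' x' = 0)
    (h4 : f' y' * g' x' < 4)
    (h : ∀ m : ℕ, (reflection hf * reflection hg) ^ m = 1 ↔
      (reflection hf' * reflection hg') ^ m = 1) : f y * g x = f' y' * g' x' := by
  have hz : f' y' * g' x' = 0 → f y * g x = 0 ∨ f y * g x = 4 := fun e =>
    eq_of_reflection_mul_reflection_sq hf hg ((h 2).mpr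
      (reflection_mul_reflection_sq hf' hg' (h0' e).1 (h0' e).2))
  rcases hc with hc | hc | hc | hc
  · have := eq_of_reflection_mul_reflection_sq hf' hg' ((h 2).mp
      (reflection_mul_reflection_sq hf hg (h0 hc).1 (h0 hc).2))
    rcases this with h1 | h1 <;> linarith
  · have := eq_of_reflection_mul_reflection_pow_three hf' hg' ((h 3).mp
      (reflection_mul_reflection_pow_three hf hg hc))
    rcases this with h1 | h1 <;> linarith
  · have := eq_of_reflection_mul_reflection_pow_four hf' hg' ((h 4).mp
      (reflection_mul_reflection_pow_four hf hg hc))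
    rcases this with h1 | h1 | h1
    · rcases hz h1 with h2 | h2 <;> linarith
    · linarith
    · linarith
  · have := eq_of_reflection_mul_reflection_pow_six hf' hg' ((h 6).mp
      (reflection_mul_reflection_pow_six hf hg hc))
    rcases this with h1 | h1 | h1 | h1
    · rcases hz h1 with h2 | h2 <;> linarith
    · have := eq_of_reflection_mul_reflection_pow_three hf hg ((h 3).mpr
        (reflection_mul_reflection_pow_three hf' hg' h1))
      rcases this with h2 | h2 <;> linarith
    · linarith
    · linarith

end Module

/-! ### The frame identity, and the Weyl group in the geometric representation -/

namespace RootPairing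

variable {ι V N : Type*} [Fintype ι] [AddCommGroup V] [Module ℝ V] [AddCommGroup N] [Module ℝ N]
  {P : RootPairing ι ℝ V N}

lemma pairing_of_root_eq_neg {k l : ι} (h : P.root k = -P.root l) :
    P.pairing k l = -2 := by
  rw [← root_coroot_eq_pairing, h, map_neg, LinearMap.neg_apply,
    root_coroot_eq_pairing, pairing_same]

variable [P.IsCrystallographic] [P.IsReduced]

lemma pairing_mul_pairing_of_ne {k l : ι} (h1 : P.root k ≠ P.root l)
    (h2 : P.root k ≠ -P.root l) : P.pairing k l * P.pairing l k = 0 ∨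
      P.pairing k l * P.pairing l k = 1 ∨ P.pairing k l * P.pairing l k = 2 ∨
        P.pairing k l * P.pairing l k = 3 := by
  have hmem := P.pairingIn_pairingIn_mem_set_of_isCrystal_of_isRed' k l h1 h2
  rw [← Base.cast_pairingIn, ← Base.cast_pairingIn]
  simp only [Set.mem_insert_iff, Set.mem_singleton_iff, Prod.mk.injEq] at hmem
  rcases hmem with ⟨h1, h2⟩ | ⟨h1, h2⟩ | ⟨h1, h2⟩ | ⟨h1, h2⟩ | ⟨h1, h2⟩ | ⟨h1, h2⟩ | ⟨h1, h2⟩ |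
    ⟨h1, h2⟩ | ⟨h1, h2⟩ | ⟨h1, h2⟩ | ⟨h1, h2⟩ <;> rw [h1, h2] <;> norm_num

end RootPairing

namespace CoxeterSystem

variable {B W : Type*} [Fintype B] [DecidableEq B] [Group W] [Finite W] {M : CoxeterMatrix B}
  {cs : CoxeterSystem M W}

/-- A set of roots stable under the simple reflections is a tight frame. The operator
`v ↦ ∑ ⟨β, v⟩ β` commutes with the simple reflections, hence is a scalar by irreducibility, and
the scalar is given by the trace. -/
theorem sum_cosForm_sq (hirr : M.IsIrreducible) {J : Finset (B → ℝ)} (hJ : ∀ β ∈ J, β ∈ cs.roots)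
    (hstab : ∀ i, ∀ β ∈ J, cs.geometricRep (cs.simple i) β ∈ J) {α : B → ℝ} (hα : α ∈ cs.roots) :
    ∑ β ∈ J, M.cosForm β α ^ 2 = 4 * J.card / Fintype.card B := by
  set T : (B → ℝ) → (B → ℝ) := fun v => ∑ β ∈ J, M.cosForm β v • β with hT
  have hTs : ∀ i v, T (cs.geometricRep (cs.simple i) v) = cs.geometricRep (cs.simple i) (T v) := by
    intro i v
    have hinv : ∀ β, cs.geometricRep (cs.simple i) (cs.geometricRep (cs.simple i) β) = β := by
      intro β
      rw [← geometricRep_mul_apply, simple_mul_simple_self, geometricRep_one_apply]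
    simp only [hT, map_sum, map_smul]
    refine Finset.sum_bij' (fun β _ => cs.geometricRep (cs.simple i) β)
      (fun β _ => cs.geometricRep (cs.simple i) β) (hstab i) (hstab i) (fun β _ => hinv β)
      (fun β _ => hinv β) fun β _ => ?_
    rw [hinv, ← cs.cosForm_geometricRep (cs.simple i) β, hinv]
  have hsymm : ∀ u v, M.cosForm (T u) v = M.cosForm (T v) u := by
    intro u v
    simp only [hT, map_sum, map_smul, LinearMap.sum_apply, LinearMap.smul_apply, smul_eq_mul]
    exact Finset.sum_congr rfl fun β _ => mul_comm _ _
  set g : B → ℝ := fun i => M.simpleForm i (T (Pi.single i 1)) / 2 with hg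
  have hTg : ∀ i, T (Pi.single i 1) = g i • Pi.single i 1 := by
    intro i
    have h1 := hTs i (Pi.single i 1)
    rw [geometricRep_simple_self, geometricRep_simple_apply] at h1
    have h2 : T (-Pi.single i 1) = -T (Pi.single i 1) := by
      simp [hT, Finset.sum_neg_distrib]
    rw [h2] at h1
    have h3 : (2 : ℝ) • T (Pi.single i 1) =
        M.simpleForm i (T (Pi.single i 1)) • Pi.single i 1 := by
      rw [two_smul]
      nth_rewrite 1 [← neg_neg (T (Pi.single i 1)), h1]
      abel
    simp only [hg]
    rw [div_eq_inv_mul, mul_smul, ← h3, smul_smul]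
    norm_num
  have hconst : ∀ i j, g i = g j := fun i j => by
    refine hirr.eq_of_forall_adj g (fun i j hij hM => ?_) i j
    have h1 := hsymm (Pi.single i 1) (Pi.single j 1)
    rw [hTg, hTg, map_smul, map_smul, LinearMap.smul_apply, LinearMap.smul_apply,
      CoxeterMatrix.cosForm_comm _ (Pi.single j 1), CoxeterMatrix.cosForm_single, smul_eq_mul,
      smul_eq_mul] at h1
    exact mul_right_cancel₀ (by linarith [CoxeterMatrix.simpleForm_single_le_neg_one hij hM]) h1
  obtain ⟨w, i₀, rfl⟩ := hα
  have hscal : ∀ i, T (Pi.single i 1) = g i₀ • Pi.single i 1 := fun i => by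
    rw [hTg, hconst i i₀]
  have hn : (0 : ℝ) < Fintype.card B := by
    exact_mod_cast Fintype.card_pos_iff.mpr ⟨i₀⟩
  have htr : (Fintype.card B : ℝ) * g i₀ = 2 * J.card := by
    have h1 : ∑ i, T (Pi.single i 1) i = Fintype.card B * g i₀ := by
      simp [hscal]
    have h2 : ∑ i, T (Pi.single i 1) i = ∑ β ∈ J, M.cosForm β β := by
      simp only [hT, Finset.sum_apply, Pi.smul_apply, smul_eq_mul]
      rw [Finset.sum_comm]
      refine Finset.sum_congr rfl fun β _ => ?_
      rw [CoxeterMatrix.cosForm_apply]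
      refine Finset.sum_congr rfl fun i _ => ?_
      rw [CoxeterMatrix.cosForm_comm, CoxeterMatrix.cosForm_single, mul_comm]
    rw [← h1, h2, Finset.sum_congr rfl fun β hβ => cosForm_self_of_mem_roots (hJ β hβ)]
    simp [mul_comm]
  have hTw : ∀ v, T v = g i₀ • v := by
    intro v
    have hv : v = ∑ i, v i • (Pi.single i 1 : B → ℝ) := by
      ext j; simp [Finset.sum_apply, Pi.single_apply]
    have hlin : T v = ∑ i, v i • T (Pi.single i 1) := by
      conv_lhs => rw [hv]
      simp only [hT, map_sum, map_smul, Finset.smul_sum, Finset.sum_smul, smul_eq_mul, mul_smul]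
      exact Finset.sum_comm
    rw [hlin]
    conv_rhs => rw [hv, Finset.smul_sum]
    refine Finset.sum_congr rfl fun i _ => ?_
    rw [hscal, smul_comm]
  set α := cs.geometricRep w (Pi.single i₀ 1)
  have h1 : M.cosForm (T α) α = ∑ β ∈ J, M.cosForm β α ^ 2 := by
    simp only [hT, map_sum, map_smul, LinearMap.sum_apply, LinearMap.smul_apply, smul_eq_mul, sq]
  rw [← h1, hTw, map_smul, LinearMap.smul_apply, smul_eq_mul,
    cosForm_self_of_mem_roots (cs := cs) ⟨w, i₀, rfl⟩]
  field_simp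
  linarith

section Weyl

variable {ι V N : Type} [Fintype ι] [AddCommGroup V] [Module ℝ V] [AddCommGroup N] [Module ℝ N]
  {P : RootPairing ι ℝ V N}

/-- The action of `W` on the ambient space of a root system whose Weyl group is identified
with `W`. -/
def weylRep (f : W ≃* P.weylGroup) : W →* (V ≃ₗ[ℝ] V) :=
  (RootPairing.Equiv.weightHom P).comp (P.weylGroup.subtype.comp f.toMonoidHom)

lemma weylRep_injective (f : W ≃* P.weylGroup) : Function.Injective (weylRep f) :=
  (RootPairing.Equiv.weightHom_injective P).comp
    (Subtype.val_injective.comp f.injective)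

variable {b : P.Base} {e : B ≃ b.support} {f : W ≃* P.weylGroup}

lemma weylRep_simple (hf : ∀ i, f (cs.simple i) = RootPairing.weylGroup.ofIdx P (e i)) (i : B) :
    weylRep f (cs.simple i) = P.reflection (e i) := by
  have : weylRep f (cs.simple i) =
      RootPairing.Equiv.weightHom P (f (cs.simple i) : P.weylGroup) := rfl
  rw [this, hf]
  exact RootPairing.Equiv.reflection_weightEquiv P (e i)

variable [P.IsCrystallographic] [P.IsReduced]

lemma pairing_le_zero {i j : B} (hij : i ≠ j) : P.pairing (e i) (e j) ≤ 0 := by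
  rw [← RootPairing.Base.cast_pairingIn]
  have : (e i : ι) ≠ e j := fun h => hij (e.injective (Subtype.ext h))
  exact_mod_cast b.pairingIn_le_zero_of_ne this (e i).2 (e j).2

/-- The Coxeter matrix determines the products of pairings of simple roots, as both are read off
from the orders of the products of two simple reflections. -/
lemma simpleForm_single_sq (hirr : M.IsIrreducible)
    (hf : ∀ i, f (cs.simple i) = RootPairing.weylGroup.ofIdx P (e i)) {i j : B} (hij : i ≠ j) :
    M.simpleForm i (Pi.single j 1) ^ 2 = P.pairing (e i) (e j) * P.pairing (e j) (e i) := by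
  have hne : (e i : ι) ≠ e j := fun h => hij (e.injective (Subtype.ext h))
  have hmem := P.pairing_mul_pairing_of_ne (k := e i) (l := e j)
    (fun hr => hne (P.root.injective hr)) (fun hr => by
      have hli := b.linearIndependent_pair_of_ne (i := e i) (j := e j)
        (fun h => hij (e.injective h))
      rw [LinearIndependent.pair_iff] at hli
      have := hli 1 1 (by rw [hr]; simp)
      exact one_ne_zero this.1)
  have hc4 : M.simpleForm j (Pi.single i 1) * M.simpleForm i (Pi.single j 1) < 4 := by
    have hv : (Pi.single i 1 - (M.simpleForm j (Pi.single i 1) / 2) • Pi.single j 1 : B → ℝ) ≠ 0 := by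
      intro h
      have := congrFun h i
      simp [hij] at this
    have := cs.cosForm_self_pos hirr hv
    simp only [map_sub, map_smul, LinearMap.sub_apply, LinearMap.smul_apply, smul_eq_mul,
      CoxeterMatrix.cosForm_single, CoxeterMatrix.simpleForm_self] at this
    linarith
  have hzero : ∀ i j, M.simpleForm i (Pi.single j 1) = 0 → M.simpleForm j (Pi.single i 1) = 0 := by
    intro i j h
    rw [← CoxeterMatrix.simpleForm_single_comm, h]
  have key := Module.eq_of_reflection_mul_reflection_pow_iff
    (P.flip.root_coroot_two (e i)) (P.flip.root_coroot_two (e j))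
    (M.simpleForm_self i) (M.simpleForm_self j) ?_ ?_ ?_ ?_ ?_
  · rw [CoxeterMatrix.simpleForm_single_comm j i] at key
    rw [sq, ← key]
    exact mul_comm _ _
  · rw [mul_comm] at hmem
    exact hmem
  · change P.pairing (e j) (e i) * P.pairing (e i) (e j) = 0 →
      P.pairing (e j) (e i) = 0 ∧ P.pairing (e i) (e j) = 0
    intro h
    rcases mul_eq_zero.mp h with h | h
    · exact ⟨h, P.pairing_eq_zero_iff'.mp h⟩
    · exact ⟨P.pairing_eq_zero_iff'.mp h, h⟩
  · intro h
    rcases mul_eq_zero.mp h with h | h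
    · exact ⟨h, hzero _ _ h⟩
    · exact ⟨hzero _ _ h, h⟩
  · linarith
  · intro m
    change (P.reflection (e i) * P.reflection (e j)) ^ m = 1 ↔
      (M.simpleReflection i * M.simpleReflection j) ^ m = 1
    rw [← weylRep_simple hf, ← weylRep_simple hf, ← cs.geometricRep_simple,
      ← cs.geometricRep_simple, ← map_mul, ← map_mul, ← map_pow, ← map_pow,
      map_eq_one_iff _ (weylRep_injective f), map_eq_one_iff _ cs.geometricRep_injective]

variable {ℓ : ι → ℝ}

/-- The intertwining map from the geometric representation, sending the `i`-th basis vector to the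
`i`-th simple root of the root system rescaled to squared length `2`. -/
def rootMap (ℓ : ι → ℝ) (e : B ≃ b.support) : (B → ℝ) →ₗ[ℝ] V :=
  ∑ i, (√(2 / ℓ (e i)) • (LinearMap.proj i : (B → ℝ) →ₗ[ℝ] ℝ)).smulRight (P.root (e i))

lemma rootMap_apply (v : B → ℝ) :
    rootMap ℓ e v = ∑ i, (√(2 / ℓ (e i)) * v i) • P.root (e i) := by
  simp [rootMap]

lemma rootMap_single (i : B) :
    rootMap ℓ e (Pi.single i 1) = √(2 / ℓ (e i)) • P.root (e i) := by
  rw [rootMap_apply, Finset.sum_eq_single i]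
  · simp
  · intro j _ hj
    simp [hj]
  · simp

lemma rootMap_injective (hℓ : P.IsSqLength ℓ) : Function.Injective (rootMap ℓ e) := by
  rw [injective_iff_map_eq_zero]
  intro v hv
  rw [rootMap_apply] at hv
  have hli : LinearIndependent ℝ fun i : B => P.root (e i) :=
    b.linearIndepOn_root.comp e e.injective
  have := Fintype.linearIndependent_iff.mp hli _ hv
  ext i
  have hi := this i
  have h2 : 0 < √(2 / ℓ (e i)) := Real.sqrt_pos.mpr (div_pos two_pos (hℓ.pos _))
  exact (mul_eq_zero.mp hi).resolve_left h2.ne'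

lemma simpleForm_single_mul_sqrt (hirr : M.IsIrreducible) (hℓ : P.IsSqLength ℓ)
    (hf : ∀ i, f (cs.simple i) = RootPairing.weylGroup.ofIdx P (e i)) (i j : B) :
    √(2 / ℓ (e i)) * M.simpleForm i (Pi.single j 1) =
      √(2 / ℓ (e j)) * P.pairing (e j) (e i) := by
  by_cases hij : i = j
  · subst hij
    rw [CoxeterMatrix.simpleForm_self, RootPairing.pairing_same]
  have hi := hℓ.pos (e i)
  have hj := hℓ.pos (e j)
  have h1 : 0 ≤ √(2 / ℓ (e i)) * -M.simpleForm i (Pi.single j 1) :=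
    mul_nonneg (Real.sqrt_nonneg _) (neg_nonneg.mpr (CoxeterMatrix.simpleForm_single_nonpos hij))
  have h2 : 0 ≤ √(2 / ℓ (e j)) * -P.pairing (e j) (e i) :=
    mul_nonneg (Real.sqrt_nonneg _) (neg_nonneg.mpr (pairing_le_zero (Ne.symm hij)))
  have h3 : (√(2 / ℓ (e i)) * -M.simpleForm i (Pi.single j 1)) ^ 2 =
      (√(2 / ℓ (e j)) * -P.pairing (e j) (e i)) ^ 2 := by
    rw [mul_pow, mul_pow, neg_sq, neg_sq, Real.sq_sqrt (by positivity),
      Real.sq_sqrt (by positivity), simpleForm_single_sq hirr hf hij]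
    have := hℓ.mul_pairing (e i) (e j)
    field_simp
    linear_combination (-P.pairing (e j) (e i)) * this
  have := (pow_left_inj₀ h1 h2 two_ne_zero).mp h3
  linarith

lemma rootMap_geometricRep (hirr : M.IsIrreducible) (hℓ : P.IsSqLength ℓ)
    (hf : ∀ i, f (cs.simple i) = RootPairing.weylGroup.ofIdx P (e i)) (w : W) (v : B → ℝ) :
    rootMap ℓ e (cs.geometricRep w v) = weylRep f w (rootMap ℓ e v) := by
  induction w using cs.simple_induction_left generalizing v with
  | one => simp
  | mul_simple_left w i ih =>
    rw [geometricRep_mul_apply, map_mul, LinearEquiv.mul_apply, ← ih]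
    generalize cs.geometricRep w v = v
    rw [geometricRep_simple_apply, weylRep_simple hf, map_sub, map_smul, rootMap_single,
      RootPairing.reflection_apply, rootMap_apply, smul_smul, map_sum]
    congr 2
    have h1 : M.simpleForm i v = ∑ j, v j * M.simpleForm i (Pi.single j 1) := by
      conv_lhs => rw [show v = ∑ j, v j • (Pi.single j 1 : B → ℝ) by
        ext k; simp [Finset.sum_apply, Pi.single_apply]]
      simp only [map_sum, map_smul, smul_eq_mul]
    rw [h1, Finset.sum_mul]
    refine Finset.sum_congr rfl fun j _ => ?_
    rw [map_smul, smul_eq_mul, RootPairing.coroot', LinearMap.flip_apply,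
      RootPairing.root_coroot_eq_pairing]
    linear_combination v j * simpleForm_single_mul_sqrt hirr hℓ hf i j

/-- The roots of the Coxeter system are the roots of the root system, rescaled to squared
length `2`. -/
theorem exists_root_indexing (hirr : M.IsIrreducible) (hℓ : P.IsSqLength ℓ)
    (hf : ∀ i, f (cs.simple i) = RootPairing.weylGroup.ofIdx P (e i)) :
    ∃ φ : ι → (B → ℝ), Function.Injective φ ∧ (∀ β, β ∈ cs.roots ↔ ∃ k, φ k = β) ∧
      (∀ i k, cs.geometricRep (cs.simple i) (φ k) = φ (P.reflectionPerm (e i) k)) ∧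
      ∀ k l, M.cosForm (φ k) (φ l) ^ 2 = P.pairing k l * P.pairing l k := by
  have hinj := rootMap_injective (e := e) hℓ
  have hκ : ∀ k, 0 < √(2 / ℓ k) := fun k => Real.sqrt_pos.mpr (div_pos two_pos (hℓ.pos _))
  have hex : ∀ k, ∃ β ∈ cs.roots, rootMap ℓ e β = √(2 / ℓ k) • P.root k ∧
      ∃ t, (∀ v, cs.geometricRep t v = v - M.cosForm β v • β) ∧
        weylRep f t = P.reflection k := by
    intro k
    induction k using b.induction_reflect with
    | h₀ k ih =>
      obtain ⟨β, hβ, h1, t, h2, h3⟩ := ih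
      refine ⟨-β, neg_mem_roots hβ, ?_, t, ?_, ?_⟩
      · rw [map_neg, h1, hℓ.reflectionPerm, RootPairing.root_reflectionPerm,
          RootPairing.reflection_apply_self, smul_neg]
      · intro v
        rw [h2]
        simp
      · rw [h3, RootPairing.reflection_reflectionPerm]
        ext v
        simp [LinearEquiv.mul_apply]
    | h₁ k hk =>
      obtain ⟨i, hi⟩ := e.surjective ⟨k, hk⟩
      have hk' : (e i : ι) = k := by rw [hi]
      refine ⟨Pi.single i 1, cs.single_mem_roots i, ?_, cs.simple i, ?_, ?_⟩
      · rw [rootMap_single, hk']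
      · intro v
        rw [geometricRep_simple_apply, CoxeterMatrix.cosForm_single]
      · rw [weylRep_simple hf, hk']
    | h₂ k j ih hj =>
      obtain ⟨β, hβ, h1, t, h2, h3⟩ := ih
      obtain ⟨i, hi⟩ := e.surjective ⟨j, hj⟩
      have hj' : (e i : ι) = j := by rw [hi]
      refine ⟨cs.geometricRep (cs.simple i) β, geometricRep_mem_roots _ hβ, ?_,
        cs.simple i * t * cs.simple i, ?_, ?_⟩
      · rw [rootMap_geometricRep hirr hℓ hf, h1, weylRep_simple hf, map_smul, hj',
          hℓ.reflectionPerm, RootPairing.root_reflectionPerm]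
      · intro v
        rw [geometricRep_mul_apply, geometricRep_mul_apply, h2, map_sub, map_smul,
          ← geometricRep_mul_apply, simple_mul_simple_self, geometricRep_one_apply,
          ← cs.cosForm_geometricRep (cs.simple i) β, ← geometricRep_mul_apply,
          simple_mul_simple_self, geometricRep_one_apply]
      · rw [map_mul, map_mul, weylRep_simple hf, h3, hj', RootPairing.reflection_reflectionPerm]
  choose φ hφ h1 t h2 h3 using hex
  have hperm : ∀ i k, cs.geometricRep (cs.simple i) (φ k) = φ (P.reflectionPerm (e i) k) := by
    intro i k
    apply hinj
    rw [rootMap_geometricRep hirr hℓ hf, h1, h1, weylRep_simple hf, map_smul, hℓ.reflectionPerm,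
      RootPairing.root_reflectionPerm]
  have hform : ∀ k l, M.cosForm (φ k) (φ l) * √(2 / ℓ k) = √(2 / ℓ l) * P.pairing l k := by
    intro k l
    have h4 := rootMap_geometricRep hirr hℓ hf (t k) (φ l)
    rw [h2, h3, map_sub, map_smul, h1, h1, map_smul, RootPairing.reflection_apply_root, smul_sub,
      sub_right_inj, smul_smul, smul_smul] at h4
    exact smul_left_injective ℝ (P.ne_zero k) h4
  have hsq : ∀ k l, M.cosForm (φ k) (φ l) ^ 2 = P.pairing k l * P.pairing l k := by
    intro k l
    have h4 := hform k l
    have h5 := hform l k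
    rw [CoxeterMatrix.cosForm_comm] at h5
    have h6 : (M.cosForm (φ k) (φ l) ^ 2 - P.pairing k l * P.pairing l k) *
        (√(2 / ℓ k) * √(2 / ℓ l)) = 0 := by
      linear_combination (M.cosForm (φ k) (φ l) * √(2 / ℓ l)) * h4 +
        (√(2 / ℓ l) * P.pairing l k) * h5
    exact sub_eq_zero.mp ((mul_eq_zero.mp h6).resolve_right (mul_pos (hκ k) (hκ l)).ne')
  refine ⟨φ, fun k l hkl => ?_, fun β => ⟨?_, ?_⟩, hperm, hsq⟩
  · have h4 := hform k l
    have h5 := hform l k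
    have h6 := hsq k l
    rw [← hkl, cosForm_self_of_mem_roots (hφ k)] at h4 h5 h6
    by_contra hne
    have hmem := P.pairing_mul_pairing_of_ne (fun hr => hne (P.root.injective hr)) (fun hr => by
      rw [RootPairing.pairing_of_root_eq_neg hr] at h5
      linarith [hκ k, hκ l])
    rcases hmem with h7 | h7 | h7 | h7 <;> rw [h7] at h6 <;> norm_num at h6
  · rintro ⟨w, i, rfl⟩
    induction w using cs.simple_induction_left with
    | one =>
      refine ⟨e i, hinj ?_⟩
      rw [h1, geometricRep_one_apply, rootMap_single]
    | mul_simple_left w j ih =>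
      obtain ⟨k, hk⟩ := ih
      exact ⟨P.reflectionPerm (e j) k, by rw [← hperm, hk, geometricRep_mul_apply]⟩
  · rintro ⟨k, rfl⟩
    exact hφ k

end Weyl

end CoxeterSystem

/-! ### The variance for Weyl groups -/

/-- The square of the correlation `1 - 2 θ / π` of two roots at angle `θ`, in terms of
`c = 4 cos² θ`. -/
def angleWeight (c : ℝ) : ℝ := (1 - 2 * Real.arccos (√c / 2) / Real.pi) ^ 2

lemma angleWeight_eq {c t : ℝ} (h0 : 0 ≤ t) (h1 : t ≤ Real.pi) (h : Real.cos t = √c / 2) :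
    angleWeight c = (1 - 2 * t / Real.pi) ^ 2 := by
  rw [angleWeight, ← h, Real.arccos_cos h0 h1]

lemma angleWeight_zero : angleWeight 0 = 0 := by
  have := Real.pi_pos
  rw [angleWeight_eq (t := Real.pi / 2) (by positivity) (by linarith) (by simp)]
  field_simp
  norm_num

lemma angleWeight_one : angleWeight 1 = 1 / 9 := by
  have := Real.pi_pos
  rw [angleWeight_eq (t := Real.pi / 3) (by positivity) (by linarith) (by simp)]
  field_simp
  norm_num

lemma angleWeight_two : angleWeight 2 = 1 / 4 := by
  have := Real.pi_pos
  rw [angleWeight_eq (t := Real.pi / 4) (by positivity) (by linarith) (by simp)]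
  field_simp
  norm_num

lemma angleWeight_three : angleWeight 3 = 4 / 9 := by
  have := Real.pi_pos
  rw [angleWeight_eq (t := Real.pi / 6) (by positivity) (by linarith) (by simp)]
  field_simp
  norm_num

lemma angleWeight_four : angleWeight 4 = 1 := by
  have := Real.pi_pos
  rw [angleWeight_eq (t := 0) le_rfl (by linarith) (by
    rw [show (4 : ℝ) = 2 ^ 2 by norm_num, Real.sqrt_sq two_pos.le]; simp)]
  simp

lemma CoxeterSystem.signCorr_sq {B W : Type*} [Fintype B] [DecidableEq B] [Group W] [Fintype W]
    {M : CoxeterMatrix B} {cs : CoxeterSystem M W} (hirr : M.IsIrreducible) {α β : B → ℝ}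
    (hα : α ∈ cs.roots) (hβ : β ∈ cs.roots) :
    cs.signCorr α β ^ 2 = angleWeight (M.cosForm α β ^ 2) := by
  rw [signCorr_eq hirr hα hβ, angleWeight, Real.sqrt_sq_eq_abs]
  have := Real.pi_pos
  rcases abs_cases (M.cosForm α β) with ⟨h, -⟩ | ⟨h, -⟩ <;> rw [h]
  rw [neg_div, Real.arccos_neg]
  field_simp
  ring

namespace RootPairing

variable {ι V N : Type*} [Fintype ι] [AddCommGroup V] [Module ℝ V] [AddCommGroup N] [Module ℝ N]
  {P : RootPairing ι ℝ V N} {ℓ : ι → ℝ} [P.IsCrystallographic] [P.IsReduced]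

lemma pairing_mul_pairing_cases (P : RootPairing ι ℝ V N) [P.IsCrystallographic] [P.IsReduced]
    (hℓ : P.IsSqLength ℓ) (j l : ι) :
    P.pairing j l * P.pairing l j = 0 ∨
    (P.pairing j l * P.pairing l j = 1 ∧ ℓ j = ℓ l) ∨
    (P.pairing j l * P.pairing l j = 4 ∧ ℓ j = ℓ l) ∨
    (P.pairing j l * P.pairing l j = 2 ∧ (ℓ j = 2 * ℓ l ∨ ℓ l = 2 * ℓ j)) ∨
    (P.pairing j l * P.pairing l j = 3 ∧ (ℓ j = 3 * ℓ l ∨ ℓ l = 3 * ℓ j)) := by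
  have hmem := P.pairingIn_pairingIn_mem_set_of_isCrystal_of_isRed j l
  have hmul := hℓ.mul_pairing j l
  rw [← Base.cast_pairingIn, ← Base.cast_pairingIn] at hmul ⊢
  simp only [Set.mem_insert_iff, Set.mem_singleton_iff, Prod.mk.injEq] at hmem
  have hp := hℓ.pos j
  rcases hmem with ⟨h1, h2⟩ | ⟨h1, h2⟩ | ⟨h1, h2⟩ | ⟨h1, h2⟩ | ⟨h1, h2⟩ | ⟨h1, h2⟩ | ⟨h1, h2⟩ |
    ⟨h1, h2⟩ | ⟨h1, h2⟩ | ⟨h1, h2⟩ | ⟨h1, h2⟩ | ⟨h1, h2⟩ | ⟨h1, h2⟩ <;>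
    rw [h1, h2] at hmul ⊢ <;> push_cast at hmul ⊢ <;> norm_num <;>
    first | linarith | (left; linarith) | (right; linarith)

open scoped Classical in
lemma card_filter_pairing_eq_four (P : RootPairing ι ℝ V N) [P.IsCrystallographic] [P.IsReduced]
    (l : ι) : (Finset.univ.filter fun j => P.pairing j l * P.pairing l j = 4).card = 2 := by
  have hne : l ≠ P.reflectionPerm l l := by
    intro h
    have h1 := P.pairing_reflectionPerm_self_left l l
    rw [← h, pairing_same] at h1
    norm_num at h1
  refine Eq.trans ?_ (Finset.card_pair hne)
  congr 1
  ext j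
  simp only [Finset.mem_filter, Finset.mem_univ, true_and, Finset.mem_insert,
    Finset.mem_singleton]
  constructor
  · intro h
    by_contra! hj
    have := P.pairing_mul_pairing_of_ne (k := j) (l := l) (fun hr => hj.1 (P.root.injective hr))
      (fun hr => hj.2 (P.root.injective (by
        rw [hr, root_reflectionPerm, reflection_apply_self])))
    rw [h] at this
    norm_num at this
  · rintro (rfl | rfl)
    · rw [pairing_same]; norm_num
    · rw [pairing_reflectionPerm_self_left, pairing_reflectionPerm_self_right, pairing_same]
      norm_num

open scoped Classical in
/-- The sum of the squared correlations over all pairs of roots of a crystallographic root system.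
For two roots of the same length `c = 4 cos² θ` is `0`, `1` or (for equal or opposite roots) `4`,
for two roots of different lengths it is `0` or the ratio `q` of the squared lengths; on these
values the weight is affine in `c`, so that the tight frame identity for each length evaluates
everything. -/
theorem sum_angleWeight (hℓ : P.IsSqLength ℓ) {n h g g' : ℝ} (hn : 0 < n)
    (hcard : (Fintype.card ι : ℝ) = n * h)
    (hframe : ∀ (r : ℝ) (l : ι), ∑ j with ℓ j = r, P.pairing j l * P.pairing l j =
      4 * (Finset.univ.filter fun j => ℓ j = r).card / n)
    {θ θ' : ι} (hθ : ∀ j, ℓ j ≤ ℓ θ) (hθ' : ∀ j, ℓ θ' ≤ ℓ j)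
    (hg : ∑ j, P.pairing j θ ^ 2 = 4 * g) (hg' : ∑ j, P.pairing θ' j ^ 2 = 4 * g') :
    1 / 16 * ∑ l, ∑ j, angleWeight (P.pairing j l * P.pairing l j) =
      n * (ℓ θ / ℓ θ' * g * g' + 5 * h + h ^ 2) / 72 := by
  have hsame : ∀ l, ∑ j with ℓ j = ℓ l, angleWeight (P.pairing j l * P.pairing l j) =
      4 * (Finset.univ.filter fun j => ℓ j = ℓ l).card / n / 9 + 10 / 9 := by
    intro l
    have h1 : ∀ j ∈ Finset.univ.filter (fun j => ℓ j = ℓ l),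
        angleWeight (P.pairing j l * P.pairing l j) = P.pairing j l * P.pairing l j / 9 +
          if P.pairing j l * P.pairing l j = 4 then 5 / 9 else 0 := by
      intro j hj
      rw [Finset.mem_filter] at hj
      have := hℓ.pos j
      rcases P.pairing_mul_pairing_cases hℓ j l with h | h | h | h | h
      · rw [h, angleWeight_zero]; norm_num
      · rw [h.1, angleWeight_one]; norm_num
      · rw [h.1, angleWeight_four]; norm_num
      · exfalso; rcases h.2 with h2 | h2 <;> linarith
      · exfalso; rcases h.2 with h2 | h2 <;> linarith
    rw [Finset.sum_congr rfl h1, Finset.sum_add_distrib, ← Finset.sum_div, hframe]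
    congr 1
    rw [Finset.sum_filter_of_ne, ← Finset.sum_filter, Finset.sum_const,
      card_filter_pairing_eq_four]
    · norm_num
    · intro j _ hj
      rw [ne_eq, ite_eq_right_iff, not_forall] at hj
      obtain ⟨hj, -⟩ := hj
      have := hℓ.pos j
      rcases P.pairing_mul_pairing_cases hℓ j l with h | h | h | h | h
      · linarith
      · linarith [h.1]
      · exact h.2
      · linarith [h.1]
      · linarith [h.1]
  -- Every length class contains a root that is not orthogonal to a given root.
  have hratio : ∀ k l, ℓ k = ℓ l ∨ ℓ k = 2 * ℓ l ∨ ℓ l = 2 * ℓ k ∨ ℓ k = 3 * ℓ l ∨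
      ℓ l = 3 * ℓ k := by
    intro k l
    have h1 : ∑ j with ℓ j = ℓ k, P.pairing j l * P.pairing l j ≠ 0 := by
      rw [hframe]
      have : 0 < (Finset.univ.filter fun j => ℓ j = ℓ k).card := Finset.card_pos.mpr ⟨k, by simp⟩
      positivity
    obtain ⟨j, hj, hj'⟩ := Finset.exists_ne_zero_of_sum_ne_zero h1
    rw [Finset.mem_filter] at hj
    rw [← hj.2]
    rcases P.pairing_mul_pairing_cases hℓ j l with h | h | h | h | h
    · exact absurd h hj'
    · exact Or.inl h.2
    · exact Or.inl h.2
    · tauto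
    · tauto
  have hpL := hℓ.pos θ
  have hpS := hℓ.pos θ'
  have hgsum : ∀ j, P.pairing j θ ^ 2 = P.pairing j θ * P.pairing θ j * (ℓ j / ℓ θ) := by
    intro j
    have h1 := hℓ.mul_pairing θ j
    field_simp
    linear_combination P.pairing j θ * h1
  have hgsum' : ∀ j, P.pairing θ' j ^ 2 = P.pairing j θ' * P.pairing θ' j * (ℓ θ' / ℓ j) := by
    intro j
    have h1 := hℓ.mul_pairing θ' j
    have := hℓ.pos j
    field_simp
    linear_combination (-P.pairing θ' j) * h1
  set a : ℝ := ((Finset.univ.filter fun j => ℓ j = ℓ θ).card : ℝ) with ha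
  set d : ℝ := ((Finset.univ.filter fun j => ℓ j = ℓ θ').card : ℝ) with hd
  by_cases hq : ℓ θ = ℓ θ'
  · have hall : ∀ j, ℓ j = ℓ θ := fun j => le_antisymm (hθ j) (hq ▸ hθ' j)
    have hfilt : ∀ l, (Finset.univ.filter fun j => ℓ j = ℓ l) = Finset.univ := fun l =>
      Finset.filter_true_of_mem fun j _ => by rw [hall j, hall l]
    have hfr : ∀ l, ∑ j, P.pairing j l * P.pairing l j = 4 * h := by
      intro l
      have := hframe (ℓ l) l
      rw [hfilt, Finset.card_univ, hcard] at this
      rw [this]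
      field_simp
    have h1 : g = h := by
      have : ∑ j, P.pairing j θ ^ 2 = 4 * h := by
        rw [← hfr θ]
        refine Finset.sum_congr rfl fun j _ => ?_
        rw [hgsum, hall j, div_self hpL.ne', mul_one]
      linarith
    have h2 : g' = h := by
      have : ∑ j, P.pairing θ' j ^ 2 = 4 * h := by
        rw [← hfr θ']
        refine Finset.sum_congr rfl fun j _ => ?_
        rw [hgsum', hall j, hall θ', div_self hpL.ne', mul_one]
      linarith
    have h3 : ∀ l, ∑ j, angleWeight (P.pairing j l * P.pairing l j) = 4 * h / 9 + 10 / 9 := by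
      intro l
      have := hsame l
      rw [hfilt, Finset.card_univ, hcard] at this
      rw [this]
      field_simp
    rw [Finset.sum_congr rfl fun l _ => h3 l, Finset.sum_const, Finset.card_univ, nsmul_eq_mul,
      hcard, h1, h2, hq, div_self hpS.ne']
    ring
  -- Two lengths: `q` is their squared ratio, `t` the weight of `c = q` divided by `q`.
  obtain ⟨q, t, hq1, hqt, hqL, htwo, hdiff⟩ : ∃ q t : ℝ, 1 < q ∧ 36 * t = q + 1 / q + 2 ∧
      ℓ θ = q * ℓ θ' ∧ (∀ k, ℓ k = ℓ θ ∨ ℓ k = ℓ θ') ∧ ∀ j l, ℓ j ≠ ℓ l →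
        angleWeight (P.pairing j l * P.pairing l j) = t * (P.pairing j l * P.pairing l j) := by
    have h2 : ℓ θ = 2 * ℓ θ' ∨ ℓ θ = 3 * ℓ θ' := by
      have := hθ θ'
      rcases hratio θ θ' with h | h | h | h | h
      · exact absurd h hq
      · exact Or.inl h
      · linarith
      · exact Or.inr h
      · linarith
    have htwo : ∀ k, ℓ k = ℓ θ ∨ ℓ k = ℓ θ' := by
      intro k
      have := hθ k
      have := hθ' k
      have := hℓ.pos k
      rcases h2 with h2 | h2 <;> rcases hratio θ k with h | h | h | h | h <;>
        rcases hratio k θ' with h' | h' | h' | h' | h' <;>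
        first | (left; linarith) | (right; linarith)
    rcases h2 with h2 | h2
    · refine ⟨2, 1 / 8, by norm_num, by norm_num, h2, htwo, fun j l hjl => ?_⟩
      rcases P.pairing_mul_pairing_cases hℓ j l with h | h | h | h | h
      · rw [h, angleWeight_zero]; ring
      · exact absurd h.2 hjl
      · exact absurd h.2 hjl
      · rw [h.1, angleWeight_two]; ring
      · exfalso
        rcases htwo j with h3 | h3 <;> rcases htwo l with h4 | h4 <;> rcases h.2 with h5 | h5 <;>
          rw [h3, h4] at h5 <;> linarith
    · refine ⟨3, 4 / 27, by norm_num, by norm_num, h2, htwo, fun j l hjl => ?_⟩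
      rcases P.pairing_mul_pairing_cases hℓ j l with h | h | h | h | h
      · rw [h, angleWeight_zero]; ring
      · exact absurd h.2 hjl
      · exact absurd h.2 hjl
      · exfalso
        rcases htwo j with h3 | h3 <;> rcases htwo l with h4 | h4 <;> rcases h.2 with h5 | h5 <;>
          rw [h3, h4] at h5 <;> linarith
      · rw [h.1, angleWeight_three]; ring
  have hnot : (Finset.univ.filter fun j => ¬ ℓ j = ℓ θ) =
      Finset.univ.filter fun j => ℓ j = ℓ θ' := by
    refine Finset.filter_congr fun j _ => ⟨fun hj => (htwo j).resolve_left hj, fun hj h' => ?_⟩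
    exact hq (h'.symm.trans hj)
  have hsplit : ∀ F : ι → ℝ, ∑ j, F j = ∑ j with ℓ j = ℓ θ, F j + ∑ j with ℓ j = ℓ θ', F j := by
    intro F
    rw [← hnot, Finset.sum_filter_add_sum_filter_not]
  have hdsum : ∀ r l, r ≠ ℓ l → ∑ j with ℓ j = r, angleWeight (P.pairing j l * P.pairing l j) =
      t * (4 * (Finset.univ.filter fun j => ℓ j = r).card / n) := by
    intro r l hr
    rw [← hframe r l, Finset.mul_sum]
    refine Finset.sum_congr rfl fun j hj => hdiff j l ?_
    rw [Finset.mem_filter] at hj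
    rw [hj.2]
    exact hr
  have hrowL : ∀ l ∈ Finset.univ.filter (fun j => ℓ j = ℓ θ),
      ∑ j, angleWeight (P.pairing j l * P.pairing l j) =
        4 * a / n / 9 + 10 / 9 + t * (4 * d / n) := by
    intro l hl
    rw [Finset.mem_filter] at hl
    have h1 := hsame l
    rw [hl.2] at h1
    rw [hsplit, h1, hdsum _ _ (by rw [hl.2]; exact Ne.symm hq)]
  have hrowS : ∀ l ∈ Finset.univ.filter (fun j => ℓ j = ℓ θ'),
      ∑ j, angleWeight (P.pairing j l * P.pairing l j) =
        t * (4 * a / n) + (4 * d / n / 9 + 10 / 9) := by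
    intro l hl
    rw [Finset.mem_filter] at hl
    have h1 := hsame l
    rw [hl.2] at h1
    rw [hsplit, h1, hdsum _ _ (by rw [hl.2]; exact hq)]
  have hnh : a + d = n * h := by
    rw [← hcard]
    have := hsplit fun _ => 1
    simp only [Finset.sum_const, nsmul_eq_mul, mul_one, Finset.card_univ] at this
    exact this.symm
  have hgv : n * g = a + d / q := by
    have h1 : ∑ j, P.pairing j θ ^ 2 = 4 * a / n + 4 * d / n / q := by
      rw [hsplit, ha, hd, ← hframe, ← hframe, Finset.sum_div]
      congr 1
      · refine Finset.sum_congr rfl fun j hj => ?_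
        rw [Finset.mem_filter] at hj
        rw [hgsum, hj.2, div_self hpL.ne', mul_one]
      · refine Finset.sum_congr rfl fun j hj => ?_
        rw [Finset.mem_filter] at hj
        rw [hgsum, hj.2, hqL]
        field_simp
    rw [h1] at hg
    field_simp at hg ⊢
    linarith
  have hgv' : n * g' = a / q + d := by
    have h1 : ∑ j, P.pairing θ' j ^ 2 = 4 * a / n / q + 4 * d / n := by
      rw [hsplit, ha, hd, ← hframe _ θ', ← hframe _ θ', Finset.sum_div]
      congr 1
      · refine Finset.sum_congr rfl fun j hj => ?_
        rw [Finset.mem_filter] at hj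
        rw [hgsum', hj.2, hqL]
        field_simp
      · refine Finset.sum_congr rfl fun j hj => ?_
        rw [Finset.mem_filter] at hj
        rw [hgsum', hj.2, div_self hpS.ne', mul_one]
    rw [h1] at hg'
    field_simp at hg' ⊢
    linarith
  have hh : h = (a + d) / n := by rw [hnh]; field_simp
  have hgn : g = (a + d / q) / n := by rw [← hgv]; field_simp
  have hgn' : g' = (a / q + d) / n := by rw [← hgv']; field_simp
  have ht : t = (q + 1 / q + 2) / 36 := by linarith
  have hq0 : q ≠ 0 := by positivity
  rw [hsplit, Finset.sum_congr rfl hrowL, Finset.sum_congr rfl hrowS, Finset.sum_const,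
    Finset.sum_const, nsmul_eq_mul, nsmul_eq_mul, ← ha, ← hd, hqL, mul_div_cancel_right₀ _ hpS.ne',
    hh, hgn, hgn', ht]
  field_simp
  ring

end RootPairing

open RootPairing in
/-- The variance formula for Weyl groups. -/
theorem CoxeterSystem.sum_signCorr_sq_weyl {B W : Type*} [Fintype B] [DecidableEq B] [Group W]
    [Fintype W] {M : CoxeterMatrix B} {cs : CoxeterSystem M W} (hirr : M.IsIrreducible) {h : ℕ}
    (hh : cs.IsCoxeterNumber h) {ι V N : Type} [Fintype ι] [AddCommGroup V] [Module ℝ V]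
    [AddCommGroup N] [Module ℝ N] {P : RootPairing ι ℝ V N} [P.IsCrystallographic] [P.IsReduced]
    {b : P.Base} {e : B ≃ b.support} {f : W ≃* P.weylGroup}
    (hf : ∀ i, f (cs.simple i) = weylGroup.ofIdx P (e i)) {θ θs : ι} {g g' : ℤ}
    (hθ : b.IsHighestRoot θ) (hθs : b.IsHighestShortRoot θs) (hg : b.IsDualCoxeterNumber g)
    (hg' : b.flip.IsDualCoxeterNumber g') :
    1 / 16 * ∑ α ∈ cs.allRoots, ∑ β ∈ cs.allRoots, cs.signCorr α β ^ 2 = (Fintype.card B : ℝ) *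
      (P.RootForm (P.root θ) (P.root θ) / P.RootForm (P.root θs) (P.root θs) * g * g' + 5 * h +
        (h : ℝ) ^ 2) / 72 := by
  classical
  set ℓ : ι → ℝ := fun i => P.RootForm (P.root i) (P.root i) with hℓdef
  have hℓ : P.IsSqLength ℓ := isSqLength_rootForm P
  obtain ⟨φ, hinj, hrange, hperm, hsq⟩ := exists_root_indexing hirr hℓ hf
  have hall : cs.allRoots = Finset.univ.image φ := by
    ext β
    rw [mem_allRoots, hrange]
    simp
  have hcardB : (0 : ℝ) < Fintype.card B := by
    have : Nonempty B := hirr.nonempty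
    exact_mod_cast Fintype.card_pos
  have hsum : ∑ α ∈ cs.allRoots, ∑ β ∈ cs.allRoots, cs.signCorr α β ^ 2 =
      ∑ l, ∑ j, angleWeight (P.pairing j l * P.pairing l j) := by
    rw [hall, Finset.sum_image fun _ _ _ _ h => hinj h]
    refine Finset.sum_congr rfl fun l _ => ?_
    rw [Finset.sum_image fun _ _ _ _ h => hinj h]
    refine Finset.sum_congr rfl fun j _ => ?_
    rw [signCorr_sq hirr ((hrange _).mpr ⟨l, rfl⟩) ((hrange _).mpr ⟨j, rfl⟩), hsq, mul_comm]
  obtain ⟨θ₁, hθ₁, rfl⟩ := hg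
  obtain ⟨θ₂, hθ₂, rfl⟩ := hg'
  have hmax := hθ.sqLength_le hℓ
  have hmax₁ := hθ₁.sqLength_le hℓ
  have hmin₂ : ∀ j, ℓ θ₂ ≤ ℓ j := fun j =>
    (inv_le_inv₀ (hℓ.pos j) (hℓ.pos θ₂)).mp (hθ₂.sqLength_le hℓ.flip j)
  have hθeq : ℓ θ = ℓ θ₁ := le_antisymm (hmax₁ θ) (hmax θ₁)
  have hseq : ℓ θs = ℓ θ₂ := le_antisymm (hθs.1 θ₂) (hmin₂ θs)
  have hframe : ∀ (r : ℝ) (l : ι), ∑ j with ℓ j = r, P.pairing j l * P.pairing l j =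
      4 * (Finset.univ.filter fun j => ℓ j = r).card / (Fintype.card B : ℝ) := by
    intro r l
    have := sum_cosForm_sq hirr (J := (Finset.univ.filter fun j => ℓ j = r).image φ)
      (fun β hβ => by
        obtain ⟨k, -, rfl⟩ := Finset.mem_image.mp hβ
        exact (hrange _).mpr ⟨k, rfl⟩)
      (fun i β hβ => by
        obtain ⟨k, hk, rfl⟩ := Finset.mem_image.mp hβ
        rw [hperm]
        refine Finset.mem_image_of_mem _ ?_
        rw [Finset.mem_filter] at hk ⊢
        exact ⟨Finset.mem_univ _, by rw [hℓ.reflectionPerm, hk.2]⟩)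
      ((hrange _).mpr ⟨l, rfl⟩)
    rw [Finset.sum_image fun _ _ _ _ h => hinj h, Finset.card_image_of_injective _ hinj] at this
    rw [← this]
    exact Finset.sum_congr rfl fun j _ => (hsq j l).symm
  have hcard : (Fintype.card ι : ℝ) = Fintype.card B * h := by
    have h1 := cs.card_allRoots
    rw [cs.two_mul_card_posRoots hirr hh, hall, Finset.card_image_of_injective _ hinj,
      Finset.card_univ] at h1
    exact_mod_cast h1
  have key := sum_angleWeight hℓ hcardB hcard hframe hmax₁ hmin₂
    (hθ₁.sum_pairing_sq hℓ) (hθ₂.sum_pairing_sq hℓ.flip)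
  rw [hsum, key]
  change _ = _ * (ℓ θ / ℓ θs * _ * _ + _ + _) / 72
  rw [hθeq, hseq]

namespace CoxeterSystem

variable {B W : Type*} [Fintype B] [DecidableEq B] [Group W] [Fintype W] {M : CoxeterMatrix B}
  {cs : CoxeterSystem M W}

/-- It suffices to know the sums of the squared correlations with the simple roots. -/
lemma sum_signCorr_sq_of_simple {C : ℝ}
    (hC : ∀ i, ∑ β ∈ cs.posRoots, cs.signCorr (Pi.single i 1) β ^ 2 = C) :
    1 / 16 * ∑ α ∈ cs.allRoots, ∑ β ∈ cs.allRoots, cs.signCorr α β ^ 2 =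
      cs.posRoots.card * C / 4 := by
  have h1 : ∀ α ∈ cs.allRoots, ∑ β ∈ cs.allRoots, cs.signCorr α β ^ 2 = 2 * C := by
    intro α hα
    obtain ⟨w, i, rfl⟩ := cs.mem_allRoots.mp hα
    rw [← cs.sum_allRoots_geometricRep w]
    simp only [signCorr_geometricRep]
    rw [cs.sum_allRoots fun β hβ => by rw [cs.signCorr_neg_right hβ, neg_sq], hC]
  rw [Finset.sum_congr rfl h1, Finset.sum_const, card_allRoots, nsmul_eq_mul]
  push_cast
  ring

end CoxeterSystem

/-! ### The types `H₃` and `H₄` -/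

open scoped goldenRatio

/-- The real number `a + b φ` encoded by the pair `(a, b)`, with `φ` the golden ratio. -/
def goldenVal : ℤ × ℤ →+ ℝ where
  toFun x := x.1 + x.2 * φ
  map_zero' := by simp
  map_add' x y := by push_cast [Prod.fst_add, Prod.snd_add]; ring

lemma goldenVal_apply (x : ℤ × ℤ) : goldenVal x = x.1 + x.2 * φ := rfl

lemma goldenVal_injective : Function.Injective goldenVal := by
  rw [injective_iff_map_eq_zero]
  rintro ⟨a, b⟩ h
  rw [goldenVal_apply] at h
  have hb : b = 0 := by
    by_contra hb
    refine (Real.goldenRatio_irrational.intCast_mul hb).ne_int (-a) ?_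
    push_cast
    linarith
  subst hb
  simpa using h

/-- Multiplication in `ℤ[φ]`. -/
def goldenMul (x y : ℤ × ℤ) : ℤ × ℤ := (x.1 * y.1 + x.2 * y.2, x.1 * y.2 + x.2 * y.1 + x.2 * y.2)

lemma goldenVal_mul (x y : ℤ × ℤ) : goldenVal (goldenMul x y) = goldenVal x * goldenVal y := by
  simp only [goldenVal_apply, goldenMul]
  push_cast
  linear_combination (-(x.2 : ℝ) * y.2) * Real.goldenRatio_sq

section RootList

variable {n : ℕ} (T : Fin n → Fin n → ℤ × ℤ)

/-- The `k`-th row of the matrix `T` over `ℤ[φ]`, as a linear form. -/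
def goldenForm (k : Fin n) (v : Fin n → ℤ × ℤ) : ℤ × ℤ := ∑ j, goldenMul (T k j) (v j)

/-- The reflection in the `k`-th simple root, in coordinates over `ℤ[φ]`. -/
def goldenRefl (k : Fin n) (v : Fin n → ℤ × ℤ) : Fin n → ℤ × ℤ :=
  fun j => if j = k then v k - goldenForm T k v else v j

/-- The `k`-th simple root, in coordinates over `ℤ[φ]`. -/
def goldenSingle (k : Fin n) : Fin n → ℤ × ℤ := fun j => if j = k then (1, 0) else (0, 0)

/-- Every entry of the list is a simple root or a simple reflection of a later entry. -/
def IsDescending : List (Fin n → ℤ × ℤ) → Prop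
  | [] => True
  | v :: L => ((∃ k, v = goldenSingle k) ∨ ∃ k, goldenRefl T k v ∈ L) ∧ IsDescending L

instance decidableIsDescending : (L : List (Fin n → ℤ × ℤ)) → Decidable (IsDescending T L)
  | [] => inferInstanceAs (Decidable True)
  | _ :: L =>
    have := decidableIsDescending L
    inferInstanceAs (Decidable (_ ∧ _))

/-- The weight `225 (1 - 2 θ / π) ^ 2`, where `2 cos θ` is one of the numbers `0`, `±1`, `±2`,
`±φ`, `±φ⁻¹` (with `φ⁻¹ = φ - 1`). -/
def goldenWeight (x : ℤ × ℤ) : ℕ :=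
  if x = (0, 0) then 0
  else if x = (1, 0) ∨ x = (-1, 0) then 25
  else if x = (0, 1) ∨ x = (0, -1) then 81
  else if x = (-1, 1) ∨ x = (1, -1) then 9
  else 225

/-- `L` consists of the positive roots of the Coxeter system with Gram matrix `T` (normalised so
that the diagonal entries are `2`): it contains the simple roots, is stable under the simple
reflections up to the negatives of the simple roots, and is obtained from the simple roots by
simple reflections; `C` is the sum of the weights of each row. -/
def IsRootList (L : List (Fin n → ℤ × ℤ)) (C : ℕ) : Prop :=
  L.Nodup ∧ (∀ k, goldenSingle k ∈ L) ∧ IsDescending T L ∧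
    (∀ v ∈ L, ∀ k, v = goldenSingle k ∨ goldenRefl T k v ∈ L) ∧
    (∀ v ∈ L, ∀ k, 0 ≤ (v k).1 ∧ 0 ≤ (v k).2) ∧
    (∀ v ∈ L, ∀ k, goldenForm T k v ∈ [(0, 0), (1, 0), (-1, 0), (0, 1), (0, -1), (-1, 1),
      (1, -1), (2, 0), (-2, 0)]) ∧
    ∀ k, (L.map fun v => goldenWeight (goldenForm T k v)).sum = C

instance (L : List (Fin n → ℤ × ℤ)) (C : ℕ) : Decidable (IsRootList T L C) := by
  unfold IsRootList; infer_instance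

end RootList

/-- The Gram matrix of type `H₃`, with entries in `ℤ[φ]`. -/
def gramH3 : Fin 3 → Fin 3 → ℤ × ℤ :=
  ![![(2, 0), (-1, 0), (0, 0)], ![(-1, 0), (2, 0), (0, -1)], ![(0, 0), (0, -1), (2, 0)]]

/-- The Gram matrix of type `H₄`, with entries in `ℤ[φ]`. -/
def gramH4 : Fin 4 → Fin 4 → ℤ × ℤ :=
  ![![(2, 0), (-1, 0), (0, 0), (0, 0)], ![(-1, 0), (2, 0), (-1, 0), (0, 0)],
    ![(0, 0), (-1, 0), (2, 0), (0, -1)], ![(0, 0), (0, 0), (0, -1), (2, 0)]]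

/-- The 15 positive roots of type `H₃`. -/
def rootsH3 : List (Fin 3 → ℤ × ℤ) :=
  [![(0, 1), (0, 2), (1, 1)], ![(0, 1), (1, 1), (1, 1)], ![(1, 0), (1, 1), (1, 1)],
    ![(0, 1), (1, 1), (0, 1)], ![(0, 1), (0, 1), (0, 1)], ![(1, 0), (1, 1), (0, 1)],
    ![(0, 1), (0, 1), (1, 0)], ![(0, 0), (0, 1), (0, 1)], ![(1, 0), (1, 0), (0, 1)],
    ![(0, 0), (0, 1), (1, 0)], ![(0, 0), (1, 0), (0, 1)], ![(1, 0), (1, 0), (0, 0)],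
    ![(0, 0), (0, 0), (1, 0)], ![(0, 0), (1, 0), (0, 0)], ![(1, 0), (0, 0), (0, 0)]]

/-- The 60 positive roots of type `H₄`. -/
def rootsH4 : List (Fin 4 → ℤ × ℤ) :=
  [![(0, 2), (1, 3), (2, 4), (2, 3)], ![(1, 1), (1, 3), (2, 4), (2, 3)],
    ![(1, 1), (2, 2), (2, 4), (2, 3)], ![(1, 1), (2, 2), (3, 3), (2, 3)],
    ![(1, 1), (2, 2), (3, 3), (1, 3)], ![(1, 1), (2, 2), (2, 3), (1, 3)],
    ![(1, 1), (1, 2), (2, 3), (1, 3)], ![(1, 1), (2, 2), (2, 3), (2, 2)],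
    ![(0, 1), (1, 2), (2, 3), (1, 3)], ![(1, 1), (1, 2), (2, 3), (2, 2)],
    ![(0, 1), (1, 2), (2, 3), (2, 2)], ![(1, 1), (1, 2), (1, 3), (2, 2)],
    ![(0, 1), (1, 2), (1, 3), (2, 2)], ![(1, 1), (1, 2), (1, 3), (1, 2)],
    ![(1, 1), (1, 2), (2, 2), (1, 2)], ![(0, 1), (0, 2), (1, 3), (2, 2)],
    ![(0, 1), (1, 2), (1, 3), (1, 2)], ![(1, 1), (2, 1), (2, 2), (1, 2)],
    ![(0, 1), (1, 2), (2, 2), (1, 2)], ![(0, 1), (0, 2), (1, 3), (1, 2)],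
    ![(1, 0), (2, 1), (2, 2), (1, 2)], ![(0, 1), (1, 1), (2, 2), (1, 2)],
    ![(0, 1), (0, 2), (1, 2), (1, 2)], ![(1, 0), (1, 1), (2, 2), (1, 2)],
    ![(0, 1), (1, 1), (1, 2), (1, 2)], ![(0, 1), (0, 2), (1, 2), (1, 1)],
    ![(0, 1), (0, 2), (0, 2), (1, 1)], ![(1, 0), (1, 1), (1, 2), (1, 2)],
    ![(0, 1), (1, 1), (1, 2), (1, 1)], ![(0, 1), (0, 1), (0, 2), (1, 1)],
    ![(1, 0), (1, 1), (1, 2), (1, 1)], ![(0, 1), (1, 1), (1, 1), (1, 1)],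
    ![(0, 0), (0, 1), (0, 2), (1, 1)], ![(0, 1), (0, 1), (1, 1), (1, 1)],
    ![(1, 0), (1, 1), (1, 1), (1, 1)], ![(0, 1), (1, 1), (1, 1), (0, 1)],
    ![(0, 0), (0, 1), (1, 1), (1, 1)], ![(0, 1), (0, 1), (1, 1), (0, 1)],
    ![(1, 0), (1, 0), (1, 1), (1, 1)], ![(1, 0), (1, 1), (1, 1), (0, 1)],
    ![(0, 1), (0, 1), (0, 1), (0, 1)], ![(0, 0), (1, 0), (1, 1), (1, 1)],
    ![(0, 0), (0, 1), (1, 1), (0, 1)], ![(1, 0), (1, 0), (1, 1), (0, 1)],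
    ![(0, 1), (0, 1), (0, 1), (1, 0)], ![(0, 0), (0, 1), (0, 1), (0, 1)],
    ![(0, 0), (1, 0), (1, 1), (0, 1)], ![(1, 0), (1, 0), (1, 0), (0, 1)],
    ![(0, 0), (0, 1), (0, 1), (1, 0)], ![(0, 0), (0, 0), (0, 1), (0, 1)],
    ![(0, 0), (1, 0), (1, 0), (0, 1)], ![(1, 0), (1, 0), (1, 0), (0, 0)],
    ![(0, 0), (0, 0), (0, 1), (1, 0)], ![(0, 0), (0, 0), (1, 0), (0, 1)],
    ![(0, 0), (1, 0), (1, 0), (0, 0)], ![(1, 0), (1, 0), (0, 0), (0, 0)],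
    ![(0, 0), (0, 0), (0, 0), (1, 0)], ![(0, 0), (0, 0), (1, 0), (0, 0)],
    ![(0, 0), (1, 0), (0, 0), (0, 0)], ![(1, 0), (0, 0), (0, 0), (0, 0)]]

lemma isRootList_H3 : IsRootList gramH3 rootsH3 685 := by decide +kernel

lemma isRootList_H4 : IsRootList gramH4 rootsH4 1805 := by decide +kernel


lemma angleWeight_goldenVal {x : ℤ × ℤ} (hx : x ∈ [(0, 0), (1, 0), (-1, 0), (0, 1), (0, -1),
    (-1, 1), (1, -1), (2, 0), (-2, 0)]) :
    angleWeight (goldenVal x ^ 2) = goldenWeight x / 225 := by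
  have hpi := Real.pi_pos
  have hcos : Real.cos (Real.pi / 5) = φ / 2 := by
    rw [Real.cos_pi_div_five, Real.goldenRatio]
    ring
  have hφ : angleWeight (φ ^ 2) = 81 / 225 := by
    rw [angleWeight_eq (t := Real.pi / 5) (by positivity) (by linarith)
      (by rw [Real.sqrt_sq Real.goldenRatio_pos.le, hcos])]
    field_simp
    norm_num
  rw [Real.goldenRatio_sq] at hφ
  -- `φ - 1 = 2 cos (2 π / 5)`
  have hψ : angleWeight ((φ - 1) ^ 2) = 9 / 225 := by
    rw [angleWeight_eq (t := 2 * (Real.pi / 5)) (by positivity) (by linarith)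
      (by
        rw [Real.sqrt_sq (sub_nonneg.mpr Real.one_lt_goldenRatio.le), Real.cos_two_mul, hcos]
        linear_combination (1 / 2) * Real.goldenRatio_sq)]
    field_simp
    norm_num
  have h4 : angleWeight (2 ^ 2) = 1 := by
    rw [← angleWeight_four]; norm_num
  simp only [List.mem_cons, List.not_mem_nil, or_false] at hx
  rcases hx with rfl | rfl | rfl | rfl | rfl | rfl | rfl | rfl | rfl
  · simp [goldenVal_apply, goldenWeight, angleWeight_zero]
  · norm_num [goldenVal_apply, goldenWeight, angleWeight_one]
  · norm_num [goldenVal_apply, goldenWeight, angleWeight_one]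
  · simp [goldenVal_apply, goldenWeight, hφ]
  · simp [goldenVal_apply, goldenWeight, hφ]
  · simp only [goldenVal_apply, goldenWeight]
    rw [show ((-1 : ℤ) : ℝ) + ((1 : ℤ) : ℝ) * φ = φ - 1 by push_cast; ring, hψ]
    norm_num
  · simp only [goldenVal_apply, goldenWeight]
    rw [show (((1 : ℤ) : ℝ) + ((-1 : ℤ) : ℝ) * φ) ^ 2 = (φ - 1) ^ 2 by push_cast; ring, hψ]
    norm_num
  · simp [goldenVal_apply, goldenWeight, h4]
  · simp [goldenVal_apply, goldenWeight, h4]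

namespace CoxeterSystem

variable {B W : Type*} [Fintype B] [DecidableEq B] [Group W] [Fintype W] {M : CoxeterMatrix B}
  {cs : CoxeterSystem M W} {n : ℕ} {e : B ≃ Fin n} {T : Fin n → Fin n → ℤ × ℤ}

/-- The vector of the geometric representation with the given coordinates in `ℤ[φ]`. -/
def goldenVec (e : B ≃ Fin n) (v : Fin n → ℤ × ℤ) : B → ℝ := fun i => goldenVal (v (e i))

lemma goldenVec_injective (e : B ≃ Fin n) : Function.Injective (goldenVec e) := by
  intro v w h
  funext k
  have := congrFun h (e.symm k)
  simp only [goldenVec, Equiv.apply_symm_apply] at this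
  exact goldenVal_injective this

lemma goldenVec_single (i : B) : goldenVec e (goldenSingle (e i)) = Pi.single i 1 := by
  ext j
  by_cases h : j = i <;> simp [goldenVec, goldenSingle, h, goldenVal_apply]

lemma simpleForm_goldenVec (hT : ∀ i j, -2 * Real.cos (Real.pi / M i j) = goldenVal (T (e i) (e j)))
    (i : B) (v : Fin n → ℤ × ℤ) :
    M.simpleForm i (goldenVec e v) = goldenVal (goldenForm T (e i) v) := by
  rw [CoxeterMatrix.simpleForm_apply, goldenForm, map_sum, ← e.sum_comp]
  refine Finset.sum_congr rfl fun j _ => ?_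
  rw [goldenVal_mul, hT, goldenVec]

lemma geometricRep_goldenVec
    (hT : ∀ i j, -2 * Real.cos (Real.pi / M i j) = goldenVal (T (e i) (e j)))
    (i : B) (v : Fin n → ℤ × ℤ) :
    cs.geometricRep (cs.simple i) (goldenVec e v) = goldenVec e (goldenRefl T (e i) v) := by
  rw [geometricRep_simple_apply, simpleForm_goldenVec hT]
  ext j
  by_cases h : j = i
  · subst h
    simp [goldenVec, goldenRefl]
  · simp [goldenVec, goldenRefl, h]

lemma goldenVec_mem_roots
    (hT : ∀ i j, -2 * Real.cos (Real.pi / M i j) = goldenVal (T (e i) (e j)))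
    {L : List (Fin n → ℤ × ℤ)} (hL : IsDescending T L) : ∀ v ∈ L, goldenVec e v ∈ cs.roots := by
  induction L with
  | nil => simp
  | cons u L ih =>
    obtain ⟨hu, hL⟩ := hL
    intro v hv
    rw [List.mem_cons] at hv
    rcases hv with rfl | hv
    · rcases hu with ⟨k, rfl⟩ | ⟨k, hk⟩
      · obtain ⟨i, rfl⟩ := e.surjective k
        rw [goldenVec_single]
        exact cs.single_mem_roots i
      · obtain ⟨i, rfl⟩ := e.surjective k
        have := geometricRep_mem_roots (cs.simple i) (ih hL _ hk)
        rwa [← geometricRep_goldenVec (cs := cs) hT, ← geometricRep_mul_apply, simple_mul_simple_self,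
          geometricRep_one_apply] at this
    · exact ih hL v hv

/-- The list and its negatives form a set of roots that contains the simple roots and is stable
under the simple reflections, so it exhausts the roots. -/
lemma posRoots_eq_of_isRootList
    (hT : ∀ i j, -2 * Real.cos (Real.pi / M i j) = goldenVal (T (e i) (e j)))
    {L : List (Fin n → ℤ × ℤ)} {C : ℕ} (hL : IsRootList T L C) :
    cs.posRoots = (L.toFinset.image (goldenVec e) : Finset (B → ℝ)) := by
  obtain ⟨-, hsimple, hdesc, hclosed, hnonneg, -, -⟩ := hL
  have hpos : ∀ v ∈ L, goldenVec e v ∈ cs.positiveRoots := by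
    refine fun v hv => ⟨goldenVec_mem_roots hT hdesc v hv, fun i => ?_⟩
    have := hnonneg v hv (e i)
    rw [goldenVec, goldenVal_apply]
    have h1 : (0 : ℝ) ≤ (v (e i)).1 := by exact_mod_cast this.1
    have h2 : (0 : ℝ) ≤ (v (e i)).2 := by exact_mod_cast this.2
    have := Real.goldenRatio_pos
    positivity
  have hroots : ∀ β ∈ cs.roots, ∃ v ∈ L, β = goldenVec e v ∨ β = -goldenVec e v := by
    rintro β ⟨w, i, rfl⟩
    induction w using cs.simple_induction_left with
    | one => exact ⟨_, hsimple (e i), Or.inl (by rw [geometricRep_one_apply, goldenVec_single])⟩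
    | mul_simple_left w j ih =>
      obtain ⟨v, hv, h⟩ := ih
      rw [geometricRep_mul_apply]
      rcases hclosed v hv (e j) with h1 | h1
      · refine ⟨v, hv, ?_⟩
        have h2 : cs.geometricRep (cs.simple j) (goldenVec e v) = -goldenVec e v := by
          rw [h1, goldenVec_single, geometricRep_simple_self]
        rcases h with h | h <;> rw [h]
        · exact Or.inr h2
        · rw [map_neg, h2, neg_neg]
          exact Or.inl rfl
      · refine ⟨_, h1, ?_⟩
        rw [← geometricRep_goldenVec (cs := cs) hT]
        rcases h with h | h <;> rw [h]
        · exact Or.inl rfl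
        · rw [map_neg]
          exact Or.inr rfl
  ext β
  simp only [mem_posRoots, Finset.mem_image, List.mem_toFinset]
  constructor
  · intro hβ
    obtain ⟨v, hv, h | h⟩ := hroots β hβ.1
    · exact ⟨v, hv, h.symm⟩
    · exact absurd (hpos v hv) (by
        have := neg_notMem_positiveRoots hβ
        rwa [h, neg_neg] at this)
  · rintro ⟨v, hv, rfl⟩
    exact hpos v hv

lemma sum_signCorr_sq_of_isRootList (hirr : M.IsIrreducible)
    (hT : ∀ i j, -2 * Real.cos (Real.pi / M i j) = goldenVal (T (e i) (e j)))
    {L : List (Fin n → ℤ × ℤ)} {C : ℕ} (hL : IsRootList T L C) :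
    cs.posRoots.card = L.length ∧
    1 / 16 * ∑ α ∈ cs.allRoots, ∑ β ∈ cs.allRoots, cs.signCorr α β ^ 2 =
      L.length * C / 900 := by
  have hpos := posRoots_eq_of_isRootList (cs := cs) hT hL
  have hcard : cs.posRoots.card = L.length := by
    rw [hpos, Finset.card_image_of_injective _ (goldenVec_injective e),
      List.toFinset_card_of_nodup hL.1]
  refine ⟨hcard, ?_⟩
  have hC : ∀ i, ∑ β ∈ cs.posRoots, cs.signCorr (Pi.single i 1) β ^ 2 = C / 225 := by
    intro i
    have h1 : ∀ v ∈ L.toFinset, cs.signCorr (Pi.single i 1) (goldenVec e v) ^ 2 =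
        (goldenWeight (goldenForm T (e i) v) : ℝ) / 225 := by
      intro v hv
      rw [List.mem_toFinset] at hv
      rw [signCorr_sq hirr (cs.single_mem_roots i) (goldenVec_mem_roots hT hL.2.2.1 v hv),
        CoxeterMatrix.cosForm_single, simpleForm_goldenVec hT,
        angleWeight_goldenVal (hL.2.2.2.2.2.1 v hv (e i))]
    rw [hpos, Finset.sum_image fun _ _ _ _ h => goldenVec_injective e h, Finset.sum_congr rfl h1,
      ← Finset.sum_div, List.sum_toFinset _ hL.1, ← hL.2.2.2.2.2.2 (e i)]
    rw [Nat.cast_list_sum, List.map_map]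
    rfl
  rw [sum_signCorr_sq_of_simple hC, hcard]
  ring

theorem sum_signCorr_sq_H3 (hirr : M.IsIrreducible) {h : ℕ} (hh : cs.IsCoxeterNumber h)
    (e : B ≃ Fin 3) (hM : M.reindex e = CoxeterMatrix.H₃) :
    1 / 16 * ∑ α ∈ cs.allRoots, ∑ β ∈ cs.allRoots, cs.signCorr α β ^ 2 =
      (Fintype.card B : ℝ) * (124 + 5 * h + (h : ℝ) ^ 2) / 72 := by
  have hT : ∀ i j, -2 * Real.cos (Real.pi / M i j) = goldenVal (gramH3 (e i) (e j)) := by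
    intro i j
    have h1 : M i j = (!![1, 3, 2; 3, 1, 5; 2, 5, 1] : Matrix (Fin 3) (Fin 3) ℕ) (e i) (e j) := by
      have : CoxeterMatrix.H₃ (e i) (e j) = M i j := by
        rw [← hM, CoxeterMatrix.reindex_apply, e.symm_apply_apply, e.symm_apply_apply]
      exact this.symm
    rw [h1]
    generalize e i = k
    generalize e j = l
    have h5 : 2 * ((1 + √5) / 4) = φ := by rw [Real.goldenRatio]; ring
    fin_cases k <;> fin_cases l <;>
      simp [gramH3, goldenVal_apply] <;> linarith
  obtain ⟨h1, h2⟩ := sum_signCorr_sq_of_isRootList (cs := cs) hirr hT isRootList_H3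
  have hcard : Fintype.card B = 3 := by rw [Fintype.card_congr e, Fintype.card_fin]
  have h3 := cs.two_mul_card_posRoots hirr hh
  have hlen : rootsH3.length = 15 := rfl
  rw [h1, hcard, hlen] at h3
  have hh' : h = 10 := by omega
  rw [h2, hcard, hh', hlen]
  norm_num

theorem sum_signCorr_sq_H4 (hirr : M.IsIrreducible) {h : ℕ} (hh : cs.IsCoxeterNumber h)
    (e : B ≃ Fin 4) (hM : M.reindex e = CoxeterMatrix.H₄) :
    1 / 16 * ∑ α ∈ cs.allRoots, ∑ β ∈ cs.allRoots, cs.signCorr α β ^ 2 =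
      (Fintype.card B : ℝ) * (1116 + 5 * h + (h : ℝ) ^ 2) / 72 := by
  have hT : ∀ i j, -2 * Real.cos (Real.pi / M i j) = goldenVal (gramH4 (e i) (e j)) := by
    intro i j
    have h1 : M i j =
        (!![1, 3, 2, 2; 3, 1, 3, 2; 2, 3, 1, 5; 2, 2, 5, 1] :
          Matrix (Fin 4) (Fin 4) ℕ) (e i) (e j) := by
      have : CoxeterMatrix.H₄ (e i) (e j) = M i j := by
        rw [← hM, CoxeterMatrix.reindex_apply, e.symm_apply_apply, e.symm_apply_apply]
      exact this.symm
    rw [h1]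
    generalize e i = k
    generalize e j = l
    have h5 : 2 * ((1 + √5) / 4) = φ := by rw [Real.goldenRatio]; ring
    fin_cases k <;> fin_cases l <;>
      simp [gramH4, goldenVal_apply] <;> linarith
  obtain ⟨h1, h2⟩ := sum_signCorr_sq_of_isRootList (cs := cs) hirr hT isRootList_H4
  have hcard : Fintype.card B = 4 := by rw [Fintype.card_congr e, Fintype.card_fin]
  have h3 := cs.two_mul_card_posRoots hirr hh
  have hlen : rootsH4.length = 60 := rfl
  rw [h1, hcard, hlen] at h3
  have hh' : h = 30 := by omega
  rw [h2, hcard, hh', hlen]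
  norm_num

end CoxeterSystem

/-! ### The dihedral types -/

namespace CoxeterSystem

variable {B W : Type*} [Fintype B] [DecidableEq B] [Group W] [Fintype W] {M : CoxeterMatrix B}
  {cs : CoxeterSystem M W}

/-- In rank two with `M i j = m`, the root
`(sin ((k + 1) π / m) α_i + sin (k π / m) α_j) / sin (π / m)` at angle `k π / m` from `α_i`; thus `k = 0` gives `α_i` and `k = m - 1` gives `α_j`. -/
def dihedralVec (m : ℕ) (i j : B) (k : ℤ) : B → ℝ :=
  (Real.sin ((k + 1) * (Real.pi / m)) / Real.sin (Real.pi / m)) • Pi.single i 1 +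
    (Real.sin (k * (Real.pi / m)) / Real.sin (Real.pi / m)) • Pi.single j 1

variable {m : ℕ} {i j : B}

lemma sin_pi_div_pos (hm : 2 ≤ m) : 0 < Real.sin (Real.pi / m) := by
  have hm' : (2 : ℝ) ≤ m := by exact_mod_cast hm
  have := Real.pi_pos
  exact Real.sin_pos_of_pos_of_lt_pi (by positivity) (div_lt_self this (by linarith))

lemma dihedralVec_zero (hm : 2 ≤ m) : dihedralVec m i j 0 = Pi.single i 1 := by
  have := (sin_pi_div_pos hm).ne'
  simp [dihedralVec, this]

lemma dihedralVec_add_self (hm : 2 ≤ m) (k : ℤ) :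
    dihedralVec m i j (k + m) = -dihedralVec m i j k := by
  have hm' : (m : ℝ) ≠ 0 := by positivity
  have h1 : ((k + m : ℤ) + 1 : ℝ) * (Real.pi / m) = (k + 1) * (Real.pi / m) + Real.pi := by
    push_cast; field_simp; ring
  have h2 : ((k + m : ℤ) : ℝ) * (Real.pi / m) = k * (Real.pi / m) + Real.pi := by
    push_cast; field_simp
  rw [dihedralVec, h1, h2, Real.sin_add_pi, Real.sin_add_pi, dihedralVec]
  module

lemma dihedralVec_sub_one (hm : 2 ≤ m) : dihedralVec m i j (m - 1) = Pi.single j 1 := by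
  have h := dihedralVec_add_self (i := i) (j := j) hm (-1)
  rw [neg_add_eq_sub] at h
  rw [h]
  have := (sin_pi_div_pos hm).ne'
  simp [dihedralVec, this]

lemma cosForm_dihedralVec (hM : M i j = m) (hm : 2 ≤ m) (k : ℤ) :
    M.cosForm (Pi.single i 1) (dihedralVec m i j k) = 2 * Real.cos (k * (Real.pi / m)) := by
  have hs := (sin_pi_div_pos hm).ne'
  rw [CoxeterMatrix.cosForm_single, dihedralVec, map_add, map_smul, map_smul,
    CoxeterMatrix.simpleForm_self, CoxeterMatrix.simpleForm_single, hM, add_mul, one_mul,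
    Real.sin_add]
  simp only [smul_eq_mul]
  field_simp
  ring

lemma geometricRep_dihedralVec (hM : M i j = m) (hm : 2 ≤ m) (k : ℤ) :
    cs.geometricRep (cs.simple i) (dihedralVec m i j k) = dihedralVec m i j (m - k) := by
  have hs := (sin_pi_div_pos hm).ne'
  rw [← sub_add_cancel ((m : ℤ) - k) m, dihedralVec_add_self hm, geometricRep_simple_apply,
    ← CoxeterMatrix.cosForm_single, cosForm_dihedralVec hM hm]
  have h1 : ((((m : ℤ) - k - m : ℤ) : ℝ) + 1) * (Real.pi / m) =
      -(k * (Real.pi / m)) + Real.pi / m := by push_cast; ring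
  have h2 : (((m : ℤ) - k - m : ℤ) : ℝ) * (Real.pi / m) = -(k * (Real.pi / m)) := by
    push_cast; ring
  rw [dihedralVec, dihedralVec, h1, h2, add_mul, one_mul, Real.sin_add, Real.sin_add, Real.sin_neg,
    Real.cos_neg]
  match_scalars
  · field_simp
    ring
  · field_simp

lemma dihedralVec_swap (hm : 2 ≤ m) (k : ℤ) :
    dihedralVec m i j k = dihedralVec m j i (m - 1 - k) := by
  have hm' : (m : ℝ) ≠ 0 := by positivity
  have h1 : (((m : ℤ) - 1 - k : ℤ) + 1 : ℝ) * (Real.pi / m) = Real.pi - k * (Real.pi / m) := by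
    push_cast; field_simp; ring
  have h2 : (((m : ℤ) - 1 - k : ℤ) : ℝ) * (Real.pi / m) = Real.pi - (k + 1) * (Real.pi / m) := by
    push_cast; field_simp; ring
  rw [dihedralVec, dihedralVec, h1, h2, Real.sin_pi_sub, Real.sin_pi_sub, add_comm]

lemma geometricRep_dihedralVec' (hM : M i j = m) (hm : 2 ≤ m) (k : ℤ) :
    cs.geometricRep (cs.simple j) (dihedralVec m i j k) = dihedralVec m i j (m - 2 - k) := by
  rw [dihedralVec_swap hm, geometricRep_dihedralVec (by rw [M.symmetric, hM]) hm,
    dihedralVec_swap hm]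
  congr 1
  ring

lemma geometricRep_mul_dihedralVec (hM : M i j = m) (hm : 2 ≤ m) (k : ℤ) :
    cs.geometricRep (cs.simple i * cs.simple j) (dihedralVec m i j k) =
      dihedralVec m i j (k + 2) := by
  rw [geometricRep_mul_apply, geometricRep_dihedralVec' hM hm, geometricRep_dihedralVec hM hm]
  congr 1
  ring

lemma dihedralVec_mem_roots (hM : M i j = m) (hm : 2 ≤ m) (k : ℕ) :
    dihedralVec m i j k ∈ cs.roots ∧ dihedralVec m i j (k + 1) ∈ cs.roots := by
  have hstep : ∀ k, dihedralVec m i j k ∈ cs.roots → dihedralVec m i j (k + 2) ∈ cs.roots := by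
    intro k hk
    have := geometricRep_mem_roots (cs.simple i * cs.simple j) hk
    rwa [geometricRep_mul_dihedralVec hM hm] at this
  induction k with
  | zero =>
    rw [Nat.cast_zero, dihedralVec_zero hm]
    refine ⟨cs.single_mem_roots i, ?_⟩
    have h1 : dihedralVec m i j (-1) ∈ cs.roots := by
      have h2 : dihedralVec m i j (-1) = -Pi.single j 1 := by
        rw [← dihedralVec_sub_one (i := i) hm, eq_neg_iff_add_eq_zero, ← neg_add_eq_sub,
          dihedralVec_add_self hm, add_neg_cancel]
      rw [h2]
      exact neg_mem_roots (cs.single_mem_roots j)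
    have := hstep _ h1
    norm_num at this
    simpa using this
  | succ k ih =>
    push_cast
    refine ⟨ih.2, ?_⟩
    have := hstep _ ih.1
    rwa [add_assoc, one_add_one_eq_two]

lemma dihedralVec_nonneg (hm : 2 ≤ m) {k : ℕ} (hk : k < m) : 0 ≤ dihedralVec m i j k := by
  have hs := sin_pi_div_pos hm
  have hm' : (0 : ℝ) < m := by positivity
  have hsin : ∀ l : ℕ, l ≤ m → 0 ≤ Real.sin (l * (Real.pi / m)) := by
    intro l hl
    have hl' : (l : ℝ) ≤ m := by exact_mod_cast hl
    have := Real.pi_pos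
    refine Real.sin_nonneg_of_nonneg_of_le_pi (by positivity) ?_
    rw [← mul_div_assoc, div_le_iff₀ hm']
    nlinarith
  have h1 := hsin (k + 1) hk
  have h2 := hsin k hk.le
  rw [Nat.cast_add_one] at h1
  have h3 : ∀ l : B, (0 : B → ℝ) ≤ Pi.single l 1 := fun l => by simp [Pi.single_nonneg]
  exact add_nonneg (smul_nonneg (div_nonneg h1 hs.le) (h3 i))
    (smul_nonneg (div_nonneg h2 hs.le) (h3 j))

lemma dihedralVec_injOn (hM : M i j = m) (hm : 2 ≤ m) :
    Set.InjOn (fun k : ℕ => dihedralVec m i j k) (Finset.range m : Set ℕ) := by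
  intro k hk l hl h
  have hm' : (0 : ℝ) < m := by positivity
  have hpi := Real.pi_pos
  have hle : ∀ a ∈ (Finset.range m : Set ℕ),
      ((a : ℤ) : ℝ) * (Real.pi / m) ∈ Set.Icc 0 Real.pi := by
    intro a ha
    rw [Finset.coe_range, Set.mem_Iio] at ha
    have ha' : (a : ℝ) ≤ m := by exact_mod_cast ha.le
    push_cast
    refine ⟨by positivity, ?_⟩
    rw [← mul_div_assoc, div_le_iff₀ hm']
    nlinarith
  have h1 := congrArg (M.cosForm (Pi.single i 1)) h
  simp only [cosForm_dihedralVec hM hm] at h1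
  have h2 := Real.injOn_cos (hle k hk) (hle l hl) (by linarith)
  have h3 : (0 : ℝ) < Real.pi / m := by positivity
  have h4 := mul_right_cancel₀ h3.ne' h2
  exact_mod_cast h4

/-- The positive roots in rank two are the vectors at angles `k π / m`, `0 ≤ k < m`. -/
lemma posRoots_eq_dihedralVec (hM : M i j = m) (hm : 2 ≤ m) (hB : ∀ k, k = i ∨ k = j) :
    cs.posRoots = (Finset.range m).image fun k : ℕ => dihedralVec m i j k := by
  have hpos : ∀ k < m, dihedralVec m i j (k : ℕ) ∈ cs.positiveRoots := fun k hk =>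
    ⟨(dihedralVec_mem_roots hM hm k).1, dihedralVec_nonneg hm hk⟩
  have hroots : ∀ β ∈ cs.roots, ∃ k : ℤ, β = dihedralVec m i j k := by
    rintro β ⟨w, l, rfl⟩
    induction w using cs.simple_induction_left with
    | one =>
      rw [geometricRep_one_apply]
      rcases hB l with rfl | rfl
      · exact ⟨0, (dihedralVec_zero hm).symm⟩
      · exact ⟨_, (dihedralVec_sub_one hm).symm⟩
    | mul_simple_left w a ih =>
      obtain ⟨k, hk⟩ := ih
      rw [geometricRep_mul_apply, hk]
      rcases hB a with rfl | rfl
      · exact ⟨_, geometricRep_dihedralVec hM hm k⟩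
      · exact ⟨_, geometricRep_dihedralVec' hM hm k⟩
  have hmod : ∀ k : ℤ, ∃ l < m, dihedralVec m i j k = dihedralVec m i j (l : ℕ) ∨
      dihedralVec m i j k = -dihedralVec m i j (l : ℕ) := by
    intro k
    have hm0 : (m : ℤ) ≠ 0 := by positivity
    refine ⟨(k % m).toNat, ?_, ?_⟩
    · have := Int.emod_lt_of_pos k (b := m) (by positivity)
      have := Int.emod_nonneg k hm0
      omega
    · rw [Int.toNat_of_nonneg (Int.emod_nonneg k hm0)]
      have key : ∀ (q : ℤ) (r : ℤ), dihedralVec m i j (r + m * q) = dihedralVec m i j r ∨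
          dihedralVec m i j (r + m * q) = -dihedralVec m i j r := by
        intro q r
        induction q using Int.induction_on with
        | zero => simp
        | succ q ih =>
          rw [mul_add, mul_one, ← add_assoc, dihedralVec_add_self hm, neg_inj,
            neg_eq_iff_eq_neg]
          exact ih.symm
        | pred q ih =>
          have h1 : r + (m : ℤ) * -q = r + m * (-q - 1) + m := by ring
          rw [h1, dihedralVec_add_self hm, neg_inj, neg_eq_iff_eq_neg] at ih
          exact ih.symm
      have := key (k / m) (k % m)
      rwa [Int.emod_add_mul_ediv] at this
  ext β
  simp only [mem_posRoots, Finset.mem_image, Finset.mem_range]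
  constructor
  · intro hβ
    obtain ⟨k, hk⟩ := hroots β hβ.1
    obtain ⟨l, hl, h | h⟩ := hmod k
    · exact ⟨l, hl, by rw [hk, h]⟩
    · exact absurd (hpos l hl) (by
        have := neg_notMem_positiveRoots hβ
        rwa [hk, h, neg_neg] at this)
  · rintro ⟨k, hk, rfl⟩
    exact hpos k hk

lemma sum_signCorr_sq_dihedral_row (hirr : M.IsIrreducible) (hM : M i j = m) (hm : 2 ≤ m)
    (hB : ∀ k, k = i ∨ k = j) :
    ∑ β ∈ cs.posRoots, cs.signCorr (Pi.single i 1) β ^ 2 = ((m : ℝ) ^ 2 + 2) / (3 * m) := by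
  have hm' : (0 : ℝ) < m := by positivity
  have hpi := Real.pi_pos
  rw [posRoots_eq_dihedralVec hM hm hB, Finset.sum_image (dihedralVec_injOn hM hm)]
  have h1 : ∀ k ∈ Finset.range m, cs.signCorr (Pi.single i 1) (dihedralVec m i j (k : ℕ)) ^ 2 =
      (1 - 2 * k / m) ^ 2 := by
    intro k hk
    rw [Finset.mem_range] at hk
    have hk' : (k : ℝ) ≤ m := by exact_mod_cast hk.le
    rw [signCorr_eq hirr (cs.single_mem_roots i) (dihedralVec_mem_roots hM hm k).1,
      cosForm_dihedralVec hM hm, mul_div_cancel_left₀ _ two_ne_zero, Int.cast_natCast,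
      Real.arccos_cos (by positivity) (by
        rw [← mul_div_assoc, div_le_iff₀ hm']; nlinarith)]
    field_simp
  rw [Finset.sum_congr rfl h1]
  have h2 : ∀ p : ℕ, ∑ k ∈ Finset.range p, (1 - 2 * (k : ℝ) / m) ^ 2 = (p : ℝ) -
      2 * (p * (p - 1)) / m + 2 * (p * (p - 1) * (2 * p - 1)) / (3 * (m : ℝ) ^ 2) := by
    intro p
    induction p with
    | zero => simp
    | succ p ih =>
      rw [Finset.sum_range_succ, ih]
      push_cast
      field_simp
      ring
  rw [h2]
  field_simp
  ring

theorem sum_signCorr_sq_dihedral (hirr : M.IsIrreducible) {h : ℕ} (hh : cs.IsCoxeterNumber h)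
    (hm : 2 ≤ m) (e : B ≃ Fin 2) (hM : M.reindex e = CoxeterMatrix.I (m - 2)) :
    1 / 16 * ∑ α ∈ cs.allRoots, ∑ β ∈ cs.allRoots, cs.signCorr α β ^ 2 =
      (Fintype.card B : ℝ) * (2 * (m : ℝ) ^ 2 - 5 * m + 6 + 5 * h + (h : ℝ) ^ 2) / 72 := by
  have hM' : ∀ i j, i ≠ j → M i j = m := by
    intro i j hij
    have h1 : M i j = CoxeterMatrix.I (m - 2) (e i) (e j) := by
      rw [← hM, CoxeterMatrix.reindex_apply, e.symm_apply_apply, e.symm_apply_apply]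
    have h2 : CoxeterMatrix.I (m - 2) (e i) (e j) = if e i = e j then 1 else m - 2 + 2 := rfl
    rw [h1, h2, if_neg (e.injective.ne hij)]
    omega
  have hB : ∀ i j : B, i ≠ j → ∀ k, k = i ∨ k = j := by
    intro i j hij k
    have h1 := e.injective.ne hij
    rw [← e.injective.eq_iff, ← e.injective.eq_iff (a := k)]
    omega
  have hex : ∀ i : B, ∃ j, i ≠ j := fun i => ⟨e.symm (e i + 1), fun h => by
    have := congrArg e h
    rw [e.apply_symm_apply] at this
    omega⟩
  have hrow : ∀ i, ∑ β ∈ cs.posRoots, cs.signCorr (Pi.single i 1) β ^ 2 =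
      ((m : ℝ) ^ 2 + 2) / (3 * m) := by
    intro i
    obtain ⟨j, hij⟩ := hex i
    exact sum_signCorr_sq_dihedral_row hirr (hM' i j hij) hm (hB i j hij)
  have hcard : cs.posRoots.card = m := by
    obtain ⟨j, hij⟩ := hex (e.symm 0)
    rw [posRoots_eq_dihedralVec (hM' _ j hij) hm (hB _ j hij),
      Finset.card_image_of_injOn (dihedralVec_injOn (hM' _ j hij) hm), Finset.card_range]
  have hcardB : Fintype.card B = 2 := by rw [Fintype.card_congr e, Fintype.card_fin]
  have h3 := cs.two_mul_card_posRoots hirr hh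
  rw [hcard, hcardB] at h3
  have hh' : h = m := by omega
  have hm' : (0 : ℝ) < m := by positivity
  rw [sum_signCorr_sq_of_simple hrow, hcard, hcardB, hh']
  field_simp
  ring

end CoxeterSystem

end

theorem mainTheorem5 {B W : Type*} [Fintype B] [DecidableEq B] [Group W] [Finite W]
    {M : CoxeterMatrix B} (cs : CoxeterSystem M W) (hirr : M.IsIrreducible)
    {Ω : Type*} [MeasurableSpace Ω] (μ : MeasureTheory.Measure Ω)
    [MeasureTheory.IsProbabilityMeasure μ] (X : Ω → ℕ) (hX : Measurable X)
    (hlaw : ∀ k : ℕ, μ.real (X ⁻¹' {k}) = (Nat.card {w : W // cs.length w = k} : ℝ) / Nat.card W) :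
    (∀ d : Fin (Fintype.card B) → ℕ, cs.IsDegrees d → ∀ r : ℕ, 1 ≤ r →
      ProbabilityTheory.cumulant (fun ω => (X ω : ℝ)) μ r =
        (bernoulli' r : ℝ) / r * ∑ i, ((d i : ℝ) ^ r - 1)) ∧
    ∫ ω, (X ω : ℝ) ∂μ = (cs.positiveRoots.ncard : ℝ) / 2 ∧
    (∀ (h : ℕ) (γ : ℝ), cs.IsCoxeterNumber h → cs.IsGamma γ →
      ProbabilityTheory.variance (fun ω => (X ω : ℝ)) μ =
        (Fintype.card B : ℝ) * (γ + 5 * h + (h : ℝ) ^ 2) / 72) := by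
  have := Fintype.ofFinite W
  refine ⟨fun d hd r hr => CoxeterSystem.cumulant_eq hirr hX hlaw hd hr, ?_, fun h γ hh hγ => ?_⟩
  · rw [CoxeterSystem.ncard_positiveRoots]
    exact CoxeterSystem.integral_eq hX hlaw
  · rw [CoxeterSystem.variance_eq hX hlaw]
    cases hγ with
    | weyl P b e f hf θ θs g g' hθ hθs hg hg' =>
      exact CoxeterSystem.sum_signCorr_sq_weyl hirr hh hf hθ hθs hg hg'
    | typeH3 e hM => exact CoxeterSystem.sum_signCorr_sq_H3 hirr hh e hM
    | typeH4 e hM => exact CoxeterSystem.sum_signCorr_sq_H4 hirr hh e hM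
    | typeI2 m hm e hM =>
      exact CoxeterSystem.sum_signCorr_sq_dihedral hirr hh (by omega) e hM
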